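/- Let $X$ be a compact smooth manifold of dimension $n$ (without boundary), oriented by a smooth volume form $\Omega>0$, and let $K\in C^\infty(X,\mathrm{End}(T_X))$ have $n$ distinct real eigenvalues at almost every point of $X$. For a smooth Riemannian metric $g$ put $f_g:=\log\frac{dV_g}{\Omega}$ and $$\mathrm{Ric}_g(\Omega):=\mathrm{Ric}(g)+\nabla_g\,d f_g,\qquad \mathrm{Ric}^*_g(\Omega):=g^{-1}\mathrm{Ric}_g(\Omega),$$ $$\mathcal W_\Omega(g):=\int_X\big[\mathrm{Tr}_g(\mathrm{Ric}_g(\Omega)-g)+2f_g\big]\,\Omega .$$ For an $\mathrm{End}(T_X)$-valued $1$-form $\alpha$ put $\mathrm{div}^\Omega_g\alpha:=\mathrm{Tr}_g(\nabla_g\alpha)-\alpha(\nabla_g f_g)$. Endomorphisms carry the scalar product $\langle B,C\rangle_g=\mathrm{Tr}(BC^T_g)$, where $C^T_g$ is the $g$-transpose, and $|\alpha|_g^2=\sum_k\langle\alpha(e_k),\alpha(e_k)\rangle_g$ for a $g$-orthonormal basis $(e_k)$. Fix a smooth Riemannian metric $g_0$ with curvature operator $\mathcal R_{g_0}$. Let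 $\mathbb T^K_{g_0}$ be the vector space of all smooth $g_0$-symmetric sections $A$ of $\mathrm{End}(T_X)$ such that $(\nabla_{g_0,\xi}A)\eta=(\nabla_{g_0,\eta}A)\xi$ for all tangent vectors $\xi,\eta$, and $[\nabla^p_{g_0}T,A]=0$ for $T=\mathcal R_{g_0}$, $T=K$ and all integers $p\ge0$. For $A\in\mathbb T^K_{g_0}$ let $g_A:=g_0e^{-2A}$, so that $A=-\tfrac12\log(g_0^{-1}g_A)$, and let $\mathbf W_\Omega(A):=\mathcal W_\Omega(g_A)$. (1) For all $A,V\in\mathbb T^K_{g_0}$ the function $t\mapsto\mathbf W_\Omega(A+tV)$ is of class $C^2$ on $\mathbb R$, and $$\frac{d^2}{dt^2}\Big|_{t=0}\mathbf W_\Omega(A+tV)=2\int_X\Big\langle\big[-e^A\,\mathrm{div}^\Omega_{g_0}(e^A\nabla_{g_0}A)+2e^{2A}\,\mathrm{Ric}^*_{g_0}(\Omega)\big]V,\,V\Big\rangle_{g_0}\Omega+2\int_X\big|\nabla_{g_0}(e^AV)\big|^2_{g_0}\,\Omega .$$ (2) If $\mathrm{Ric}_{g_0}(\Omega)>0$, then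 the set $$\mathbb T^{K,+}_{g_0}:=\Big\{A\in\mathbb T^K_{g_0}\ :\ \int_X|U\,\nabla_{g_0}A|^2_{g_0}\,\Omega\le\int_X\mathrm{Tr}\big[U^2\,\mathrm{Ric}^*_{g_0}(\Omega)\big]\,\Omega\quad\text{for all }U\in\mathbb T^K_{g_0}\Big\}$$ is convex, and $\mathbf W_\Omega$ is convex on it. -/

import Mathlib

set_option maxSynthPendingDepth 3

open scoped Manifold ContDiff

noncomputable section

namespace SolitonRicci

/-- The model space `ℝⁿ`.  For a manifold `X` modelled on `ℝⁿ`, Mathlib's tangent space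
`TangentSpace (𝓡 n) x` is by definition `ℝⁿ`, identified with `T_x X` through the preferred chart
at `x`.  Accordingly, tensor fields on `X` are written below as functions of `x : X` with values in
the tensors over `ℝⁿ`; smoothness is expressed in the tangent bundle. -/
abbrev E (n : ℕ) := EuclideanSpace ℝ (Fin n)

/-- The standard basis of `ℝⁿ`. -/
def e {n : ℕ} (i : Fin n) : E n := EuclideanSpace.single i 1

/-- The trace of an endomorphism. -/
def tr {n : ℕ} (B : E n →L[ℝ] E n) : ℝ := LinearMap.trace ℝ (E n) (B : E n →ₗ[ℝ] E n)

/-- The trace as a continuous linear form on endomorphisms. -/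
def trL (n : ℕ) : (E n →L[ℝ] E n) →L[ℝ] ℝ :=
  LinearMap.toContinuousLinearMap
    ((LinearMap.trace ℝ (E n)) ∘ₗ (ContinuousLinearMap.coeLM ℝ (M := E n) (N₃ := E n)))

theorem trL_apply {n : ℕ} (B : E n →L[ℝ] E n) : trL n B = tr B := rfl

/-- Continuous bilinear forms on `ℝⁿ`. -/
abbrev Bil (n : ℕ) := E n →L[ℝ] E n →L[ℝ] ℝ

/-- The exchange of the two arguments of a bilinear map. -/
def flipL (E₁ E₂ F : Type*) [NormedAddCommGroup E₁] [NormedSpace ℝ E₁]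
    [NormedAddCommGroup E₂] [NormedSpace ℝ E₂] [NormedAddCommGroup F] [NormedSpace ℝ F] :
    (E₁ →L[ℝ] E₂ →L[ℝ] F) →L[ℝ] (E₂ →L[ℝ] E₁ →L[ℝ] F) :=
  (ContinuousLinearMap.flipₗᵢ ℝ E₁ E₂ F).toContinuousLinearEquiv

theorem flipL_apply (E₁ E₂ F : Type*) [NormedAddCommGroup E₁] [NormedSpace ℝ E₁]
    [NormedAddCommGroup E₂] [NormedSpace ℝ E₂] [NormedAddCommGroup F] [NormedSpace ℝ F]
    (B : E₁ →L[ℝ] E₂ →L[ℝ] F) (u : E₁) (v : E₂) : flipL E₁ E₂ F B v u = B u v := rfl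

section Manifold

variable {n : ℕ} {X : Type*} [TopologicalSpace X] [ChartedSpace (E n) X] [IsManifold (𝓡 n) ∞ X]

/-- For `y` in the domain of the preferred chart at `x`, the differential at `y` of that chart,
as a map from `T_y X` to `ℝⁿ`. -/
def toChart (x y : X) : E n →L[ℝ] E n := tangentCoordChange (𝓡 n) y x y

/-- The inverse of `toChart x y`: it sends `u : ℝⁿ` to the value at `y` of the coordinate vector
field of the preferred chart at `x` with constant coefficients `u`. -/
def fromChart (x y : X) : E n →L[ℝ] E n := tangentCoordChange (𝓡 n) x y y

/-- The differential at `x` of a map to a normed space, as a linear map on `T_x X`. -/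
def diff {F : Type*} [NormedAddCommGroup F] [NormedSpace ℝ F] (f : X → F) (x : X) : E n →L[ℝ] F :=
  mfderiv (𝓡 n) 𝓘(ℝ, F) f x

/-! ### Fields on the manifold -/

variable (n X) in
/-- (Not necessarily smooth) sections of `End (T_X)`. -/
abbrev EndField := X → (E n →L[ℝ] E n)

variable (n X) in
/-- (Not necessarily smooth) sections of `T_X^* ⊗ T_X^*`. -/
abbrev BilField := X → Bil n

variable (n X) in
/-- `End (T_X)`-valued covariant tensor fields of degree `q`. -/
abbrev EndTensor (q : ℕ) := X → (Fin q → E n) → (E n →L[ℝ] E n)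

/-- Smoothness of a section of `End (T_X)`. -/
def SmoothEnd (A : EndField n X) : Prop :=
  ContMDiff (𝓡 n) ((𝓡 n).prod 𝓘(ℝ, E n →L[ℝ] E n)) ∞
    (fun x : X => Bundle.TotalSpace.mk' (E n →L[ℝ] E n)
      (E := fun x : X => TangentSpace (𝓡 n) x →L[ℝ] TangentSpace (𝓡 n) x) x (A x))

variable (n X) in
/-- The smooth Riemannian metrics on `X`. -/
abbrev Metric := Bundle.ContMDiffRiemannianMetric (𝓡 n) ∞ (E n)
  (fun x : X => TangentSpace (𝓡 n) x)

/-- The field of bilinear forms underlying a Riemannian metric. -/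
def Metric.field (g : Metric n X) : BilField n X := fun x => g.inner x

/-! ### Pointwise metric operations -/

/-- `v^*_g = g⁻¹ v`, i.e. `g (v^*_g ξ, η) = v (ξ, η)`. -/
def sharp (g v : BilField n X) : EndField n X := fun x => (g x).inverse ∘L v x

/-- The tangent vector `g⁻¹ θ` at `x`. -/
def raise (g : BilField n X) (x : X) (θ : E n →L[ℝ] ℝ) : E n := (g x).inverse θ

/-- The `g`-transpose of an endomorphism of `T_x X`. -/
def transpose (g : BilField n X) (x : X) (C : E n →L[ℝ] E n) : E n →L[ℝ] E n :=
  (g x).inverse ∘L ((ContinuousLinearMap.compL ℝ (E n) (E n) ℝ).flip C) ∘L g x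

/-- The scalar product `⟨B, C⟩_g = Tr (B C^T)` of endomorphisms of `T_x X`. -/
def innerEnd (g : BilField n X) (x : X) (B C : E n →L[ℝ] E n) : ℝ := tr (B ∘L transpose g x C)

/-- The covector `e_i^*` of the dual of the standard basis. -/
def dualBasis (i : Fin n) : E n →L[ℝ] ℝ := EuclideanSpace.proj i

/-- `|α|²_g = ∑ₖ ⟨α (eₖ), α (g⁻¹ eₖ^*)⟩_g` for an `End (T_X)`-valued 1-form `α` (the sum does not
depend on the basis; for a `g`-orthonormal basis it is `∑ₖ |α (eₖ)|²_g`). -/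
def normSq (g : BilField n X) (α : EndTensor n X 1) (x : X) : ℝ :=
  ∑ i : Fin n, innerEnd g x (α x ![e i]) (α x ![raise g x (dualBasis i)])

/-! ### Levi-Civita connection, curvature -/

/-- The metric in the coordinates of the preferred chart at `x`, as a function of `y`. -/
def metricCoord (g : BilField n X) (x y : X) : Bil n :=
  (g y).bilinearComp (fromChart x y) (fromChart x y)

/-- First coordinate derivatives of the metric in the preferred chart at `x`, at the point `y`:
`(u, v, w) ↦ ∂_u (g (v, w))`. -/
def metricDeriv (g : BilField n X) (x y : X) : E n →L[ℝ] Bil n :=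
  diff (metricCoord g x) y ∘L fromChart x y

/-- Christoffel symbols of the first kind in the preferred chart at `x`, at the point `y`:
`(u, v, w) ↦ (∂_u (g (v, w)) + ∂_v (g (u, w)) - ∂_w (g (u, v))) / 2`. -/
def christoffelLower (g : BilField n X) (x y : X) : E n →L[ℝ] Bil n :=
  let D : E n →L[ℝ] Bil n := metricDeriv g x y
  let Dflip : E n →L[ℝ] Bil n := D.flip
  let Dlast : E n →L[ℝ] Bil n := flipL (E n) (E n) ℝ ∘L Dflip
  (1 / 2 : ℝ) • (D + Dflip - Dlast)

theorem christoffelLower_apply (g : BilField n X) (x y : X) (u v w : E n) :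
    christoffelLower g x y u v w =
      1 / 2 * (metricDeriv g x y u v w + metricDeriv g x y v u w - metricDeriv g x y w u v) := rfl

/-- Christoffel symbols of the Levi-Civita connection of `g` in the preferred chart at `x`, at the
point `y`: `christoffel g x y u v` is the coordinate expression of `∇_u v` for the coordinate
vector fields with constant coefficients `u`, `v`. -/
def christoffel (g : BilField n X) (x y : X) : E n →L[ℝ] E n →L[ℝ] E n :=
  (ContinuousLinearMap.compL ℝ (E n) (E n →L[ℝ] ℝ) (E n) (metricCoord g x y).inverse) ∘L
    christoffelLower g x y

/-- The curvature tensor `R_g (u, v) = [∇_u, ∇_v] - ∇_{[u, v]}` at `x`, computed in the preferred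
chart at `x`: `R (u, v) = ∂_u Γ_v - ∂_v Γ_u + Γ_u Γ_v - Γ_v Γ_u`. -/
def riemann (g : BilField n X) (x : X) : E n →L[ℝ] E n →L[ℝ] E n →L[ℝ] E n :=
  let dΓ : E n →L[ℝ] E n →L[ℝ] E n →L[ℝ] E n := diff (christoffel g x) x
  let dΓflip : E n →L[ℝ] E n →L[ℝ] E n →L[ℝ] E n := dΓ.flip
  let ΓΓ : E n →L[ℝ] E n →L[ℝ] E n →L[ℝ] E n :=
    (ContinuousLinearMap.compL ℝ (E n) (E n) (E n)).bilinearComp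
      (christoffel g x x) (christoffel g x x)
  let ΓΓflip : E n →L[ℝ] E n →L[ℝ] E n →L[ℝ] E n := ΓΓ.flip
  dΓ - dΓflip + (ΓΓ - ΓΓflip)

theorem riemann_apply (g : BilField n X) (x : X) (u v w : E n) :
    riemann g x u v w =
      diff (christoffel g x) x u v w - diff (christoffel g x) x v u w
        + (christoffel g x x u (christoffel g x x v w)
          - christoffel g x x v (christoffel g x x u w)) := rfl

/-- The curvature as an `End (T_X)`-valued tensor field of degree 2. -/
def riemannTensor (g : BilField n X) : EndTensor n X 2 := fun x u => riemann g x (u 0) (u 1)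

/-- The Ricci tensor `Ric (v, w) = Tr (u ↦ R (u, v) w)`. -/
def ricci (g : BilField n X) : BilField n X := fun x =>
  (ContinuousLinearMap.compL ℝ (E n) (E n →L[ℝ] E n) ℝ (trL n)) ∘L
    flipL (E n) (E n) (E n) ∘L (riemann g x).flip

theorem ricci_apply (g : BilField n X) (x : X) (v w : E n) :
    ricci g x v w = tr (((riemann g x).flip v).flip w) := rfl

/-- The gradient `∇_g f`. -/
def grad (g : BilField n X) (f : X → ℝ) (x : X) : E n := raise g x (diff f x)

/-- The Hessian `∇_g d f`, i.e. `(u, v) ↦ ∂_u ∂_v f - df (Γ_u v)` in the preferred chart. -/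
def hessian (g : BilField n X) (f : X → ℝ) : BilField n X := fun x =>
  diff (fun y : X => diff f y ∘L fromChart x y) x
    - (ContinuousLinearMap.compL ℝ (E n) (E n) ℝ (diff f x)) ∘L christoffel g x x

theorem hessian_apply (g : BilField n X) (f : X → ℝ) (x : X) (u v : E n) :
    hessian g f x u v =
      diff (fun y : X => diff f y ∘L fromChart x y) x u v - diff f x (christoffel g x x u v) := rfl

/-- The covariant derivative of an `End (T_X)`-valued covariant tensor field, the direction of
differentiation being the first argument:
`(∇ τ) (u₀, u₁, …) = ∂_{u₀} (τ (u₁, …)) + [Γ_{u₀}, τ (u₁, …)] - ∑ⱼ τ (…, Γ_{u₀} uⱼ, …)`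
in the preferred chart. -/
def nabla (g : BilField n X) {q : ℕ} (τ : EndTensor n X q) : EndTensor n X (q + 1) := fun x u =>
  diff (fun y : X =>
      toChart x y ∘L τ y (fun j => fromChart x y (Fin.tail u j)) ∘L fromChart x y) x (u 0)
    + (christoffel g x x (u 0) ∘L τ x (Fin.tail u) - τ x (Fin.tail u) ∘L christoffel g x x (u 0))
    - ∑ j : Fin q,
        τ x (Function.update (Fin.tail u) j (christoffel g x x (u 0) (Fin.tail u j)))

/-- The iterated covariant derivative `∇^p τ`. -/
def nablaIter (g : BilField n X) {q : ℕ} (τ : EndTensor n X q) :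
    (p : ℕ) → EndTensor n X (q + p)
  | 0 => τ
  | p + 1 => nabla g (nablaIter g τ p)

/-- A section of `End (T_X)` as a tensor field of degree 0. -/
def EndField.tensor (A : EndField n X) : EndTensor n X 0 := fun x _ => A x

/-- The covariant derivative `∇_g A` of a section of `End (T_X)`. -/
def nablaEnd (g : BilField n X) (A : EndField n X) : EndTensor n X 1 :=
  nabla g (EndField.tensor A)

/-- The product `U α`, `(U α) (ξ) = U (α ξ)`, with a section `U` of `End (T_X)`. -/
def mulLeft (U : EndField n X) (α : EndTensor n X 1) : EndTensor n X 1 := fun x u => U x ∘L α x u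

/-- The divergence `div_g α = Tr_g (∇_g α)` of an `End (T_X)`-valued 1-form. -/
def divg (g : BilField n X) (α : EndTensor n X 1) : EndField n X := fun x =>
  ∑ i : Fin n, nabla g α x ![e i, raise g x (dualBasis i)]

/-! ### Volume forms -/

variable (n X) in
/-- A smooth volume form: a smooth nowhere vanishing form of degree `n`.  The manifold carries the
orientation for which the form is positive. -/
structure VolumeForm where
  /-- The value of the form at `x`, an alternating `n`-linear form on `T_x X`. -/
  form : X → (E n) [⋀^Fin n]→L[ℝ] ℝ
  /-- The coefficient of the form in each chart is smooth. -/
  smooth : ∀ x : X, ContMDiffOn (𝓡 n) 𝓘(ℝ, ℝ) ∞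
    (fun y : X => form y (fun i => fromChart x y (e i))) (chartAt (E n) x).source
  /-- The form vanishes nowhere. -/
  ne_zero : ∀ x : X, form x ≠ 0

namespace VolumeForm

variable [MeasurableSpace X]

/-- The measure `|ω| dx¹ … dxⁿ` on the domain of the preferred chart at `x`, where `ω` is the
coefficient of the volume form in this chart (extended by zero outside the chart). -/
def chartMeasure (Ω : VolumeForm n X) (x : X) : MeasureTheory.Measure X :=
  (((MeasureTheory.volume : MeasureTheory.Measure (E n)).restrict
      (chartAt (E n) x).target).withDensity
    (fun z => ENNReal.ofReal
      |Ω.form ((chartAt (E n) x).symm z)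
        (fun i => fromChart x ((chartAt (E n) x).symm z) (e i))|)).map (chartAt (E n) x).symm

/-- The measure `S ↦ ∫_S Ω` defined by the volume form with respect to its own orientation.  The
chart measures are the restrictions of one measure to the chart domains; as these cover `X`, that
measure is their supremum. -/
def measure (Ω : VolumeForm n X) : MeasureTheory.Measure X := ⨆ x : X, Ω.chartMeasure x

end VolumeForm

/-- The function `log (dV_g / Ω)`. -/
def logVol (Ω : VolumeForm n X) (g : BilField n X) (x : X) : ℝ :=
  Real.log (Real.sqrt (Matrix.of fun i j : Fin n => g x (e i) (e j)).det / |Ω.form x e|)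

/-- The `Ω`-Bakry-Emery-Ricci tensor `Ric_g (Ω) = Ric (g) + ∇_g d log (dV_g / Ω)`. -/
def ricciOmega (Ω : VolumeForm n X) (g : BilField n X) : BilField n X := fun x =>
  ricci g x + hessian g (logVol Ω g) x

/-- `Ric^*_g (Ω) = g⁻¹ Ric_g (Ω)`. -/
def ricciOmegaStar (Ω : VolumeForm n X) (g : BilField n X) : EndField n X :=
  sharp g (ricciOmega Ω g)

/-- The `Ω`-divergence `div^Ω_g α = div_g α - α (∇_g f)`, `f = log (dV_g / Ω)`. -/
def divOmega (Ω : VolumeForm n X) (g : BilField n X) (α : EndTensor n X 1) : EndField n X :=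
  fun x => divg g α x - α x ![grad g (logVol Ω g) x]

/-- Perelman's functional
`𝓦_Ω (g) = ∫_X [Tr_g (Ric_g (Ω) - g) + 2 log (dV_g / Ω)] Ω`. -/
def perelmanW [MeasurableSpace X] (Ω : VolumeForm n X) (g : BilField n X) : ℝ :=
  ∫ x, (tr (sharp g (fun y => ricciOmega Ω g y - g y) x) + 2 * logVol Ω g x) ∂Ω.measure

/-! ### The space `𝕋^K` and the change of variables -/

/-- The pointwise exponential `e^A` of a section of `End (T_X)`. -/
def expEnd (A : EndField n X) : EndField n X := fun x => NormedSpace.exp (A x)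

/-- The metric `g_A = g₀ e^{-2A}`, i.e. `g_A (u, v) = g₀ (e^{-2A} u, v)`; it corresponds to
`A = -½ log (g₀⁻¹ g_A)`. -/
def metricOf (g₀ : BilField n X) (A : EndField n X) : BilField n X := fun x =>
  g₀ x ∘L expEnd ((-2 : ℝ) • A) x

/-- The functional `𝐖_Ω (A) = 𝓦_Ω (g_A)`. -/
def boldW [MeasurableSpace X] (Ω : VolumeForm n X) (g₀ : Metric n X) (A : EndField n X) : ℝ :=
  perelmanW Ω (metricOf g₀.field A)

/-- The endomorphism `B` of `T_x X` has `n` distinct real eigenvalues. -/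
def HasDistinctEigenvalues (B : E n →L[ℝ] E n) : Prop :=
  ∃ ev : Fin n → ℝ, Function.Injective ev ∧
    ∀ i, Module.End.HasEigenvalue (B : E n →ₗ[ℝ] E n) (ev i)

/-- The space `𝕋^K_g = g⁻¹ 𝔽^K_g`: the sections `A = v^*_g` with `v = g A` a smooth symmetric
covariant 2-tensor such that `∇_{T_X, g} v^*_g = 0` and `[∇^p_g T, v^*_g] = 0` for `T = R_g, K` and
all `p ≥ 0`. -/
structure MemTK (g : Metric n X) (K A : EndField n X) : Prop where
  smooth : SmoothEnd A
  symm : ∀ (x : X) (u v : E n), g.field x (A x u) v = g.field x (A x v) u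
  closed : ∀ (x : X) (u v : E n),
    nablaEnd g.field A x ![u] v - nablaEnd g.field A x ![v] u = 0
  comm_curvature : ∀ (p : ℕ) (x : X) (u : Fin (2 + p) → E n),
    nablaIter g.field (riemannTensor g.field) p x u ∘L A x
      - A x ∘L nablaIter g.field (riemannTensor g.field) p x u = 0
  comm_center : ∀ (p : ℕ) (x : X) (u : Fin (0 + p) → E n),
    nablaIter g.field (EndField.tensor K) p x u ∘L A x
      - A x ∘L nablaIter g.field (EndField.tensor K) p x u = 0

/-- The space `𝕋^K_g` as a set of sections of `End (T_X)`. -/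
def TK (g : Metric n X) (K : EndField n X) : Set (EndField n X) := {A | MemTK g K A}

/-- The set `𝕋^{K,+}_g` of all `A ∈ 𝕋^K_g` such that
`∫_X |U ∇_g A|²_g Ω ≤ ∫_X Tr (U² Ric^*_g (Ω)) Ω` for all `U ∈ 𝕋^K_g`. -/
def TKplus [MeasurableSpace X] (Ω : VolumeForm n X) (g : Metric n X) (K : EndField n X) :
    Set (EndField n X) :=
  {A | A ∈ TK g K ∧ ∀ U ∈ TK g K,
    ∫ x, normSq g.field (mulLeft U (nablaEnd g.field A)) x ∂Ω.measure
      ≤ ∫ x, tr ((U x ∘L U x) ∘L ricciOmegaStar Ω g.field x) ∂Ω.measure}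

end Manifold

end SolitonRicci

end

set_option linter.unusedSectionVars false

noncomputable section

namespace SolitonRicci

open Filter Topology MeasureTheory

section

variable {n : ℕ}

/-! ### Linear algebra on the model space -/

/-! Two facts carry the theorem: the elements of `TK g K` and their covariant derivatives all
commute, and for A in this space the Levi-Civita connection of g e^{-2A} is that of g minus ∇A.

Commutation (`MemTK.cC`). The conditions on K with p = 0, 1 give [K, A] = 0 and [∇K, A] = 0, hence
[K, ∇A] = 0 by differentiation. Where K has n distinct real eigenvalues its commutant is abelian, so
A, V, ∇A, ∇V commute there. The set where a commutation fails is open, and nonempty open sets have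
positive measure, so the relations hold everywhere.

Change of metric. The connection Γ - ∇A is torsion free because ∇A is symmetric in its two
arguments, and it preserves g e^{-2A} because A is symmetric and commutes with ∇A (`lchr_gauge`).
Its curvature is R - [R, A] + [∇A, ∇A] = R (`lriem_gauge`), so the Ricci tensor does not move, while
log (dV/Ω) decreases by Tr A. Put D(A, V) = ∑ ∇_{e_i}A ∇_{e_i}V over an orthonormal basis (`dd`); it
is bilinear and symmetric. Then the trace of the Bakry-Emery tensor of g e^{-2A} is Tr(e^{2A}(Ric^*
+ D(A, A))) minus the Ω-divergence of e^{2A} ∇ Tr A (`tr_sharp_metricOf`), and the divergence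
theorem `integral_divV` leaves W(A) = ∫ Tr(e^{2A}(Ric^* + D(A, A))) + ∫ (2f - n) - 2 ∫ Tr A
(`boldW_eq`).

Second variation. Along A + tV the first integrand is the trace of e^{2tV} times a quadratic
polynomial in t. With r = Tr(e^{2A} V² Ric^*), a = Tr(e^{2A} V² D(A, A)), b = Tr(e^{2A} V D(A, V)),
c = Tr(e^{2A} D(V, V)), the second derivative at 0 is ∫ (4r + 4a + 8b + 2c) (`boldW_add_smul`). Now
|∇(e^A V)|² = a + 2b + c, and the Ω-divergence of V² e^{2A} ∇ Tr A is a + 2b + Tr(V² e^A div^Ω(e^A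
∇A)) (`CodPair.divV_field`). Subtracting twice the latter, whose integral vanishes, gives the
formula in (1).

Convexity. With U = e^A V, which again lies in `TK g K` (`MemTK.exp_comp`), completing the square
turns the same integrand into 4 Tr(U² Ric^*) - 4 |U ∇A|² + 2 |2U ∇A + e^A ∇V|²
(`CodPair.secondVar_ge`). The condition defining `TKplus`, tested on this U, makes its integral
nonnegative. The set `TKplus` is convex because |U ∇A|² is a nonnegative quadratic form in A. -/

theorem tr_add (B C : E n →L[ℝ] E n) : tr (B + C) = tr B + tr C := (trL n).map_add B C
theorem tr_sub (B C : E n →L[ℝ] E n) : tr (B - C) = tr B - tr C := (trL n).map_sub B C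
theorem tr_neg (B : E n →L[ℝ] E n) : tr (-B) = -tr B := (trL n).map_neg B
theorem tr_smul (c : ℝ) (B : E n →L[ℝ] E n) : tr (c • B) = c * tr B := (trL n).map_smul c B
theorem tr_zero : tr (0 : E n →L[ℝ] E n) = 0 := (trL n).map_zero
theorem tr_sum {ι : Type*} (s : Finset ι) (B : ι → E n →L[ℝ] E n) :
    tr (∑ i ∈ s, B i) = ∑ i ∈ s, tr (B i) := map_sum (trL n) B s
theorem tr_comm (B C : E n →L[ℝ] E n) : tr (B ∘L C) = tr (C ∘L B) :=
  LinearMap.trace_mul_comm ℝ (B : E n →ₗ[ℝ] E n) (C : E n →ₗ[ℝ] E n)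

theorem tr_eq_sum (B : E n →L[ℝ] E n) : tr B = ∑ i, B (e i) i := by
  rw [tr, LinearMap.trace_eq_matrix_trace ℝ (EuclideanSpace.basisFun (Fin n) ℝ).toBasis]
  simp [Matrix.trace, LinearMap.toMatrix_apply, e]

theorem tr_id : tr (ContinuousLinearMap.id ℝ (E n)) = n := by
  simp [tr_eq_sum, e]

theorem tr_conj {F T : E n →L[ℝ] E n} (h : F ∘L T = .id ℝ _) (B : E n →L[ℝ] E n) :
    tr (T ∘L B ∘L F) = tr B := by
  rw [tr_comm, ContinuousLinearMap.comp_assoc, h, ContinuousLinearMap.comp_id]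

theorem sum_coord (v : E n) : ∑ i, v i • e i = v := by
  simpa [e] using (EuclideanSpace.basisFun (Fin n) ℝ).sum_repr v

theorem dualBasis_apply (i : Fin n) (v : E n) : dualBasis i v = v i := rfl

/-- A symmetric positive definite bilinear form. -/
structure IsMet (G : Bil n) : Prop where
  symm : ∀ u v, G u v = G v u
  pos : ∀ v, v ≠ 0 → 0 < G v v

namespace IsMet

variable {G : Bil n}

theorem ext (h : IsMet G) {u v : E n} (H : ∀ w, G u w = G v w) : u = v := by
  by_contra hne
  have h1 := h.pos (u - v) (sub_ne_zero.2 hne)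
  have h2 : G (u - v) (u - v) = 0 := by
    rw [map_sub (G (u - v)), map_sub G, sub_apply, sub_apply, H, H]; ring
  exact h1.ne' h2

theorem isInvertible (h : IsMet G) : G.IsInvertible := by
  have hinj : Function.Injective (G : E n →ₗ[ℝ] (E n →L[ℝ] ℝ)) := by
    intro u v huv
    exact h.ext fun w => congrArg (fun L : E n →L[ℝ] ℝ => L w) huv
  have hfin : Module.finrank ℝ (E n) = Module.finrank ℝ (E n →L[ℝ] ℝ) := by
    rw [← LinearEquiv.finrank_eq (LinearMap.toContinuousLinearMap : (E n →ₗ[ℝ] ℝ) ≃ₗ[ℝ] _)]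
    exact (Subspace.dual_finrank_eq).symm
  refine ⟨(LinearEquiv.ofInjectiveOfFinrankEq _ hinj hfin).toContinuousLinearEquiv, ?_⟩
  ext u v
  rfl

theorem inverse_apply (h : IsMet G) (θ : E n →L[ℝ] ℝ) (w : E n) : G (G.inverse θ) w = θ w := by
  rw [h.isInvertible.self_apply_inverse]

theorem apply_inverse (h : IsMet G) (θ : E n →L[ℝ] ℝ) (w : E n) : G w (G.inverse θ) = θ w := by
  rw [h.symm, h.inverse_apply]

theorem inverse_self (h : IsMet G) (w : E n) : G.inverse (G w) = w :=
  h.isInvertible.inverse_apply_self w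

theorem inverse_symm (h : IsMet G) (θ η : E n →L[ℝ] ℝ) : θ (G.inverse η) = η (G.inverse θ) := by
  rw [← h.inverse_apply θ, h.symm, h.inverse_apply]

end IsMet

/-- The contraction `∑ᵢ b (eᵢ, G⁻¹ eᵢ^*)`. -/
theorem IsMet.sum_contr {G : Bil n} (h : IsMet G) (b : Bil n) :
    ∑ i, b (e i) (G.inverse (dualBasis i)) = tr (G.inverse ∘L b) := by
  rw [tr_eq_sum]
  refine Finset.sum_congr rfl fun i _ => ?_
  rw [h.inverse_symm]
  rfl

/-- The matrix of G⁻¹ is symmetric, so the contraction may raise either index, even for a form b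
that is not symmetric. -/
theorem IsMet.sum_contr_symm {G : Bil n} (h : IsMet G) (b : Bil n) :
    ∑ i, b (e i) (G.inverse (dualBasis i)) = ∑ i, b (G.inverse (dualBasis i)) (e i) := by
  have h1 : ∀ i, G.inverse (dualBasis i) = ∑ j, G.inverse (dualBasis i) j • e j :=
    fun i => (sum_coord _).symm
  have h5 : ∀ i j : Fin n, G.inverse (dualBasis i) j = G.inverse (dualBasis j) i := fun i j =>
    h.inverse_symm (dualBasis j) (dualBasis i)
  have h2 : ∀ i, b (e i) (G.inverse (dualBasis i)) =
      ∑ j, G.inverse (dualBasis i) j * b (e i) (e j) := fun i => by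
    conv_lhs => rw [h1 i]
    simp
  have h3 : ∀ i, b (G.inverse (dualBasis i)) (e i) =
      ∑ j, G.inverse (dualBasis i) j * b (e j) (e i) := fun i => by
    conv_lhs => rw [h1 i]
    simp
  simp_rw [h2, h3]
  rw [Finset.sum_comm]
  refine Finset.sum_congr rfl fun i _ => Finset.sum_congr rfl fun j _ => ?_
  rw [h5]

theorem IsMet.tr_eq {G : Bil n} (h : IsMet G) (B : E n →L[ℝ] E n) :
    tr B = ∑ i, G (B (e i)) (G.inverse (dualBasis i)) := by
  rw [tr_eq_sum]
  exact Finset.sum_congr rfl fun i _ => by rw [h.apply_inverse, dualBasis_apply]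

/-- The contraction formula writes both traces as contractions of (u, v) ↦ G(u, Cv), taken in the
two orders that `sum_contr_symm` identifies. -/
theorem IsMet.tr_eq_tr {G : Bil n} (h : IsMet G) {B C : E n →L[ℝ] E n}
    (H : ∀ u v, G (B u) v = G u (C v)) : tr B = tr C := by
  have h1 := h.sum_contr_symm (G.bilinearComp (.id ℝ _) C)
  simp only [ContinuousLinearMap.bilinearComp_apply, ContinuousLinearMap.id_apply] at h1
  rw [h.tr_eq B, h.tr_eq C]
  simp_rw [H]
  rw [h1]
  exact Finset.sum_congr rfl fun i _ => h.symm _ _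

/-- An endomorphism commuting with B preserves its eigenlines, so both C and C' are diagonal in an
eigenbasis of B. -/
theorem commute_of_distinctEigenvalues {B C C' : E n →L[ℝ] E n} (hB : HasDistinctEigenvalues B)
    (hC : Commute B C) (hC' : Commute B C') : Commute C C' := by
  obtain ⟨ev, hinj, hev⟩ := hB
  choose v hv using fun i => (hev i).exists_hasEigenvector
  have hli : LinearIndependent ℝ v :=
    Module.End.eigenvectors_linearIndependent' (B : E n →ₗ[ℝ] E n) ev hinj v hv
  let b := basisOfLinearIndependentOfCardEqFinrank' (b := v) hli (by simp)
  have hb : ∀ i, b i = v i := fun i => by simp [b]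
  have hBb : ∀ i, B (b i) = ev i • b i := fun i => by
    rw [hb]; exact (hv i).apply_eq_smul
  -- D bᵢ is again an eigenvector candidate for evᵢ; comparing j-th coordinates of B (D bᵢ) gives
  -- (evᵢ - evⱼ)(D bᵢ)ⱼ = 0.
  have key : ∀ D : E n →L[ℝ] E n, Commute B D → ∀ i, ∃ c : ℝ, D (b i) = c • b i := by
    intro D hD i
    refine ⟨b.repr (D (b i)) i, ?_⟩
    have h1 : B (D (b i)) = ev i • D (b i) := by
      have : (B * D) (b i) = (D * B) (b i) := by rw [hD.eq]
      simpa [hBb] using this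
    have h2 : ∀ w : E n, ∀ j, b.repr (B w) j = ev j * b.repr w j := by
      intro w j
      have : b.coord j ∘ₗ (B : E n →ₗ[ℝ] E n) = ev j • b.coord j := by
        refine b.ext fun k => ?_
        rcases eq_or_ne k j with rfl | hkj
        · simp [hBb]
        · simp [hBb, hkj]
      exact congrArg (fun L : E n →ₗ[ℝ] ℝ => L w) this
    apply b.repr.injective
    ext j
    rcases eq_or_ne i j with rfl | hij
    · simp
    · have h3 := h2 (D (b i)) j
      rw [h1] at h3
      have h4 : (ev i - ev j) * b.repr (D (b i)) j = 0 := by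
        rw [map_smul, Finsupp.smul_apply, smul_eq_mul] at h3
        linarith
      rcases mul_eq_zero.1 h4 with h | h
      · exact absurd (hinj (sub_eq_zero.1 h)) hij
      · simp [h, hij]
  have h5 : ((C * C' : E n →L[ℝ] E n) : E n →ₗ[ℝ] E n) = ((C' * C : E n →L[ℝ] E n) : E n →ₗ[ℝ] E n) := by
    refine b.ext fun i => ?_
    obtain ⟨c, hc⟩ := key C hC i
    obtain ⟨c', hc'⟩ := key C' hC' i
    simp [hc, hc', smul_comm c c']
  exact ContinuousLinearMap.coe_injective h5

end

section

variable {n : ℕ}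

/-! ### The exponential of endomorphisms -/

instance : NormedAlgebra ℚ (E n →L[ℝ] E n) := NormedAlgebra.restrictScalars ℚ ℝ _

theorem contDiff_exp_end {k : ℕ∞} :
    ContDiff ℝ k (NormedSpace.exp : (E n →L[ℝ] E n) → (E n →L[ℝ] E n)) :=
  contDiff_iff_contDiffAt.2 fun x => (NormedSpace.exp_analytic (𝕂 := ℝ) x).contDiffAt

theorem differentiableAt_exp_end (X : E n →L[ℝ] E n) : DifferentiableAt ℝ NormedSpace.exp X :=
  (NormedSpace.exp_analytic (𝕂 := ℝ) X).differentiableAt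

/-- Along the line X + sY the exponential factors as e^X e^{sY}, and the derivative in direction Y
only sees this line. -/
theorem fderiv_exp_of_commute {X Y : E n →L[ℝ] E n} (h : Commute X Y) :
    fderiv ℝ NormedSpace.exp X Y = NormedSpace.exp X * Y := by
  have h1 : HasDerivAt (fun s : ℝ => NormedSpace.exp (X + s • Y))
      (fderiv ℝ NormedSpace.exp X Y) 0 := by
    have h2 : HasDerivAt (fun s : ℝ => X + s • Y) Y 0 := by
      simpa using ((hasDerivAt_id (0 : ℝ)).smul_const Y).const_add X
    have h3 : HasFDerivAt NormedSpace.exp (fderiv ℝ NormedSpace.exp X) (X + (0 : ℝ) • Y) := by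
      simpa using (differentiableAt_exp_end X).hasFDerivAt
    exact h3.comp_hasDerivAt 0 h2
  have h4 : HasDerivAt (fun s : ℝ => NormedSpace.exp (X + s • Y)) (NormedSpace.exp X * Y) 0 := by
    have h5 : (fun s : ℝ => NormedSpace.exp (X + s • Y)) =
        fun s : ℝ => NormedSpace.exp X * NormedSpace.exp (s • Y) := by
      funext s
      exact NormedSpace.exp_add_of_commute (h.smul_right s)
    rw [h5]
    simpa using (hasDerivAt_exp_smul_const Y (0 : ℝ)).const_mul (NormedSpace.exp X)
  exact h1.unique h4

/-- Differentiating exp(e^{sc} X e^{-sc}) = e^{sc} e^X e^{-sc} at s = 0. No commutation is involved: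
this is the term by which a connection acts on e^A. -/
theorem fderiv_exp_bracket (c X : E n →L[ℝ] E n) :
    fderiv ℝ NormedSpace.exp X (c * X - X * c) =
      c * NormedSpace.exp X - NormedSpace.exp X * c := by
  have hd : ∀ Z : E n →L[ℝ] E n,
      HasDerivAt (fun s : ℝ => NormedSpace.exp (s • c) * Z * NormedSpace.exp (s • (-c)))
        (c * Z - Z * c) 0 := by
    intro Z
    have h1 := ((hasDerivAt_exp_smul_const c (0 : ℝ)).mul_const Z).mul
      (hasDerivAt_exp_smul_const (-c) (0 : ℝ))
    have h2 : c * Z - Z * c = NormedSpace.exp ((0 : ℝ) • c) * c * Z * NormedSpace.exp ((0 : ℝ) • -c) +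
        NormedSpace.exp ((0 : ℝ) • c) * Z * (NormedSpace.exp ((0 : ℝ) • -c) * -c) := by
      simp [sub_eq_add_neg]
    rw [h2]
    exact h1
  have h1 : HasDerivAt
      (fun s : ℝ => NormedSpace.exp (NormedSpace.exp (s • c) * X * NormedSpace.exp (s • (-c))))
      (fderiv ℝ NormedSpace.exp X (c * X - X * c)) 0 := by
    have h3 : HasFDerivAt NormedSpace.exp (fderiv ℝ NormedSpace.exp X)
        (NormedSpace.exp ((0 : ℝ) • c) * X * NormedSpace.exp ((0 : ℝ) • (-c))) := by
      simpa using (differentiableAt_exp_end X).hasFDerivAt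
    exact h3.comp_hasDerivAt 0 (hd X)
  have h2 : (fun s : ℝ =>
        NormedSpace.exp (NormedSpace.exp (s • c) * X * NormedSpace.exp (s • (-c)))) =
      fun s : ℝ => NormedSpace.exp (s • c) * NormedSpace.exp X * NormedSpace.exp (s • (-c)) := by
    funext s
    have hm : ∀ Y : E n →L[ℝ] E n, NormedSpace.exp Y * NormedSpace.exp (-Y) = 1 := fun Y => by
      rw [← NormedSpace.exp_add_of_commute (Commute.neg_right (Commute.refl Y)), add_neg_cancel,
        NormedSpace.exp_zero]
    let y : (E n →L[ℝ] E n)ˣ :=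
      ⟨NormedSpace.exp (s • c), NormedSpace.exp (s • (-c)), by rw [smul_neg]; exact hm _, by
        have := hm (s • (-c)); rwa [smul_neg, neg_neg, ← smul_neg] at this⟩
    exact NormedSpace.exp_units_conj y X
  rw [h2] at h1
  exact h1.unique (hd _)

/-- The covariant derivative of the exponential, in coordinates. -/
theorem fderiv_exp_add_bracket {c X Y : E n →L[ℝ] E n} (h : Commute X (Y + (c * X - X * c))) :
    fderiv ℝ NormedSpace.exp X Y + (c * NormedSpace.exp X - NormedSpace.exp X * c) =
      NormedSpace.exp X * (Y + (c * X - X * c)) := by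
  rw [← fderiv_exp_of_commute h, map_add, fderiv_exp_bracket]

theorem exp_smul_add_smul (A : E n →L[ℝ] E n) (s t : ℝ) :
    NormedSpace.exp ((s + t) • A) = NormedSpace.exp (s • A) * NormedSpace.exp (t • A) := by
  rw [add_smul, NormedSpace.exp_add_of_commute (((Commute.refl A).smul_left s).smul_right t)]

theorem exp_conj {F T : E n →L[ℝ] E n} (hFT : F * T = 1) (hTF : T * F = 1) (A : E n →L[ℝ] E n) :
    NormedSpace.exp (T * A * F) = T * NormedSpace.exp A * F :=
  NormedSpace.exp_units_conj (⟨T, F, hTF, hFT⟩ : (E n →L[ℝ] E n)ˣ) A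

/-! ### Determinants -/

/-- The Gram determinant of a bilinear form in the standard basis. -/
def detB (b : Bil n) : ℝ := (Matrix.of fun i j : Fin n => b (e i) (e j)).det

/-- The determinant of an endomorphism. -/
def detE (C : E n →L[ℝ] E n) : ℝ := (Matrix.of fun i j : Fin n => C (e i) j).det

theorem detE_eq_det (C : E n →L[ℝ] E n) : detE C = C.det := by
  rw [ContinuousLinearMap.det, ← LinearMap.det_toMatrix (EuclideanSpace.basisFun (Fin n) ℝ).toBasis,
    ← Matrix.det_transpose, detE]
  congr 1

theorem detE_mul (B C : E n →L[ℝ] E n) : detE (B * C) = detE B * detE C := by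
  simp only [detE_eq_det, ContinuousLinearMap.det]
  exact LinearMap.det_comp _ _

theorem detE_one : detE (1 : E n →L[ℝ] E n) = 1 := by
  rw [detE_eq_det]; exact LinearMap.det_id

theorem detB_comp (b : Bil n) (C : E n →L[ℝ] E n) : detB (b ∘L C) = detE C * detB b := by
  rw [detB, detE, detB, ← Matrix.det_mul]
  congr 1
  ext i j
  simp only [Matrix.of_apply, ContinuousLinearMap.comp_apply, Matrix.mul_apply]
  conv_lhs => rw [← sum_coord (C (e i))]
  simp

theorem detB_bilinearComp (b : Bil n) (F : E n →L[ℝ] E n) :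
    detB (b.bilinearComp F F) = detE F ^ 2 * detB b := by
  have h : ∀ b : Bil n, detB b.flip = detB b := fun b => by
    rw [detB, detB, ← Matrix.det_transpose]; rfl
  have : b.bilinearComp F F = ((b ∘L F).flip ∘L F).flip := by ext; rfl
  rw [this, h, detB_comp, h, detB_comp, sq, mul_assoc]

theorem contDiff_detB {k : ℕ∞ω} : ContDiff ℝ k (detB : Bil n → ℝ) := by
  unfold detB
  simp only [Matrix.det_apply, Matrix.of_apply]
  fun_prop

theorem contDiff_detE {k : ℕ∞ω} : ContDiff ℝ k (detE : (E n →L[ℝ] E n) → ℝ) := by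
  unfold detE
  simp only [Matrix.det_apply, Matrix.of_apply]
  fun_prop

theorem hasDerivAt_detE_one (C : E n →L[ℝ] E n) :
    HasDerivAt (fun s : ℝ => detE (1 + s • C)) (tr C) 0 := by
  -- `divX.divX` collects the coefficients of det(1 + X C) from degree two on, so the remainder is
  -- s² times a polynomial and only the trace survives in the derivative at 0.
  have h : (fun s : ℝ => detE (1 + s • C)) = fun s : ℝ =>
      1 + tr C * s + (Matrix.det (1 + (Polynomial.X : Polynomial ℝ) •
        (Matrix.of fun i j : Fin n => C (e i) j).map Polynomial.C)).divX.divX.eval s * s ^ 2 := by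
    funext s
    have h1 := Matrix.det_one_add_smul s (Matrix.of fun i j : Fin n => C (e i) j)
    have h2 : (1 + s • Matrix.of fun i j : Fin n => C (e i) j) =
        Matrix.of fun i j : Fin n => (1 + s • C) (e i) j := by
      ext i j
      simp [Matrix.one_apply, e, eq_comm]
    rw [h2] at h1
    rw [detE, h1, tr_eq_sum]
    rfl
  rw [h]
  set p := (Matrix.det (1 + (Polynomial.X : Polynomial ℝ) •
        (Matrix.of fun i j : Fin n => C (e i) j).map Polynomial.C)).divX.divX
  have h1 : HasDerivAt (fun s : ℝ => 1 + tr C * s) (tr C) 0 := by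
    simpa using ((hasDerivAt_id (0 : ℝ)).const_mul (tr C)).const_add 1
  have h2 := (p.hasDerivAt 0).mul (hasDerivAt_pow 2 (0 : ℝ))
  have h3 := h1.add h2
  have h4 : tr C + (Polynomial.eval 0 (Polynomial.derivative p) * (0 : ℝ) ^ 2 +
      Polynomial.eval 0 p * (((2 : ℕ) : ℝ) * 0 ^ (2 - 1))) = tr C := by simp
  rw [h4] at h3
  exact h3

theorem fderiv_detE_one (C : E n →L[ℝ] E n) : fderiv ℝ detE (1 : E n →L[ℝ] E n) C = tr C := by
  have h2 : HasDerivAt (fun s : ℝ => (1 : E n →L[ℝ] E n) + s • C) C 0 := by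
    simpa using ((hasDerivAt_id (0 : ℝ)).smul_const C).const_add (1 : E n →L[ℝ] E n)
  have h3 : HasFDerivAt detE (fderiv ℝ detE (1 : E n →L[ℝ] E n)) (1 + (0 : ℝ) • C) := by
    simpa using ((contDiff_detE (k := 1)).differentiable (by simp)).differentiableAt.hasFDerivAt
  have h4 := h3.comp_hasDerivAt 0 h2
  exact h4.unique (hasDerivAt_detE_one C)

/-- Jacobi's formula: G + sH = G ∘ (1 + s G⁻¹H), which reduces the derivative to that of the
determinant at the identity. -/
theorem fderiv_detB {G : Bil n} (hG : G.IsInvertible) (H : Bil n) :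
    fderiv ℝ detB G H = detB G * tr (G.inverse ∘L H) := by
  have h2 : HasDerivAt (fun s : ℝ => G + s • H) H 0 := by
    simpa using ((hasDerivAt_id (0 : ℝ)).smul_const H).const_add G
  have h3 : HasFDerivAt detB (fderiv ℝ detB G) (G + (0 : ℝ) • H) := by
    simpa using ((contDiff_detB (k := 1)).differentiable (by simp)).differentiableAt.hasFDerivAt
  have h4 : (fun s : ℝ => detB (G + s • H)) =
      fun s : ℝ => detE (1 + s • (G.inverse ∘L H)) * detB G := by
    funext s
    rw [← detB_comp]
    congr 1
    ext u v
    simp [hG.self_apply_inverse]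
  have h5 := (h3.comp_hasDerivAt 0 h2)
  have h6 := (hasDerivAt_detE_one (G.inverse ∘L H)).mul_const (detB G)
  rw [← h4] at h6
  rw [mul_comm]
  exact h5.unique h6

/-- By the one-parameter group law s ↦ det e^{sB} solves y' = (Tr B) y, so its product with e^{-s Tr
B} is constant; compare s = 1 with s = 0. -/
theorem detE_exp (B : E n →L[ℝ] E n) : detE (NormedSpace.exp B) = Real.exp (tr B) := by
  have h0 : HasDerivAt (fun s : ℝ => detE (NormedSpace.exp (s • B))) (tr B) 0 := by
    have h3 : HasFDerivAt detE (fderiv ℝ detE (1 : E n →L[ℝ] E n))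
        (NormedSpace.exp ((0 : ℝ) • B)) := by
      simpa using ((contDiff_detE (k := 1)).differentiable (by simp)).differentiableAt.hasFDerivAt
    have := h3.comp_hasDerivAt 0 (hasDerivAt_exp_smul_const B (0 : ℝ))
    rwa [zero_smul, NormedSpace.exp_zero, one_mul, fderiv_detE_one] at this
  have h1 : ∀ t : ℝ, HasDerivAt (fun s : ℝ => detE (NormedSpace.exp (s • B)))
      (detE (NormedSpace.exp (t • B)) * tr B) t := by
    intro t
    have h2 : (fun s : ℝ => detE (NormedSpace.exp (s • B))) =
        fun s : ℝ => detE (NormedSpace.exp (t • B)) * detE (NormedSpace.exp ((s - t) • B)) := by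
      funext s
      rw [← detE_mul, ← exp_smul_add_smul, add_sub_cancel]
    rw [h2]
    refine HasDerivAt.const_mul _ ?_
    have h3 : HasDerivAt (fun s : ℝ => s - t) 1 t := (hasDerivAt_id t).sub_const t
    have h4 : HasDerivAt (fun s : ℝ => detE (NormedSpace.exp (s • B))) (tr B) (t - t) := by
      rwa [sub_self]
    have h5 := HasDerivAt.comp (h₂ := fun s : ℝ => detE (NormedSpace.exp (s • B)))
      (h := fun s : ℝ => s - t) t h4 h3
    rw [mul_one] at h5
    exact h5
  have h2 : ∀ t : ℝ, HasDerivAt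
      (fun s : ℝ => detE (NormedSpace.exp (s • B)) * Real.exp (-(s * tr B))) 0 t := by
    intro t
    have h3 : HasDerivAt (fun s : ℝ => -(s * tr B)) (-(1 * tr B)) t :=
      ((hasDerivAt_id t).mul_const (tr B)).neg
    have h4 := (h1 t).mul h3.exp
    have h5 : detE (NormedSpace.exp (t • B)) * tr B * Real.exp (-(t * tr B)) +
        detE (NormedSpace.exp (t • B)) * (Real.exp (-(t * tr B)) * -(1 * tr B)) = 0 := by ring
    rw [h5] at h4
    exact h4
  have h3 := is_const_of_deriv_eq_zero (fun t => (h2 t).differentiableAt)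
    (fun t => (h2 t).deriv) 1 0
  simp only [one_smul, zero_smul, NormedSpace.exp_zero, detE_one, one_mul, zero_mul, neg_zero,
    Real.exp_zero] at h3
  rw [← mul_one (detE _), ← Real.exp_zero, ← neg_add_cancel (tr B), Real.exp_add, ← mul_assoc, h3,
    one_mul]

theorem IsMet.detB_pos {G : Bil n} (h : IsMet G) : 0 < detB G := by
  refine Matrix.PosDef.det_pos (Matrix.PosDef.of_dotProduct_mulVec_pos ?_ ?_)
  · ext i j
    simp [h.symm (e i) (e j)]
  · intro x hx
    have h1 : 0 < G (∑ i, x i • e i) (∑ i, x i • e i) := by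
      refine h.pos _ fun h0 => hx ?_
      have : (∑ i, x i • e i : E n) = WithLp.toLp 2 x := by
        conv_rhs => rw [← sum_coord (WithLp.toLp 2 x)]
      rw [this] at h0
      funext i
      exact congrArg (fun v : E n => v i) h0
    simp only [map_sum, map_smul, sum_apply, smul_apply, smul_eq_mul] at h1
    refine h1.trans_eq ?_
    simp only [dotProduct, Matrix.mulVec, Matrix.of_apply, Pi.star_apply, star_trivial]
    refine Finset.sum_congr rfl fun i _ => congrArg _ (Finset.sum_congr rfl fun j _ => ?_)
    rw [h.symm, mul_comm]

end

section

variable {n : ℕ}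

/-! ### Levi-Civita connection in coordinates -/

theorem fderiv_apply_const {W E₁ E₂ : Type*} [NormedAddCommGroup W] [NormedSpace ℝ W]
    [NormedAddCommGroup E₁] [NormedSpace ℝ E₁] [NormedAddCommGroup E₂] [NormedSpace ℝ E₂]
    {f : W → E₁ →L[ℝ] E₂} {z : W} (hf : DifferentiableAt ℝ f z) (v : E₁) (u : W) :
    fderiv ℝ (fun z => f z v) z u = fderiv ℝ f z u v := by
  rw [(hf.hasFDerivAt.clm_apply (hasFDerivAt_const v z)).fderiv]
  simp

theorem fderiv_apply_const₂ {f : E n → Bil n} {z : E n} (hf : DifferentiableAt ℝ f z)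
    (u v w : E n) : fderiv ℝ (fun z => f z v w) z u = fderiv ℝ f z u v w := by
  rw [fderiv_apply_const (f := fun z => f z v) (hf.clm_apply (differentiableAt_const v)),
    fderiv_apply_const hf]

/-- Christoffel symbols of the first kind in terms of the derivatives of the metric. -/
def kosz (D : E n →L[ℝ] Bil n) : E n →L[ℝ] Bil n :=
  (1 / 2 : ℝ) • (D + D.flip - flipL (E n) (E n) ℝ ∘L D.flip)

theorem kosz_apply (D : E n →L[ℝ] Bil n) (u v w : E n) :
    kosz D u v w = 1 / 2 * (D u v w + D v u w - D w u v) := rfl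

/-- Christoffel symbols of a field of bilinear forms on the model space. -/
def lchr (G : E n → Bil n) (z : E n) : E n →L[ℝ] E n →L[ℝ] E n :=
  (ContinuousLinearMap.compL ℝ (E n) (E n →L[ℝ] ℝ) (E n) (G z).inverse) ∘L kosz (fderiv ℝ G z)

theorem lchr_lower {G : E n → Bil n} {z : E n} (hG : IsMet (G z)) (u v w : E n) :
    G z (lchr G z u v) w =
      1 / 2 * (fderiv ℝ G z u v w + fderiv ℝ G z v u w - fderiv ℝ G z w u v) := by
  have : lchr G z u v = (G z).inverse (kosz (fderiv ℝ G z) u v) := rfl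
  rw [this, hG.inverse_apply, kosz_apply]

/-- Uniqueness of the Levi-Civita connection: symmetry and metric compatibility force the Koszul
formula. The change of coordinates and the change of metric are both handled by exhibiting a
candidate T. -/
theorem lchr_unique {G : E n → Bil n} {z : E n} (hG : IsMet (G z)) {T : E n → E n → E n}
    (hT : ∀ u v, T u v = T v u)
    (hc : ∀ u v w, fderiv ℝ G z u v w = G z (T u v) w + G z v (T u w)) (u v : E n) :
    lchr G z u v = T u v := by
  refine hG.ext fun w => ?_
  rw [lchr_lower hG, hc, hc, hc, hT v u, hT w u, hT w v, hG.symm (T u w) v, hG.symm u (T v w)]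
  ring

theorem fderiv_met_symm {G : E n → Bil n} {z : E n} (hd : DifferentiableAt ℝ G z)
    (hG : ∀ᶠ z' in 𝓝 z, IsMet (G z')) (u v w : E n) :
    fderiv ℝ G z u v w = fderiv ℝ G z u w v := by
  rw [← fderiv_apply_const₂ hd, ← fderiv_apply_const₂ hd]
  have : (fun z => G z v w) =ᶠ[𝓝 z] fun z => G z w v := hG.mono fun z' h => h.symm v w
  rw [this.fderiv_eq]

theorem lchr_symm {G : E n → Bil n} {z : E n} (hd : DifferentiableAt ℝ G z)
    (hG : ∀ᶠ z' in 𝓝 z, IsMet (G z')) (u v : E n) : lchr G z u v = lchr G z v u := by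
  refine hG.self_of_nhds.ext fun w => ?_
  rw [lchr_lower hG.self_of_nhds, lchr_lower hG.self_of_nhds, fderiv_met_symm hd hG w u v]
  ring

theorem lchr_compat {G : E n → Bil n} {z : E n} (hd : DifferentiableAt ℝ G z)
    (hG : ∀ᶠ z' in 𝓝 z, IsMet (G z')) (u v w : E n) :
    fderiv ℝ G z u v w = G z (lchr G z u v) w + G z v (lchr G z u w) := by
  rw [hG.self_of_nhds.symm v, lchr_lower hG.self_of_nhds, lchr_lower hG.self_of_nhds,
    fderiv_met_symm hd hG u w v]
  ring

theorem fderiv_comp₂ {G1 : E n → Bil n} {φ : E n → E n} {z : E n} {α β : E n → E n}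
    (hd1 : DifferentiableAt ℝ G1 (φ z)) (hφ : DifferentiableAt ℝ φ z)
    (hα : DifferentiableAt ℝ α z) (hβ : DifferentiableAt ℝ β z) (u : E n) :
    fderiv ℝ (fun z' => G1 (φ z') (α z') (β z')) z u =
      fderiv ℝ G1 (φ z) (fderiv ℝ φ z u) (α z) (β z) + G1 (φ z) (fderiv ℝ α z u) (β z) +
        G1 (φ z) (α z) (fderiv ℝ β z u) := by
  have h1 : HasFDerivAt (fun z' => G1 (φ z')) (fderiv ℝ G1 (φ z) ∘L fderiv ℝ φ z) z :=
    hd1.hasFDerivAt.comp z hφ.hasFDerivAt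
  rw [((h1.clm_apply hα.hasFDerivAt).clm_apply hβ.hasFDerivAt).fderiv]
  simp
  ring

theorem two_le_infty : minSmoothness ℝ 2 ≤ (∞ : ℕ∞ω) := by
  simp only [minSmoothness_of_isRCLikeNormedField]
  exact (WithTop.coe_le_coe.2 (le_top : (2 : ℕ∞) ≤ ⊤) : ((2 : ℕ∞) : ℕ∞ω) ≤ _)

/-- Data of a change of coordinates `φ` near `z`, with `N` the inverse of its differential. -/
structure IsTrans (φ : E n → E n) (z : E n) (N : E n →L[ℝ] E n) : Prop where
  smooth : ContDiffAt ℝ ∞ φ z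
  left : ∀ u, N (fderiv ℝ φ z u) = u
  right : ∀ u, fderiv ℝ φ z (N u) = u

namespace IsTrans

variable {φ : E n → E n} {z : E n} {N : E n →L[ℝ] E n}

theorem smooth' (h : IsTrans φ z N) : ContDiffAt ℝ ∞ (fderiv ℝ φ) z :=
  h.smooth.fderiv_right (m := ∞) (by simp)

theorem smooth'' (h : IsTrans φ z N) : ContDiffAt ℝ ∞ (fderiv ℝ (fderiv ℝ φ)) z :=
  h.smooth'.fderiv_right (m := ∞) (by simp)

theorem diff (h : IsTrans φ z N) : DifferentiableAt ℝ φ z := h.smooth.differentiableAt (by simp)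

theorem diff' (h : IsTrans φ z N) : DifferentiableAt ℝ (fderiv ℝ φ) z :=
  h.smooth'.differentiableAt (by simp)

theorem diff'' (h : IsTrans φ z N) : DifferentiableAt ℝ (fderiv ℝ (fderiv ℝ φ)) z :=
  h.smooth''.differentiableAt (by simp)

theorem symm (h : IsTrans φ z N) (u v : E n) :
    fderiv ℝ (fderiv ℝ φ) z u v = fderiv ℝ (fderiv ℝ φ) z v u :=
  h.smooth.isSymmSndFDerivAt two_le_infty u v

theorem symm' (h : IsTrans φ z N) (u v w : E n) :
    fderiv ℝ (fderiv ℝ (fderiv ℝ φ)) z u v w = fderiv ℝ (fderiv ℝ (fderiv ℝ φ)) z v u w := by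
  have := h.smooth'.isSymmSndFDerivAt two_le_infty u v
  rw [this]

end IsTrans

/-- The pulled back connection is symmetric because the second derivative of φ is, and compatible
with G0 by the chain rule applied to G0 = φ^*G1; `lchr_unique` concludes. -/
theorem lchr_transform {G0 G1 : E n → Bil n} {φ : E n → E n} {z : E n} {N : E n →L[ℝ] E n}
    (hφ : IsTrans φ z N) (hd0 : DifferentiableAt ℝ G0 z) (hd1 : DifferentiableAt ℝ G1 (φ z))
    (hm0 : IsMet (G0 z)) (hm1 : ∀ᶠ w in 𝓝 (φ z), IsMet (G1 w))
    (h : ∀ᶠ z' in 𝓝 z, ∀ u v, G0 z' u v = G1 (φ z') (fderiv ℝ φ z' u) (fderiv ℝ φ z' v))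
    (u v : E n) :
    fderiv ℝ φ z (lchr G0 z u v) =
      lchr G1 (φ z) (fderiv ℝ φ z u) (fderiv ℝ φ z v) + fderiv ℝ (fderiv ℝ φ) z u v := by
  have key := lchr_unique hm0 (T := fun u v =>
    N (lchr G1 (φ z) (fderiv ℝ φ z u) (fderiv ℝ φ z v) + fderiv ℝ (fderiv ℝ φ) z u v))
    (fun u v => by rw [lchr_symm hd1 hm1, hφ.symm]) (fun u v w => by
      have h1 : (fun z => G0 z v w) =ᶠ[𝓝 z]
          fun z' => G1 (φ z') (fderiv ℝ φ z' v) (fderiv ℝ φ z' w) := h.mono fun z' hz => hz v w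
      rw [← fderiv_apply_const₂ hd0, h1.fderiv_eq, fderiv_comp₂ hd1 hφ.diff
        (hφ.diff'.clm_apply (differentiableAt_const _))
        (hφ.diff'.clm_apply (differentiableAt_const _)), fderiv_apply_const hφ.diff',
        fderiv_apply_const hφ.diff', h.self_of_nhds, h.self_of_nhds, hφ.right, hφ.right,
        lchr_compat hd1 hm1]
      simp only [map_add, add_apply]
      ring) u v
  rw [key, hφ.right]

/-- The covariant derivative of a field of endomorphisms, in coordinates. -/
def lnab (Γ : E n → E n →L[ℝ] E n →L[ℝ] E n) (A : E n → E n →L[ℝ] E n) (z : E n) :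
    E n →L[ℝ] E n →L[ℝ] E n :=
  fderiv ℝ A z + ((ContinuousLinearMap.compL ℝ (E n) (E n) (E n)).flip (A z)
    - ContinuousLinearMap.compL ℝ (E n) (E n) (E n) (A z)) ∘L Γ z

theorem lnab_apply (Γ : E n → E n →L[ℝ] E n →L[ℝ] E n) (A : E n → E n →L[ℝ] E n) (z u : E n) :
    lnab Γ A z u = fderiv ℝ A z u + (Γ z u ∘L A z - A z ∘L Γ z u) := rfl

/-- The covariant derivative of a vector field, in coordinates. -/
def lnabV (Γ : E n → E n →L[ℝ] E n →L[ℝ] E n) (Y : E n → E n) (z : E n) : E n →L[ℝ] E n :=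
  fderiv ℝ Y z + (Γ z).flip (Y z)

theorem lnabV_apply (Γ : E n → E n →L[ℝ] E n →L[ℝ] E n) (Y : E n → E n) (z u : E n) :
    lnabV Γ Y z u = fderiv ℝ Y z u + Γ z u (Y z) := rfl

/-! ### Covariant derivatives and Hessians under a change of coordinates -/

section transform

variable {Γ0 Γ1 : E n → E n →L[ℝ] E n →L[ℝ] E n} {φ : E n → E n} {z : E n} {N : E n →L[ℝ] E n}

/-- Differentiating dφ ∘ A0 = A1 ∘ dφ produces second derivatives of φ, which cancel against the
inhomogeneous terms in the transformation law of Γ. -/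
theorem lnab_transform (hφ : IsTrans φ z N)
    (hΓ : ∀ u v, fderiv ℝ φ z (Γ0 z u v) =
      Γ1 (φ z) (fderiv ℝ φ z u) (fderiv ℝ φ z v) + fderiv ℝ (fderiv ℝ φ) z u v)
    {A0 A1 : E n → E n →L[ℝ] E n} (hA0 : DifferentiableAt ℝ A0 z)
    (hA1 : DifferentiableAt ℝ A1 (φ z))
    (h : ∀ᶠ z' in 𝓝 z, ∀ u, fderiv ℝ φ z' (A0 z' u) = A1 (φ z') (fderiv ℝ φ z' u)) (u v : E n) :
    fderiv ℝ φ z (lnab Γ0 A0 z u v) = lnab Γ1 A1 (φ z) (fderiv ℝ φ z u) (fderiv ℝ φ z v) := by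
  have h1 : (fun z' => fderiv ℝ φ z' (A0 z' v)) =ᶠ[𝓝 z]
      fun z' => A1 (φ z') (fderiv ℝ φ z' v) := h.mono fun z' hz => hz v
  have h2 := congrArg (fun L : E n →L[ℝ] E n => L u) h1.fderiv_eq
  have hA1' : HasFDerivAt (fun z' => A1 (φ z')) (fderiv ℝ A1 (φ z) ∘L fderiv ℝ φ z) z :=
    hA1.hasFDerivAt.comp z hφ.diff.hasFDerivAt
  rw [(hφ.diff'.hasFDerivAt.clm_apply (hA0.hasFDerivAt.clm_apply (hasFDerivAt_const v z))).fderiv,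
    (hA1'.clm_apply (hφ.diff'.hasFDerivAt.clm_apply (hasFDerivAt_const v z))).fderiv] at h2
  simp only [add_apply, ContinuousLinearMap.comp_apply, ContinuousLinearMap.flip_apply,
    zero_apply, map_zero, zero_add] at h2
  simp only [lnab_apply, add_apply, sub_apply, ContinuousLinearMap.comp_apply, map_add, map_sub,
    hΓ, ← h.self_of_nhds]
  rw [eq_sub_of_add_eq h2, h.self_of_nhds (Γ0 z u v), hΓ, map_add]
  abel

theorem lnabV_transform (hφ : IsTrans φ z N)
    (hΓ : ∀ u v, fderiv ℝ φ z (Γ0 z u v) =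
      Γ1 (φ z) (fderiv ℝ φ z u) (fderiv ℝ φ z v) + fderiv ℝ (fderiv ℝ φ) z u v)
    {Y0 Y1 : E n → E n} (hY0 : DifferentiableAt ℝ Y0 z)
    (hY1 : DifferentiableAt ℝ Y1 (φ z))
    (h : ∀ᶠ z' in 𝓝 z, fderiv ℝ φ z' (Y0 z') = Y1 (φ z')) (u : E n) :
    fderiv ℝ φ z (lnabV Γ0 Y0 z u) = lnabV Γ1 Y1 (φ z) (fderiv ℝ φ z u) := by
  have h1 : (fun z' => fderiv ℝ φ z' (Y0 z')) =ᶠ[𝓝 z] fun z' => Y1 (φ z') := h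
  have h2 := congrArg (fun L : E n →L[ℝ] E n => L u) h1.fderiv_eq
  have hY1' : HasFDerivAt (fun z' => Y1 (φ z')) (fderiv ℝ Y1 (φ z) ∘L fderiv ℝ φ z) z :=
    hY1.hasFDerivAt.comp z hφ.diff.hasFDerivAt
  rw [(hφ.diff'.hasFDerivAt.clm_apply hY0.hasFDerivAt).fderiv, hY1'.fderiv] at h2
  simp only [add_apply, ContinuousLinearMap.comp_apply, ContinuousLinearMap.flip_apply] at h2
  simp only [lnabV_apply, map_add, hΓ, ← h.self_of_nhds]
  rw [eq_sub_of_add_eq h2]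
  abel

/-- The Hessian in coordinates. -/
theorem lhess_transform (hφ : IsTrans φ z N)
    (hΓ : ∀ u v, fderiv ℝ φ z (Γ0 z u v) =
      Γ1 (φ z) (fderiv ℝ φ z u) (fderiv ℝ φ z v) + fderiv ℝ (fderiv ℝ φ) z u v)
    {h0 h1 : E n → ℝ} (hd0 : DifferentiableAt ℝ (fderiv ℝ h0) z)
    (hd1 : ContDiffAt ℝ ∞ h1 (φ z)) (h : h0 =ᶠ[𝓝 z] h1 ∘ φ) (u v : E n) :
    fderiv ℝ (fderiv ℝ h0) z u v - fderiv ℝ h0 z (Γ0 z u v) =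
      fderiv ℝ (fderiv ℝ h1) (φ z) (fderiv ℝ φ z u) (fderiv ℝ φ z v) -
        fderiv ℝ h1 (φ z) (Γ1 (φ z) (fderiv ℝ φ z u) (fderiv ℝ φ z v)) := by
  have hd1' : DifferentiableAt ℝ (fderiv ℝ h1) (φ z) :=
    (hd1.fderiv_right (m := ∞) (by simp)).differentiableAt (by simp)
  have e0 : ∀ᶠ z' in 𝓝 z, ContDiffAt ℝ 1 φ z' ∧ ContDiffAt ℝ 1 h1 (φ z') := by
    exact ((hφ.smooth.of_le (m := 1) (by simp)).eventually (by simp)).and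
      (hφ.smooth.continuousAt.eventually ((hd1.of_le (m := 1) (by simp)).eventually (by simp)))
  have e1 : ∀ᶠ z' in 𝓝 z, fderiv ℝ h0 z' = fderiv ℝ h1 (φ z') ∘L fderiv ℝ φ z' := by
    filter_upwards [e0, h.eventuallyEq_nhds] with z' ⟨hz1, hz2⟩ hz3
    rw [hz3.fderiv_eq, fderiv_comp _ (hz2.differentiableAt (by simp))
      (hz1.differentiableAt (by simp))]
  have e2 : (fun z' => fderiv ℝ h0 z' v) =ᶠ[𝓝 z] fun z' => fderiv ℝ h1 (φ z') (fderiv ℝ φ z' v) :=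
    e1.mono fun z' hz => by simp only [hz]; rfl
  have e3 : HasFDerivAt (fun z' => fderiv ℝ h1 (φ z')) (fderiv ℝ (fderiv ℝ h1) (φ z) ∘L fderiv ℝ φ z) z :=
    hd1'.hasFDerivAt.comp z hφ.diff.hasFDerivAt
  rw [← fderiv_apply_const hd0, e2.fderiv_eq,
    (e3.clm_apply (hφ.diff'.hasFDerivAt.clm_apply (hasFDerivAt_const v z))).fderiv,
    e1.self_of_nhds]
  simp [hΓ]
  ring

end transform

end

section

variable {n : ℕ}

/-! ### Curvature in coordinates -/

/-- The curvature of a connection form `Γ`, in terms of `Γ` and its derivative. -/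
def curvOp (dΓ : E n →L[ℝ] E n →L[ℝ] E n →L[ℝ] E n) (Γ : E n →L[ℝ] E n →L[ℝ] E n) :
    E n →L[ℝ] E n →L[ℝ] E n →L[ℝ] E n :=
  let ΓΓ : E n →L[ℝ] E n →L[ℝ] E n →L[ℝ] E n :=
    (ContinuousLinearMap.compL ℝ (E n) (E n) (E n)).bilinearComp Γ Γ
  dΓ - dΓ.flip + (ΓΓ - ΓΓ.flip)

theorem curvOp_apply (dΓ : E n →L[ℝ] E n →L[ℝ] E n →L[ℝ] E n) (Γ : E n →L[ℝ] E n →L[ℝ] E n)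
    (u v : E n) : curvOp dΓ Γ u v = dΓ u v - dΓ v u + (Γ u ∘L Γ v - Γ v ∘L Γ u) := rfl

/-- The Ricci contraction of a curvature tensor. -/
def ricOp (R : E n →L[ℝ] E n →L[ℝ] E n →L[ℝ] E n) : Bil n :=
  (ContinuousLinearMap.compL ℝ (E n) (E n →L[ℝ] E n) ℝ (trL n)) ∘L
    flipL (E n) (E n) (E n) ∘L R.flip

theorem ricOp_apply (R : E n →L[ℝ] E n →L[ℝ] E n →L[ℝ] E n) (v w : E n) :
    ricOp R v w = tr ((R.flip v).flip w) := rfl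

theorem ricOp_transform {R0 R1 : E n →L[ℝ] E n →L[ℝ] E n →L[ℝ] E n} {M N : E n →L[ℝ] E n}
    (hNM : ∀ u, N (M u) = u) (hMN : ∀ u, M (N u) = u)
    (h : ∀ u v w, M (R0 u v w) = R1 (M u) (M v) (M w)) (v w : E n) :
    ricOp R0 v w = ricOp R1 (M v) (M w) := by
  rw [ricOp_apply, ricOp_apply,
    ← tr_conj (F := M) (T := N) (by ext1 u; exact hMN u) ((R1.flip (M v)).flip (M w))]
  congr 1
  ext1 u
  simp [← h, hNM]

/-- The curvature of a connection form, in coordinates. -/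
def lriem (Γ : E n → E n →L[ℝ] E n →L[ℝ] E n) (z : E n) :
    E n →L[ℝ] E n →L[ℝ] E n →L[ℝ] E n := curvOp (fderiv ℝ Γ z) (Γ z)

/-- Differentiating the transformation law of Γ brings in the second and third derivatives of φ;
antisymmetrising in u and v removes those that are symmetric in these arguments, and the quadratic
part of the curvature absorbs the rest. -/
theorem lriem_transform {Γ0 Γ1 : E n → E n →L[ℝ] E n →L[ℝ] E n} {φ : E n → E n} {z : E n}
    {N : E n →L[ℝ] E n} (hφ : IsTrans φ z N)
    (hΓ : ∀ᶠ z' in 𝓝 z, ∀ u v, fderiv ℝ φ z' (Γ0 z' u v) =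
      Γ1 (φ z') (fderiv ℝ φ z' u) (fderiv ℝ φ z' v) + fderiv ℝ (fderiv ℝ φ) z' u v)
    (hd0 : DifferentiableAt ℝ Γ0 z) (hd1 : DifferentiableAt ℝ Γ1 (φ z)) (u v w : E n) :
    fderiv ℝ φ z (lriem Γ0 z u v w) =
      lriem Γ1 (φ z) (fderiv ℝ φ z u) (fderiv ℝ φ z v) (fderiv ℝ φ z w) := by
  have hΓ1' : HasFDerivAt (fun z' => Γ1 (φ z')) (fderiv ℝ Γ1 (φ z) ∘L fderiv ℝ φ z) z :=
    hd1.hasFDerivAt.comp z hφ.diff.hasFDerivAt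
  have key : ∀ u v, fderiv ℝ φ z (fderiv ℝ Γ0 z u v w) + fderiv ℝ (fderiv ℝ φ) z u (Γ0 z v w) =
      fderiv ℝ Γ1 (φ z) (fderiv ℝ φ z u) (fderiv ℝ φ z v) (fderiv ℝ φ z w) +
      Γ1 (φ z) (fderiv ℝ (fderiv ℝ φ) z u v) (fderiv ℝ φ z w) +
      Γ1 (φ z) (fderiv ℝ φ z v) (fderiv ℝ (fderiv ℝ φ) z u w) +
      fderiv ℝ (fderiv ℝ (fderiv ℝ φ)) z u v w := by
    intro u v
    have h1 : (fun z' => fderiv ℝ φ z' (Γ0 z' v w)) =ᶠ[𝓝 z] fun z' =>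
        Γ1 (φ z') (fderiv ℝ φ z' v) (fderiv ℝ φ z' w) + fderiv ℝ (fderiv ℝ φ) z' v w :=
      hΓ.mono fun z' hz => hz v w
    have h2 := congrArg (fun L : E n →L[ℝ] E n => L u) h1.fderiv_eq
    have hc : ∀ v : E n, HasFDerivAt (fun _ : E n => v) (0 : E n →L[ℝ] E n) z :=
      fun v => hasFDerivAt_const v z
    rw [(hφ.diff'.hasFDerivAt.clm_apply
        ((hd0.hasFDerivAt.clm_apply (hc v)).clm_apply (hc w))).fderiv,
      (((hΓ1'.clm_apply (hφ.diff'.hasFDerivAt.clm_apply (hc v))).clm_apply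
        (hφ.diff'.hasFDerivAt.clm_apply (hc w))).fun_add
        ((hφ.diff''.hasFDerivAt.clm_apply (hc v)).clm_apply (hc w))).fderiv] at h2
    simp only [add_apply, ContinuousLinearMap.comp_apply, ContinuousLinearMap.flip_apply,
      zero_apply, map_zero, zero_add] at h2
    rw [h2]
    abel
  have k1 := eq_sub_of_add_eq (key u v)
  have k2 := eq_sub_of_add_eq (key v u)
  have hΓ0 := hΓ.self_of_nhds
  simp only [lriem, curvOp_apply, add_apply, sub_apply, ContinuousLinearMap.comp_apply, map_add,
    map_sub, hΓ0, k1, k2, hφ.symm v u, hφ.symm' v u w]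
  abel

/-! ### The gauge change `Γ ↦ Γ - ∇A` -/

/-- The functional L measuring the failure of symmetry is continuous and linear and kills every
power of A, hence the sum of the exponential series. -/
theorem IsMet.exp_symm {G : Bil n} {A : E n →L[ℝ] E n} (h : ∀ u v, G (A u) v = G u (A v))
    (u v : E n) : G (NormedSpace.exp A u) v = G u (NormedSpace.exp A v) := by
  let L : (E n →L[ℝ] E n) →L[ℝ] ℝ :=
    (G.flip v) ∘L (ContinuousLinearMap.apply ℝ (E n) u) -
      (G u) ∘L (ContinuousLinearMap.apply ℝ (E n) v)
  have hL : ∀ X, L X = G (X u) v - G u (X v) := fun X => rfl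
  have hpow : ∀ k : ℕ, ∀ u v, G ((A ^ k) u) v = G u ((A ^ k) v) := by
    intro k
    induction k with
    | zero => intro u v; simp
    | succ k ih =>
      intro u v
      have e1 : (A ^ (k + 1)) u = (A ^ k) (A u) := by rw [pow_succ]; rfl
      have e2 : (A ^ (k + 1)) v = A ((A ^ k) v) := by rw [pow_succ']; rfl
      rw [e1, e2, ih, h]
  have h1 := (NormedSpace.exp_series_hasSum_exp' (𝕂 := ℝ) A).mapL L
  have h2 : (fun k : ℕ => L ((k.factorial⁻¹ : ℝ) • A ^ k)) = fun _ => 0 := by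
    funext k
    rw [map_smul, hL, hpow, sub_self, smul_zero]
  rw [h2] at h1
  have := h1.unique hasSum_zero
  rw [hL] at this
  linarith

theorem exp_mul_exp_neg (A : E n →L[ℝ] E n) : NormedSpace.exp A * NormedSpace.exp (-A) = 1 := by
  rw [← NormedSpace.exp_add_of_commute (Commute.neg_right (Commute.refl A)), add_neg_cancel,
    NormedSpace.exp_zero]

theorem exp_neg_mul_exp (A : E n →L[ℝ] E n) : NormedSpace.exp (-A) * NormedSpace.exp A = 1 := by
  simpa using exp_mul_exp_neg (-A)

theorem exp_neg_apply_exp (A : E n →L[ℝ] E n) (u : E n) :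
    NormedSpace.exp (-A) (NormedSpace.exp A u) = u :=
  congrArg (fun L : E n →L[ℝ] E n => L u) (exp_neg_mul_exp A)

theorem exp_apply_exp_neg (A : E n →L[ℝ] E n) (u : E n) :
    NormedSpace.exp A (NormedSpace.exp (-A) u) = u :=
  congrArg (fun L : E n →L[ℝ] E n => L u) (exp_mul_exp_neg A)

theorem exp_two_smul (A : E n →L[ℝ] E n) :
    NormedSpace.exp ((2 : ℝ) • A) = NormedSpace.exp A * NormedSpace.exp A := by
  have := exp_smul_add_smul A 1 1
  rwa [one_add_one_eq_two, one_smul] at this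

theorem IsMet.smul_symm {G : Bil n} {A : E n →L[ℝ] E n} (h : ∀ u v, G (A u) v = G u (A v))
    (c : ℝ) (u v : E n) : G ((c • A) u) v = G u ((c • A) v) := by
  simp [h]

/-- Since e^{-2A} = e^{-A} e^{-A} with e^{-A} symmetric and invertible, the new form is the pullback
of G by e^{-A}. -/
theorem IsMet.comp_exp {G : Bil n} (hG : IsMet G) {A : E n →L[ℝ] E n}
    (h : ∀ u v, G (A u) v = G u (A v)) : IsMet (G ∘L NormedSpace.exp ((-2 : ℝ) • A)) := by
  have h1 : ∀ u v, G (NormedSpace.exp (-A) u) v = G u (NormedSpace.exp (-A) v) :=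
    IsMet.exp_symm fun u v => by simp [h]
  have h2 : NormedSpace.exp ((-2 : ℝ) • A) = NormedSpace.exp (-A) * NormedSpace.exp (-A) := by
    rw [← exp_two_smul, smul_neg, neg_smul]
  have h3 : ∀ u v, (G ∘L NormedSpace.exp ((-2 : ℝ) • A)) u v =
      G (NormedSpace.exp (-A) u) (NormedSpace.exp (-A) v) := fun u v => by
    rw [h2]
    exact h1 _ _
  refine ⟨fun u v => by rw [h3, h3, hG.symm], fun v hv => ?_⟩
  rw [h3]
  refine hG.pos _ fun h0 => hv ?_
  rw [← exp_apply_exp_neg A v, h0, map_zero]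

theorem IsMet.inverse_comp_exp {G : Bil n} (hG : IsMet G) (A : E n →L[ℝ] E n) :
    (G ∘L NormedSpace.exp ((-2 : ℝ) • A)).inverse =
      NormedSpace.exp ((2 : ℝ) • A) ∘L G.inverse := by
  refine ContinuousLinearMap.inverse_eq ?_ ?_
  · ext θ w
    have := exp_neg_apply_exp ((2 : ℝ) • A) (G.inverse θ)
    simp [this, hG.inverse_apply]
  · ext1 u
    have := exp_apply_exp_neg ((2 : ℝ) • A) u
    simp [hG.inverse_self, this]

section gauge

variable {G : E n → Bil n} {A : E n → E n →L[ℝ] E n} {z : E n}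

theorem fderiv_exp_field (hA : DifferentiableAt ℝ A z) (Γ : E n → E n →L[ℝ] E n →L[ℝ] E n)
    (hc : ∀ u, Commute (A z) (lnab Γ A z u)) (c : ℝ) (u : E n) :
    lnab Γ (fun z => NormedSpace.exp (c • A z)) z u =
      c • (NormedSpace.exp (c • A z) ∘L lnab Γ A z u) := by
  have h1 : fderiv ℝ (fun z => NormedSpace.exp (c • A z)) z u =
      fderiv ℝ NormedSpace.exp (c • A z) (c • fderiv ℝ A z u) := by
    have := (differentiableAt_exp_end (c • A z)).hasFDerivAt.comp z (hA.hasFDerivAt.const_smul c)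
    rw [show (fun z => NormedSpace.exp (c • A z)) = NormedSpace.exp ∘ (c • A) from rfl, this.fderiv]
    rfl
  have h2 : c • fderiv ℝ A z u + (Γ z u * (c • A z) - (c • A z) * Γ z u) = c • lnab Γ A z u := by
    rw [lnab_apply, smul_add, smul_sub, mul_smul_comm, smul_mul_assoc]
    rfl
  have h3 := fderiv_exp_add_bracket (c := Γ z u) (X := c • A z) (Y := c • fderiv ℝ A z u)
    (by rw [h2]; exact ((hc u).smul_left c).smul_right c)
  rw [h2] at h3
  rw [lnab_apply, h1]
  refine Eq.trans h3 ?_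
  rw [mul_smul_comm]
  rfl

/-- Differentiate G(Av, w) = G(v, Aw) and rewrite the derivatives of G by metric compatibility. -/
theorem lnab_symm (hd : DifferentiableAt ℝ G z) (hG : ∀ᶠ z' in 𝓝 z, IsMet (G z'))
    (hA : DifferentiableAt ℝ A z) (hs : ∀ᶠ z' in 𝓝 z, ∀ u v, G z' (A z' u) v = G z' u (A z' v))
    (u v w : E n) : G z (lnab (lchr G) A z u v) w = G z v (lnab (lchr G) A z u w) := by
  have h1 : (fun z' => G z' (A z' v) w) =ᶠ[𝓝 z] fun z' => G z' v (A z' w) :=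
    hs.mono fun z' h => h v w
  have h2 := congrArg (fun L : E n →L[ℝ] ℝ => L u) h1.fderiv_eq
  have hA' : ∀ v, DifferentiableAt ℝ (fun z => A z v) z := fun v =>
    hA.clm_apply (differentiableAt_const v)
  have e1 := fderiv_comp₂ (φ := fun z => z) (z := z) hd differentiableAt_id (hA' v)
    (differentiableAt_const w) u
  have e2 := fderiv_comp₂ (φ := fun z => z) (z := z) hd differentiableAt_id
    (differentiableAt_const v) (hA' w) u
  simp only [e1, e2, fderiv_apply_const hA, fderiv_fun_const, Pi.zero_apply, zero_apply, map_zero,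
    add_zero] at h2
  have hid : fderiv ℝ (fun z : E n => z) z u = u := by
    rw [show (fun z : E n => z) = id from rfl, fderiv_id]; rfl
  rw [hid, lchr_compat hd hG, lchr_compat hd hG] at h2
  have hs' := hs.self_of_nhds
  simp only [lnab_apply, add_apply, sub_apply, ContinuousLinearMap.comp_apply, map_add, map_sub]
  have h3 := hs' (lchr G z u v) w
  have h4 := hs' v (lchr G z u w)
  linarith

/-- The candidate Γ - ∇A is symmetric by the Codazzi condition. For compatibility, ∇(G e^{-2A}) = -2
G e^{-2A} ∇A because A commutes with ∇A, and the symmetry of ∇A together with its commutation with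
e^{-2A} distributes this term equally over the two arguments. -/
theorem lchr_gauge (hd : DifferentiableAt ℝ G z) (hG : ∀ᶠ z' in 𝓝 z, IsMet (G z'))
    (hA : DifferentiableAt ℝ A z) (hs : ∀ᶠ z' in 𝓝 z, ∀ u v, G z' (A z' u) v = G z' u (A z' v))
    (hcl : ∀ u v, lnab (lchr G) A z u v = lnab (lchr G) A z v u)
    (hc : ∀ u, Commute (A z) (lnab (lchr G) A z u)) :
    lchr (fun z => G z ∘L NormedSpace.exp ((-2 : ℝ) • A z)) z =
      lchr G z - lnab (lchr G) A z := by
  have hm : IsMet (G z ∘L NormedSpace.exp ((-2 : ℝ) • A z)) :=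
    hG.self_of_nhds.comp_exp hs.self_of_nhds
  set S : E n → E n →L[ℝ] E n := fun z => NormedSpace.exp ((-2 : ℝ) • A z) with hS
  have hSd : DifferentiableAt ℝ S z :=
    (differentiableAt_exp_end _).comp z (hA.const_smul (-2 : ℝ))
  have hDS : ∀ u, lnab (lchr G) S z u = (-2 : ℝ) • (S z ∘L lnab (lchr G) A z u) :=
    fderiv_exp_field hA (lchr G) hc (-2)
  have hcomm : ∀ u w, lnab (lchr G) A z u (S z w) = S z (lnab (lchr G) A z u w) := fun u w => by
    have : Commute (S z) (lnab (lchr G) A z u) := ((hc u).smul_left (-2 : ℝ)).exp_left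
    exact (congrArg (fun L : E n →L[ℝ] E n => L w) this.eq).symm
  ext1 u; ext1 v
  refine (lchr_unique hm (T := fun u v => lchr G z u v - lnab (lchr G) A z u v)
    (fun u v => by rw [lchr_symm hd hG, hcl]) (fun u v w => ?_) u v).trans rfl
  have hd' : DifferentiableAt ℝ (fun z => G z ∘L S z) z := hd.clm_comp hSd
  rw [← fderiv_apply_const₂ hd']
  have e1 := fderiv_comp₂ (φ := fun z => z) (z := z) hd differentiableAt_id
    (hSd.clm_apply (differentiableAt_const v)) (differentiableAt_const w) u
  have hid : fderiv ℝ (fun z : E n => z) z u = u := by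
    rw [show (fun z : E n => z) = id from rfl, fderiv_id]; rfl
  simp only [fderiv_apply_const hSd, fderiv_fun_const, Pi.zero_apply, zero_apply, map_zero,
    add_zero, hid] at e1
  have e2 : fderiv ℝ S z u v = (-2 : ℝ) • S z (lnab (lchr G) A z u v) -
      (lchr G z u (S z v) - S z (lchr G z u v)) := by
    have := congrArg (fun L : E n →L[ℝ] E n => L v) (hDS u)
    simp only [lnab_apply _ S, add_apply, sub_apply, ContinuousLinearMap.comp_apply,
      smul_apply] at this
    rw [← this]
    abel
  refine e1.trans ?_
  rw [lchr_compat hd hG, e2]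
  simp only [ContinuousLinearMap.comp_apply, map_sub, map_smul, sub_apply, smul_apply, smul_eq_mul]
  have h5 := lnab_symm hd hG hA hs u (S z v) w
  rw [hcomm] at h5
  linarith

/-- The curvature changes by -d^∇(∇A) + [∇A, ∇A], and d^∇(∇A) = [R, A]; both brackets vanish by
hypothesis. -/
theorem lriem_gauge {Γ : E n → E n →L[ℝ] E n →L[ℝ] E n} (hΓ : DifferentiableAt ℝ Γ z)
    (hA : ContDiffAt ℝ 2 A z)
    (hc : ∀ u v, Commute (lnab Γ A z u) (lnab Γ A z v))
    (hR : ∀ u v, Commute (lriem Γ z u v) (A z)) :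
    lriem (fun z => Γ z - lnab Γ A z) z = lriem Γ z := by
  have hA1 : DifferentiableAt ℝ A z := hA.differentiableAt (by simp)
  have hA2 : DifferentiableAt ℝ (fderiv ℝ A) z :=
    (hA.fderiv_right (m := 1) (by norm_num)).differentiableAt (by simp)
  have hsymm : ∀ u v, fderiv ℝ (fderiv ℝ A) z u v = fderiv ℝ (fderiv ℝ A) z v u :=
    hA.isSymmSndFDerivAt (by simp)
  have hD : ∀ v, HasFDerivAt (fun z' => lnab Γ A z' v) _ z := fun v =>
    ((hA2.hasFDerivAt.clm_apply (hasFDerivAt_const v z)).fun_add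
      (((hΓ.hasFDerivAt.clm_apply (hasFDerivAt_const v z)).clm_comp hA1.hasFDerivAt).fun_sub
      (hA1.hasFDerivAt.clm_comp (hΓ.hasFDerivAt.clm_apply (hasFDerivAt_const v z)))))
  have hDd : DifferentiableAt ℝ (lnab Γ A) z := by
    refine hA2.add ((DifferentiableAt.sub ?_ ?_).clm_comp hΓ)
    · exact (ContinuousLinearMap.differentiableAt _).comp z hA1
    · exact (ContinuousLinearMap.differentiableAt _).comp z hA1
  have hDv : ∀ u v, fderiv ℝ (lnab Γ A) z u v = fderiv ℝ (fderiv ℝ A) z u v +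
      (fderiv ℝ Γ z u v * A z + Γ z v * fderiv ℝ A z u -
        (fderiv ℝ A z u * Γ z v + A z * fderiv ℝ Γ z u v)) := by
    intro u v
    rw [← fderiv_apply_const hDd, (hD v).fderiv]
    ext w
    simp
    abel
  have hf : ∀ u v, fderiv ℝ (fun z => Γ z - lnab Γ A z) z u v =
      fderiv ℝ Γ z u v - fderiv ℝ (lnab Γ A) z u v := fun u v => by
    rw [fderiv_fun_sub hΓ hDd]; rfl
  ext1 u; ext1 v
  have h1 := hR u v
  have h2 := hc u v
  simp only [lriem, curvOp_apply, hf, hDv] at h1 ⊢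
  simp only [← ContinuousLinearMap.mul_def, sub_apply] at h1 ⊢
  simp only [lnab_apply, ← ContinuousLinearMap.mul_def] at h2 ⊢
  rw [hsymm v u]
  have h1' := h1.eq
  have h2' := h2.eq
  rw [← sub_eq_zero] at h1' h2' ⊢
  -- The difference of the two curvatures is -[R(u, v), A] + [∇_uA, ∇_vA] as an identity in a
  -- noncommutative ring, once the second derivatives of A have been symmetrised.
  refine Eq.trans (b := -((fderiv ℝ Γ z u v - fderiv ℝ Γ z v u + (Γ z u * Γ z v - Γ z v * Γ z u)) * A z -
    A z * (fderiv ℝ Γ z u v - fderiv ℝ Γ z v u + (Γ z u * Γ z v - Γ z v * Γ z u))) +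
    ((fderiv ℝ A z u + (Γ z u * A z - A z * Γ z u)) * (fderiv ℝ A z v + (Γ z v * A z - A z * Γ z v)) -
      (fderiv ℝ A z v + (Γ z v * A z - A z * Γ z v)) *
        (fderiv ℝ A z u + (Γ z u * A z - A z * Γ z u)))) ?_ ?_
  · noncomm_ring
  · rw [h1', h2']; simp

/-- The trace of the Christoffel symbols is the logarithmic derivative of the Riemannian
density. -/
theorem fderiv_detB_field (hd : DifferentiableAt ℝ G z) (hG : ∀ᶠ z' in 𝓝 z, IsMet (G z'))
    (u : E n) :
    fderiv ℝ (fun z => detB (G z)) z u = detB (G z) * (2 * tr (lchr G z u)) := by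
  have h0 := hG.self_of_nhds
  have h1 := ((contDiff_detB (k := 1)).differentiable (by simp)).differentiableAt
    (x := G z) |>.hasFDerivAt.comp z hd.hasFDerivAt
  rw [show (fun z => detB (G z)) = detB ∘ G from rfl, h1.fderiv, ContinuousLinearMap.comp_apply,
    fderiv_detB h0.isInvertible]
  congr 1
  -- By metric compatibility G⁻¹ ∂_uG is Γ_u plus its G-transpose, and these two have the same
  -- trace; this is the source of the factor 2.
  have h2 : (G z).inverse ∘L fderiv ℝ G z u = lchr G z u +
      (G z).inverse ∘L ((G z).bilinearComp (.id ℝ _) (lchr G z u)) := by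
    ext1 v
    refine h0.ext fun w => ?_
    simp [h0.inverse_apply, lchr_compat hd hG u v w]
  rw [h2, tr_add, h0.tr_eq_tr (B := (G z).inverse ∘L _) (C := lchr G z u), two_mul]
  intro v w
  simp [h0.inverse_apply]

end gauge

end

section

variable {n : ℕ} {X : Type*} [TopologicalSpace X] [ChartedSpace (E n) X]

/-! ### Tensor fields in charts -/

/-- The inverse of the preferred chart at `x`. -/
def cs (x : X) : E n → X := (chartAt (E n) x).symm

/-- The range of the preferred chart at `x`. -/
def ct (x : X) : Set (E n) := (chartAt (E n) x).target

theorem isOpen_ct (x : X) : IsOpen (ct x : Set (E n)) := (chartAt (E n) x).open_target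

theorem cs_mem {x : X} {z : E n} (hz : z ∈ ct x) : cs x z ∈ (chartAt (E n) x).source :=
  (chartAt (E n) x).map_target hz

theorem chart_cs {x : X} {z : E n} (hz : z ∈ ct x) : chartAt (E n) x (cs x z) = z :=
  (chartAt (E n) x).right_inv hz

theorem cs_chart {x y : X} (hy : y ∈ (chartAt (E n) x).source) : cs x (chartAt (E n) x y) = y :=
  (chartAt (E n) x).left_inv hy

theorem chart_mem_ct {x y : X} (hy : y ∈ (chartAt (E n) x).source) : chartAt (E n) x y ∈ ct x :=
  (chartAt (E n) x).map_source hy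

theorem self_mem_ct (x : X) : chartAt (E n) x x ∈ ct x := chart_mem_ct (mem_chart_source _ x)

theorem cs_self (x : X) : cs x (chartAt (E n) x x) = x := cs_chart (mem_chart_source _ x)

theorem continuousOn_cs (x : X) : ContinuousOn (cs x) (ct x : Set (E n)) :=
  (chartAt (E n) x).continuousOn_symm

theorem eventually_ct {x : X} {z : E n} (hz : z ∈ ct x) : ∀ᶠ z' in 𝓝 z, z' ∈ ct x :=
  (isOpen_ct x).mem_nhds hz

theorem eventually_cs_source {x0 x1 : X} {z : E n} (hz : z ∈ ct x0)
    (h1 : cs x0 z ∈ (chartAt (E n) x1).source) :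
    ∀ᶠ z' in 𝓝 z, cs x0 z' ∈ (chartAt (E n) x1).source :=
  ((continuousOn_cs x0).continuousAt ((isOpen_ct x0).mem_nhds hz)).eventually
    ((chartAt (E n) x1).open_source.mem_nhds h1)

/-- The change of coordinates from the chart at `x0` to the chart at `x1`. -/
def chg (x0 x1 : X) : E n → E n := fun z => chartAt (E n) x1 (cs x0 z)

theorem cs_chg {x0 x1 : X} {z : E n} (h1 : cs x0 z ∈ (chartAt (E n) x1).source) :
    cs x1 (chg x0 x1 z) = cs x0 z := cs_chart h1

variable [IsManifold (𝓡 n) ∞ X]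

theorem contDiffAt_chg {x0 x1 : X} {z : E n} (hz : z ∈ ct x0)
    (h1 : cs x0 z ∈ (chartAt (E n) x1).source) : ContDiffAt ℝ ∞ (chg x0 x1) z := by
  have hz' : z ∈ ((extChartAt (𝓡 n) x0).symm ≫ extChartAt (𝓡 n) x1).source := by
    simp only [PartialEquiv.trans_source, PartialEquiv.symm_source, Set.mem_inter_iff,
      Set.mem_preimage, extChartAt_source]
    exact ⟨by rw [extChartAt_target]; simpa [ct] using hz, h1⟩
  have h := contDiffWithinAt_ext_coord_change (I := 𝓡 n) (n := ∞) x1 x0 hz'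
  simp only [modelWithCornersSelf_coe, Set.range_id] at h
  exact h.contDiffAt univ_mem

theorem fderiv_chg {x0 x1 : X} {z : E n} (hz : z ∈ ct x0)
 :
    fderiv ℝ (chg x0 x1) z = tangentCoordChange (𝓡 n) x0 x1 (cs x0 z) := by
  rw [tangentCoordChange_def]
  simp only [modelWithCornersSelf_coe, Set.range_id, fderivWithin_univ]
  have : extChartAt (𝓡 n) x0 (cs x0 z) = z := chart_cs hz
  rw [this]
  rfl

theorem tcc_comp {w x y p : X} (hw : p ∈ (chartAt (E n) w).source)
    (hx : p ∈ (chartAt (E n) x).source) (hy : p ∈ (chartAt (E n) y).source) (v : E n) :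
    tangentCoordChange (𝓡 n) x y p (tangentCoordChange (𝓡 n) w x p v) =
      tangentCoordChange (𝓡 n) w y p v :=
  tangentCoordChange_comp (by simp [hw, hx, hy])

theorem tcc_self {x p : X} (hx : p ∈ (chartAt (E n) x).source) (v : E n) :
    tangentCoordChange (𝓡 n) x x p v = v :=
  tangentCoordChange_self (by simpa [extChartAt_source] using hx)

theorem isTrans_chg {x0 x1 : X} {z : E n} (hz : z ∈ ct x0)
    (h1 : cs x0 z ∈ (chartAt (E n) x1).source) :
    IsTrans (chg x0 x1) z (tangentCoordChange (𝓡 n) x1 x0 (cs x0 z)) where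
  smooth := contDiffAt_chg hz h1
  left u := by rw [fderiv_chg hz, tcc_comp (cs_mem hz) h1 (cs_mem hz), tcc_self (cs_mem hz)]
  right u := by rw [fderiv_chg hz, tcc_comp h1 (cs_mem hz) h1, tcc_self h1]

theorem fromChart_self (x : X) : fromChart x x = ContinuousLinearMap.id ℝ (E n) := by
  ext1 v; exact tcc_self (mem_chart_source _ x) v

theorem toChart_self (x : X) : toChart x x = ContinuousLinearMap.id ℝ (E n) := by
  ext1 v; exact tcc_self (mem_chart_source _ x) v

theorem toChart_fromChart {x y : X} (hy : y ∈ (chartAt (E n) x).source) (v : E n) :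
    toChart x y (fromChart x y v) = v := by
  refine (tcc_comp hy (mem_chart_source _ y) hy v).trans (tcc_self hy v)

theorem fromChart_toChart {x y : X} (hy : y ∈ (chartAt (E n) x).source) (v : E n) :
    fromChart x y (toChart x y v) = v :=
  (tcc_comp (mem_chart_source _ y) hy (mem_chart_source _ y) v).trans
    (tcc_self (mem_chart_source _ y) v)

theorem fromChart_chg {x0 x1 : X} {z : E n} (hz : z ∈ ct x0)
    (h1 : cs x0 z ∈ (chartAt (E n) x1).source) (v : E n) :
    fromChart x1 (cs x0 z) (fderiv ℝ (chg x0 x1) z v) = fromChart x0 (cs x0 z) v := by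
  rw [fderiv_chg hz]
  exact tcc_comp (cs_mem hz) h1 (mem_chart_source _ _) v

theorem toChart_chg {x0 x1 : X} {z : E n} (hz : z ∈ ct x0)
    (h1 : cs x0 z ∈ (chartAt (E n) x1).source) (v : E n) :
    fderiv ℝ (chg x0 x1) z (toChart x0 (cs x0 z) v) = toChart x1 (cs x0 z) v := by
  rw [fderiv_chg hz]
  exact tcc_comp (mem_chart_source _ _) (cs_mem hz) h1 v

/-- The coordinate expression of a section of `End (T_X)`. -/
def repE (x : X) (A : EndField n X) (z : E n) : E n →L[ℝ] E n :=
  toChart x (cs x z) ∘L A (cs x z) ∘L fromChart x (cs x z)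

/-- The coordinate expression of a covariant 2-tensor field. -/
def repB (x : X) (g : BilField n X) (z : E n) : Bil n := metricCoord g x (cs x z)

/-- The coordinate expression of a vector field. -/
def repV (x : X) (Y : X → E n) (z : E n) : E n := toChart x (cs x z) (Y (cs x z))

/-- The coordinate expression of an `End (T_X)`-valued 1-form. -/
def rep1 (x : X) (D : X → E n →L[ℝ] E n →L[ℝ] E n) (z : E n) : E n →L[ℝ] E n →L[ℝ] E n :=
  (ContinuousLinearMap.compL ℝ (E n) (E n) (E n) (toChart x (cs x z)) ∘L
    (ContinuousLinearMap.compL ℝ (E n) (E n) (E n)).flip (fromChart x (cs x z)) ∘L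
      D (cs x z)) ∘L fromChart x (cs x z)

/-- The coordinate expression of a 1-form. -/
def repθ (x : X) (θ : X → E n →L[ℝ] ℝ) (z : E n) : E n →L[ℝ] ℝ :=
  θ (cs x z) ∘L fromChart x (cs x z)

theorem repE_apply (x : X) (A : EndField n X) (z u : E n) :
    repE x A z u = toChart x (cs x z) (A (cs x z) (fromChart x (cs x z) u)) := rfl

theorem repB_apply (x : X) (g : BilField n X) (z u v : E n) :
    repB x g z u v = g (cs x z) (fromChart x (cs x z) u) (fromChart x (cs x z) v) := rfl

theorem rep1_apply (x : X) (D : X → E n →L[ℝ] E n →L[ℝ] E n) (z u v : E n) :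
    rep1 x D z u v =
      toChart x (cs x z) (D (cs x z) (fromChart x (cs x z) u) (fromChart x (cs x z) v)) := rfl

theorem repE_self (x : X) (A : EndField n X) : repE x A (chartAt (E n) x x) = A x := by
  ext1 u; rw [repE_apply, cs_self, toChart_self, fromChart_self]; rfl

theorem repB_self (x : X) (g : BilField n X) : repB x g (chartAt (E n) x x) = g x := by
  ext u v; rw [repB_apply, cs_self, fromChart_self]; rfl

theorem repV_self (x : X) (Y : X → E n) : repV x Y (chartAt (E n) x x) = Y x := by
  rw [repV, cs_self, toChart_self]; rfl

theorem repE_chg {x0 x1 : X} {z : E n} (hz : z ∈ ct x0)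
    (h1 : cs x0 z ∈ (chartAt (E n) x1).source) (A : EndField n X) (u : E n) :
    fderiv ℝ (chg x0 x1) z (repE x0 A z u) =
      repE x1 A (chg x0 x1 z) (fderiv ℝ (chg x0 x1) z u) := by
  rw [repE_apply, repE_apply, toChart_chg hz h1, cs_chg h1, fromChart_chg hz h1]

theorem repB_chg {x0 x1 : X} {z : E n} (hz : z ∈ ct x0)
    (h1 : cs x0 z ∈ (chartAt (E n) x1).source) (g : BilField n X) (u v : E n) :
    repB x0 g z u v =
      repB x1 g (chg x0 x1 z) (fderiv ℝ (chg x0 x1) z u) (fderiv ℝ (chg x0 x1) z v) := by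
  rw [repB_apply, repB_apply, cs_chg h1, fromChart_chg hz h1, fromChart_chg hz h1]

theorem repV_chg {x0 x1 : X} {z : E n} (hz : z ∈ ct x0)
    (h1 : cs x0 z ∈ (chartAt (E n) x1).source) (Y : X → E n) :
    fderiv ℝ (chg x0 x1) z (repV x0 Y z) = repV x1 Y (chg x0 x1 z) := by
  rw [repV, repV, toChart_chg hz h1, cs_chg h1]

/-! ### Smoothness in charts -/

variable (n) in
/-- A function that is smooth in all charts. -/
def SF {W : Type*} [NormedAddCommGroup W] [NormedSpace ℝ W] (f : X → W) : Prop :=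
  ∀ x : X, ContDiffOn ℝ ∞ (f ∘ cs x) (ct x : Set (E n))

/-- A section of `End (T_X)` that is smooth in all charts. -/
def SE (A : EndField n X) : Prop := ∀ x : X, ContDiffOn ℝ ∞ (repE x A) (ct x : Set (E n))

/-- A covariant 2-tensor field that is smooth in all charts. -/
def SB (g : BilField n X) : Prop := ∀ x : X, ContDiffOn ℝ ∞ (repB x g) (ct x : Set (E n))

/-- A vector field that is smooth in all charts. -/
def SV (Y : X → E n) : Prop := ∀ x : X, ContDiffOn ℝ ∞ (repV x Y) (ct x : Set (E n))

theorem contMDiffOn_chart_iff {W : Type*} [NormedAddCommGroup W] [NormedSpace ℝ W] (f : X → W)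
    (x : X) : ContMDiffOn (𝓡 n) 𝓘(ℝ, W) ∞ f (chartAt (E n) x).source ↔
      ContDiffOn ℝ ∞ (f ∘ cs x) (ct x : Set (E n)) := by
  rw [← contMDiffOn_iff_contDiffOn]
  constructor
  · intro h
    exact h.comp (contMDiffOn_chart_symm (I := 𝓡 n)) fun z hz => cs_mem hz
  · intro h
    refine (h.comp (contMDiffOn_chart (I := 𝓡 n) (x := x)) fun y hy => chart_mem_ct hy).congr ?_
    intro y hy
    simp [Function.comp, cs_chart hy]

theorem SF.contMDiff {W : Type*} [NormedAddCommGroup W] [NormedSpace ℝ W] {f : X → W}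
    (h : SF n f) : ContMDiff (𝓡 n) 𝓘(ℝ, W) ∞ f := fun x =>
  ((contMDiffOn_chart_iff f x).2 (h x)).contMDiffAt (chart_source_mem_nhds _ x)

theorem SF.continuous {W : Type*} [NormedAddCommGroup W] [NormedSpace ℝ W] {f : X → W}
    (h : SF n f) : Continuous f := h.contMDiff.continuous

theorem ContMDiff.sF {W : Type*} [NormedAddCommGroup W] [NormedSpace ℝ W] {f : X → W}
    (h : ContMDiff (𝓡 n) 𝓘(ℝ, W) ∞ f) : SF n f := fun x =>
  (contMDiffOn_chart_iff f x).1 h.contMDiffOn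

/-- Over the chart domain at x the trivialization of the endomorphism bundle reads A as `repE x A`,
so bundle smoothness can be tested on coordinate expressions. -/
theorem smoothEnd_iff (A : EndField n X) : SmoothEnd A ↔ SE A := by
  have key : ∀ x : X, ContMDiffOn (𝓡 n) ((𝓡 n).prod 𝓘(ℝ, E n →L[ℝ] E n)) ∞
      (fun x : X => Bundle.TotalSpace.mk' (E n →L[ℝ] E n)
        (E := fun x : X => TangentSpace (𝓡 n) x →L[ℝ] TangentSpace (𝓡 n) x) x (A x))
      (chartAt (E n) x).source ↔ ContDiffOn ℝ ∞ (repE x A) (ct x : Set (E n)) := by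
    intro x
    have h := (trivializationAt (E n →L[ℝ] E n)
      (fun x : X => TangentSpace (𝓡 n) x →L[ℝ] TangentSpace (𝓡 n) x) x).contMDiffOn_section_baseSet_iff
      (IB := 𝓡 n) (n := ∞)
      (E := fun x : X => TangentSpace (𝓡 n) x →L[ℝ] TangentSpace (𝓡 n) x) (s := A)
    have hb : (trivializationAt (E n →L[ℝ] E n)
      (fun x : X => TangentSpace (𝓡 n) x →L[ℝ] TangentSpace (𝓡 n) x) x).baseSet =
        (chartAt (E n) x).source := by
      rw [hom_trivializationAt_baseSet, TangentBundle.trivializationAt_baseSet, Set.inter_self]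
    rw [hb] at h
    refine h.trans ?_
    rw [contMDiffOn_chart_iff]
    refine contDiffOn_congr fun z hz => ?_
    have hz' := cs_mem hz
    exact (tangentBundleCore (𝓡 n) X).inCoordinates_eq (tangentBundleCore (𝓡 n) X) _ hz' hz'
  constructor
  · intro h x
    exact (key x).1 h.contMDiffOn
  · intro h x
    exact ((key x).2 (h x)).contMDiffAt (chart_source_mem_nhds _ x)

theorem Metric.sB (g : Metric n X) : SB g.field := by
  intro x
  have h := (trivializationAt (E n →L[ℝ] E n →L[ℝ] ℝ)
    (fun x : X => TangentSpace (𝓡 n) x →L[ℝ] TangentSpace (𝓡 n) x →L[ℝ] ℝ) x).contMDiffOn_section_baseSet_iff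
      (IB := 𝓡 n) (n := ∞) (s := g.inner)
  have hb : (trivializationAt (E n →L[ℝ] E n →L[ℝ] ℝ)
      (fun x : X => TangentSpace (𝓡 n) x →L[ℝ] TangentSpace (𝓡 n) x →L[ℝ] ℝ) x).baseSet =
        (chartAt (E n) x).source := by
    simp [hom_trivializationAt_baseSet, TangentBundle.trivializationAt_baseSet]
  rw [hb] at h
  refine ((contMDiffOn_chart_iff _ x).1 (h.1 g.contMDiff.contMDiffOn)).congr fun z hz => ?_
  have hz' := cs_mem hz
  ext u v
  simp only [Function.comp, hom_trivializationAt_apply]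
  rw [inCoordinates_apply_eq₂ (by exact hz') (by exact hz') (by simp)]
  have h2 : ∀ v : E n, (trivializationAt (E n) (TangentSpace (𝓡 n)) x).symm (cs x z) v =
      fromChart x (cs x z) v := fun v => by
    have := TangentBundle.symmL_trivializationAt_eq_core (I := 𝓡 n) hz'
    refine Eq.trans ?_ (congrArg (fun L : E n →L[ℝ] E n => L v) this)
    exact (Bundle.Trivialization.symmL_apply (R := ℝ) _ (by exact hz') _).symm
  rw [h2, h2]
  simp
  rfl

/-- The differential of a function in terms of its coordinate expression. -/
theorem diff_fromChart {W : Type*} [NormedAddCommGroup W] [NormedSpace ℝ W] {f : X → W} {x y : X}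
    (hy : y ∈ (chartAt (E n) x).source)
    (hf : DifferentiableAt ℝ (f ∘ cs x) (chartAt (E n) x y)) :
    diff f y ∘L fromChart x y = fderiv ℝ (f ∘ cs x) (chartAt (E n) x y) := by
  have hyy := mem_chart_source (E n) y
  have hsrc : cs y (chartAt (E n) y y) ∈ (chartAt (E n) x).source := by rwa [cs_self]
  -- The manifold derivative at y is computed in the preferred chart at y, so the chart at x has to
  -- be reached through the transition map `chg y x`.
  have hev : f ∘ cs y =ᶠ[𝓝 (chartAt (E n) y y)] (f ∘ cs x) ∘ chg y x := by
    filter_upwards [eventually_cs_source (self_mem_ct y) hsrc] with z hz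
    simp only [Function.comp, cs_chg hz]
  have hc : chg y x (chartAt (E n) y y) = chartAt (E n) x y := by rw [chg, cs_self]
  have hT := isTrans_chg (self_mem_ct y) hsrc
  have hf' : DifferentiableAt ℝ (f ∘ cs x) (chg y x (chartAt (E n) y y)) := by rwa [hc]
  have hder : HasFDerivAt (f ∘ cs y) (fderiv ℝ (f ∘ cs x) (chartAt (E n) x y) ∘L
      fderiv ℝ (chg y x) (chartAt (E n) y y)) (chartAt (E n) y y) := by
    have := hf'.hasFDerivAt.comp _ hT.diff.hasFDerivAt
    rw [hc] at this
    exact this.congr_of_eventuallyEq hev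
  have hcont : ContinuousAt f y := by
    have h1 : ContinuousAt ((f ∘ cs x) ∘ chartAt (E n) x) y :=
      ContinuousAt.comp hf.continuousAt ((chartAt (E n) x).continuousAt hy)
    refine h1.congr ?_
    filter_upwards [(chartAt (E n) x).open_source.mem_nhds hy] with p hp
    simp only [Function.comp, cs_chart hp]
  have hm : MDifferentiableAt (𝓡 n) 𝓘(ℝ, W) f y := by
    rw [mdifferentiableAt_iff]
    refine ⟨hcont, ?_⟩
    exact hder.differentiableAt.differentiableWithinAt
  have hmf : diff f y = fderiv ℝ (f ∘ cs y) (chartAt (E n) y y) := by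
    rw [diff, hm.mfderiv]
    simp only [modelWithCornersSelf_coe, Set.range_id, fderivWithin_univ]
    rfl
  rw [hmf, hder.fderiv, fderiv_chg (self_mem_ct y), cs_self]
  ext1 u
  exact congrArg _ (toChart_fromChart hy u)

theorem diff_self {W : Type*} [NormedAddCommGroup W] [NormedSpace ℝ W] {f : X → W} {x : X}
    (hf : DifferentiableAt ℝ (f ∘ cs x) (chartAt (E n) x x)) :
    diff f x = fderiv ℝ (f ∘ cs x) (chartAt (E n) x x) := by
  rw [← diff_fromChart (mem_chart_source _ x) hf, fromChart_self]; rfl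

end

section

variable {n : ℕ} {X : Type*} [TopologicalSpace X] [ChartedSpace (E n) X] [IsManifold (𝓡 n) ∞ X]

/-! ### Metric fields and their connections -/

/-- A smooth field of positive definite symmetric bilinear forms. -/
structure MF (g : BilField n X) : Prop where
  sB : SB g
  met : ∀ x, IsMet (g x)

theorem Metric.mF (g : Metric n X) : MF g.field :=
  ⟨g.sB, fun x => ⟨g.symm x, g.pos x⟩⟩

/-- Christoffel symbols in the preferred chart at `x`. -/
def chr (g : BilField n X) (x : X) : E n → E n →L[ℝ] E n →L[ℝ] E n := lchr (repB x g)

theorem contDiff_kosz {k : ℕ∞ω} : ContDiff ℝ k (kosz (n := n)) := by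
  have h1 : ContDiff ℝ k fun D : E n →L[ℝ] Bil n => D.flip :=
    (flipL (E n) (E n) (E n →L[ℝ] ℝ)).contDiff
  exact ((contDiff_id.add h1).sub (contDiff_const.clm_comp h1)).const_smul (1 / 2 : ℝ)

theorem ContDiffOn.at_ct {W : Type*} [NormedAddCommGroup W] [NormedSpace ℝ W] {f : E n → W}
    {x : X} (h : ContDiffOn ℝ ∞ f (ct x : Set (E n))) {z : E n} (hz : z ∈ ct x) :
    ContDiffAt ℝ ∞ f z := h.contDiffAt ((isOpen_ct x).mem_nhds hz)

theorem ContDiffOn.diff_ct {W : Type*} [NormedAddCommGroup W] [NormedSpace ℝ W] {f : E n → W}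
    {x : X} (h : ContDiffOn ℝ ∞ f (ct x : Set (E n))) {z : E n} (hz : z ∈ ct x) :
    DifferentiableAt ℝ f z := (ContDiffOn.at_ct h hz).differentiableAt (by simp)

theorem ContDiffOn.fderiv_ct {W : Type*} [NormedAddCommGroup W] [NormedSpace ℝ W] {f : E n → W}
    {x : X} (h : ContDiffOn ℝ ∞ f (ct x : Set (E n))) :
    ContDiffOn ℝ ∞ (fderiv ℝ f) (ct x : Set (E n)) :=
  h.fderiv_of_isOpen (isOpen_ct x) (by simp)

theorem contDiffOn_inverse {G : E n → Bil n} {s : Set (E n)} (h : ContDiffOn ℝ ∞ G s)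
    (hm : ∀ z ∈ s, IsMet (G z)) : ContDiffOn ℝ ∞ (fun z => (G z).inverse) s := fun z hz =>
  (hm z hz).isInvertible.contDiffAt_map_inverse.comp_contDiffWithinAt z (h z hz)

theorem fromChart_injective {x y : X} (hy : y ∈ (chartAt (E n) x).source) :
    Function.Injective (fromChart x y : E n → E n) := fun u v huv => by
  rw [← toChart_fromChart hy u, huv, toChart_fromChart hy]

/-! ### Chart independence of the connection and the curvature -/

namespace MF

variable {g : BilField n X}

theorem met_rep (hg : MF g) {x : X} {z : E n} (hz : z ∈ ct x) : IsMet (repB x g z) where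
  symm _ _ := (hg.met _).symm _ _
  pos _ hv := (hg.met _).pos _ fun h => hv
    (fromChart_injective (cs_mem hz) (h.trans (map_zero _).symm))

theorem eventually_met (hg : MF g) {x : X} {z : E n} (hz : z ∈ ct x) : ∀ᶠ z' in 𝓝 z, IsMet (repB x g z') :=
  (eventually_ct hz).mono fun _ h => hg.met_rep h

theorem diff_rep (hg : MF g) {x : X} {z : E n} (hz : z ∈ ct x) : DifferentiableAt ℝ (repB x g) z :=
  ContDiffOn.diff_ct (hg.sB x) hz

theorem contDiffOn_chr (hg : MF g) (x : X) : ContDiffOn ℝ ∞ (chr g x) (ct x : Set (E n)) := by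
  have h1 := contDiffOn_inverse (hg.sB x) fun z hz => hg.met_rep hz
  exact ((ContinuousLinearMap.contDiff _).comp_contDiffOn h1).clm_comp
    (contDiff_kosz.comp_contDiffOn (ContDiffOn.fderiv_ct (hg.sB x)))

theorem diff_chr (hg : MF g) {x : X} {z : E n} (hz : z ∈ ct x) : DifferentiableAt ℝ (chr g x) z :=
  ContDiffOn.diff_ct (hg.contDiffOn_chr x) hz

theorem christoffel_eq (hg : MF g) {x y : X} (hy : y ∈ (chartAt (E n) x).source) :
    christoffel g x y = chr g x (chartAt (E n) x y) := by
  have h1 : metricDeriv g x y = fderiv ℝ (repB x g) (chartAt (E n) x y) :=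
    diff_fromChart hy (hg.diff_rep (chart_mem_ct hy))
  have h2 : metricCoord g x y = repB x g (chartAt (E n) x y) := by rw [repB, cs_chart hy]
  have h3 : christoffel g x y = ContinuousLinearMap.compL ℝ (E n) (E n →L[ℝ] ℝ) (E n)
    (metricCoord g x y).inverse ∘L kosz (metricDeriv g x y) := rfl
  rw [h3, h1, h2]
  rfl

theorem christoffel_self (hg : MF g) (x : X) : christoffel g x x = chr g x (chartAt (E n) x x) :=
  hg.christoffel_eq (mem_chart_source _ x)

theorem chr_chg (hg : MF g) {x0 x1 : X} {z : E n} (hz : z ∈ ct x0)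
    (h1 : cs x0 z ∈ (chartAt (E n) x1).source) (u v : E n) :
    fderiv ℝ (chg x0 x1) z (chr g x0 z u v) =
      chr g x1 (chg x0 x1 z) (fderiv ℝ (chg x0 x1) z u) (fderiv ℝ (chg x0 x1) z v) +
        fderiv ℝ (fderiv ℝ (chg x0 x1)) z u v :=
  lchr_transform (isTrans_chg hz h1) (hg.diff_rep hz) (hg.diff_rep (chart_mem_ct h1))
    (hg.met_rep hz) (hg.eventually_met (chart_mem_ct h1))
    (((eventually_ct hz).and (eventually_cs_source hz h1)).mono fun _ h u v =>
      repB_chg h.1 h.2 g u v) u v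

theorem riemann_eq (hg : MF g) (x : X) : riemann g x = lriem (chr g x) (chartAt (E n) x x) := by
  have h1 : christoffel g x ∘ cs x =ᶠ[𝓝 (chartAt (E n) x x)] chr g x := by
    filter_upwards [eventually_ct (self_mem_ct x)] with z hz
    rw [Function.comp, hg.christoffel_eq (cs_mem hz), chart_cs hz]
  have h2 : diff (christoffel g x) x = fderiv ℝ (chr g x) (chartAt (E n) x x) := by
    rw [diff_self (h1.differentiableAt_iff.2 (hg.diff_chr (self_mem_ct x))), h1.fderiv_eq]
  have h3 : riemann g x = curvOp (diff (christoffel g x) x) (christoffel g x x) := rfl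
  rw [h3, h2, hg.christoffel_self]
  rfl

/-- The tensor is defined at each point through the preferred chart of that very point. The
transformation laws show that one fixed chart computes it on its whole domain; this is what makes
smoothness and differentiation accessible. -/
theorem ricci_rep (hg : MF g) {x : X} {z : E n} (hz : z ∈ ct x) :
    repB x (ricci g) z = ricOp (lriem (chr g x) z) := by
  have h1 := mem_chart_source (E n) (cs x z)
  have hT := isTrans_chg hz h1
  ext v w
  rw [ricOp_transform (R1 := lriem (chr g (cs x z)) (chg x (cs x z) z)) hT.left hT.right
    (fun u v w => lriem_transform hT ?_ (hg.diff_chr hz) (hg.diff_chr (chart_mem_ct h1)) u v w)]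
  · have h3 : ricci g (cs x z) = ricOp (riemann g (cs x z)) := rfl
    rw [repB_apply, h3, hg.riemann_eq, fderiv_chg hz]
    rfl
  · exact ((eventually_ct hz).and (eventually_cs_source hz h1)).mono fun _ h u v =>
      hg.chr_chg h.1 h.2 u v

end MF

/-- The covariant derivative of a section of `End (T_X)`. -/
def covE (g : BilField n X) (A : EndField n X) (x : X) : E n →L[ℝ] E n →L[ℝ] E n :=
  lnab (chr g x) (repE x A) (chartAt (E n) x x)

/-- The covariant derivative of a vector field. -/
def covV (g : BilField n X) (Y : X → E n) (x : X) : E n →L[ℝ] E n :=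
  lnabV (chr g x) (repV x Y) (chartAt (E n) x x)

theorem nablaEnd_eq {g : BilField n X} (hg : MF g) {A : EndField n X} (hA : SE A) (x : X)
    (u : Fin 1 → E n) : nablaEnd g A x u = covE g A x (u 0) := by
  have h1 : diff (fun y : X => toChart x y ∘L A y ∘L fromChart x y) x =
      fderiv ℝ (repE x A) (chartAt (E n) x x) :=
    diff_self (f := fun y : X => toChart x y ∘L A y ∘L fromChart x y)
      (ContDiffOn.diff_ct (hA x) (self_mem_ct x))
  have h2 : nablaEnd g A x u = diff (fun y : X => toChart x y ∘L A y ∘L fromChart x y) x (u 0)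
    + (christoffel g x x (u 0) ∘L A x - A x ∘L christoffel g x x (u 0)) - ∑ j : Fin 0, A x := rfl
  rw [h2, h1, hg.christoffel_self, covE, lnab_apply, repE_self]
  simp

/-- As for the Ricci tensor, a derivative taken pointwise in moving charts is identified with one
coordinate formula on a fixed chart. -/
theorem covE_rep {g : BilField n X} (hg : MF g) {A : EndField n X} (hA : SE A) {x : X} {z : E n}
    (hz : z ∈ ct x) : rep1 x (covE g A) z = lnab (chr g x) (repE x A) z := by
  have h1 := mem_chart_source (E n) (cs x z)
  have hT := isTrans_chg hz h1
  ext1 u; ext1 v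
  have h := lnab_transform hT (fun u v => hg.chr_chg hz h1 u v)
    (ContDiffOn.diff_ct (hA x) hz) (ContDiffOn.diff_ct (hA _) (chart_mem_ct h1))
    (((eventually_ct hz).and (eventually_cs_source hz h1)).mono fun _ h u =>
      repE_chg h.1 h.2 A u) u v
  rw [← hT.left (lnab (chr g x) (repE x A) z u v), h, rep1_apply, fderiv_chg hz]
  rfl

theorem covV_rep {g : BilField n X} (hg : MF g) {Y : X → E n} (hY : SV Y) {x : X} {z : E n}
    (hz : z ∈ ct x) : repE x (covV g Y) z = lnabV (chr g x) (repV x Y) z := by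
  have h1 := mem_chart_source (E n) (cs x z)
  have hT := isTrans_chg hz h1
  ext1 u
  have h := lnabV_transform hT (fun u v => hg.chr_chg hz h1 u v)
    (ContDiffOn.diff_ct (hY x) hz) (ContDiffOn.diff_ct (hY _) (chart_mem_ct h1))
    (((eventually_ct hz).and (eventually_cs_source hz h1)).mono fun _ h =>
      repV_chg h.1 h.2 Y) u
  rw [← hT.left (lnabV (chr g x) (repV x Y) z u), h, repE_apply, fderiv_chg hz]
  rfl

theorem repθ_diff {f : X → ℝ} (hf : SF n f) {x : X} {z : E n} (hz : z ∈ ct x) :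
    repθ x (diff f) z = fderiv ℝ (f ∘ cs x) z := by
  have := diff_fromChart (f := f) (cs_mem hz)
    (by rw [chart_cs hz]; exact ContDiffOn.diff_ct (hf x) hz)
  rwa [chart_cs hz] at this

theorem SF.diff_eq {f : X → ℝ} (hf : SF n f) (x : X) :
    diff f x = fderiv ℝ (f ∘ cs x) (chartAt (E n) x x) :=
  diff_self (ContDiffOn.diff_ct (hf x) (self_mem_ct x))

theorem hessian_eq {g : BilField n X} (hg : MF g) {f : X → ℝ} (hf : SF n f) (x : X) (u v : E n) :
    hessian g f x u v = fderiv ℝ (fderiv ℝ (f ∘ cs x)) (chartAt (E n) x x) u v -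
      fderiv ℝ (f ∘ cs x) (chartAt (E n) x x) (chr g x (chartAt (E n) x x) u v) := by
  have h1 : (fun y : X => diff f y ∘L fromChart x y) ∘ cs x =ᶠ[𝓝 (chartAt (E n) x x)]
      fderiv ℝ (f ∘ cs x) := by
    filter_upwards [eventually_ct (self_mem_ct x)] with z hz using repθ_diff hf hz
  have h2 : diff (fun y : X => diff f y ∘L fromChart x y) x =
      fderiv ℝ (fderiv ℝ (f ∘ cs x)) (chartAt (E n) x x) := by
    rw [diff_self (h1.differentiableAt_iff.2
      (ContDiffOn.diff_ct (ContDiffOn.fderiv_ct (hf x)) (self_mem_ct x))), h1.fderiv_eq]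
  rw [hessian_apply, h2, hf.diff_eq, hg.christoffel_self]

theorem hessian_rep {g : BilField n X} (hg : MF g) {f : X → ℝ} (hf : SF n f) {x : X} {z : E n}
    (hz : z ∈ ct x) (u v : E n) :
    repB x (hessian g f) z u v = fderiv ℝ (fderiv ℝ (f ∘ cs x)) z u v -
      fderiv ℝ (f ∘ cs x) z (chr g x z u v) := by
  have h1 := mem_chart_source (E n) (cs x z)
  have hT := isTrans_chg hz h1
  rw [lhess_transform hT (fun u v => hg.chr_chg hz h1 u v)
    (ContDiffOn.diff_ct (ContDiffOn.fderiv_ct (hf x)) hz)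
    (ContDiffOn.at_ct (hf (cs x z)) (chart_mem_ct h1))
    ((eventually_cs_source hz h1).mono fun _ h => by
      simp only [Function.comp, cs_chg h]), repB_apply, hessian_eq hg hf, fderiv_chg hz]
  rfl

/-! ### Smoothness of derived fields -/

theorem SE.comp {A B : EndField n X} (hA : SE A) (hB : SE B) : SE fun x => A x ∘L B x := fun x =>
  ((hA x).clm_comp (hB x)).congr fun z hz => by
    ext1 u
    simp [repE_apply, fromChart_toChart (cs_mem hz)]

theorem SE.add {A B : EndField n X} (hA : SE A) (hB : SE B) : SE (A + B) := fun x =>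
  ((hA x).add (hB x)).congr fun z hz => by ext1 u; simp [repE_apply]

theorem SE.smul {A : EndField n X} (c : ℝ) (hA : SE A) : SE (c • A) := fun x =>
  ((hA x).const_smul c).congr fun z hz => by ext1 u; simp [repE_apply]

theorem repE_exp {x : X} {z : E n} (hz : z ∈ ct x) (A : EndField n X) :
    repE x (expEnd A) z = NormedSpace.exp (repE x A z) := by
  have h := exp_conj (F := fromChart x (cs x z)) (T := toChart x (cs x z))
    (by ext1 u; exact fromChart_toChart (cs_mem hz) u)
    (by ext1 u; exact toChart_fromChart (cs_mem hz) u) (A (cs x z))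
  simp only [mul_assoc] at h
  exact h.symm

theorem SE.exp {A : EndField n X} (hA : SE A) : SE (expEnd A) := fun x =>
  (contDiff_exp_end.comp_contDiffOn (hA x)).congr fun _ hz => repE_exp hz A

theorem tr_repE {x : X} {z : E n} (hz : z ∈ ct x) (A : EndField n X) :
    tr (repE x A z) = tr (A (cs x z)) :=
  tr_conj (by ext1 u; exact fromChart_toChart (cs_mem hz) u) _

theorem SE.tr {A : EndField n X} (hA : SE A) : SF n fun x => tr (A x) := fun x =>
  ((trL n).contDiff.comp_contDiffOn (hA x)).congr fun _ hz => (tr_repE hz A).symm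

theorem repB_inverse {g : BilField n X} (hg : MF g) {x : X} {z : E n} (hz : z ∈ ct x)
    (θ : E n →L[ℝ] ℝ) :
    (repB x g z).inverse (θ ∘L fromChart x (cs x z)) =
      toChart x (cs x z) ((g (cs x z)).inverse θ) := by
  refine (hg.met_rep hz).ext fun w => ?_
  rw [(hg.met_rep hz).inverse_apply, repB_apply, fromChart_toChart (cs_mem hz),
    (hg.met _).inverse_apply]
  rfl

theorem repE_sharp {g : BilField n X} (hg : MF g) {x : X} {z : E n} (hz : z ∈ ct x)
    (v : BilField n X) : repE x (sharp g v) z = (repB x g z).inverse ∘L repB x v z := by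
  ext1 u
  exact (repB_inverse hg hz _).symm

theorem SB.sharp {g v : BilField n X} (hg : MF g) (hv : SB v) : SE (sharp g v) := fun x =>
  ((contDiffOn_inverse (hg.sB x) fun _ hz => hg.met_rep hz).clm_comp (hv x)).congr
    fun _ hz => repE_sharp hg hz v

theorem SB.add {g v : BilField n X} (hg : SB g) (hv : SB v) : SB (fun x => g x + v x) := fun x =>
  ((hg x).add (hv x)).congr fun z hz => by ext; simp [repB_apply]

theorem MF.sB_ricci {g : BilField n X} (hg : MF g) : SB (ricci g) := fun x => by
  have hΓ := hg.contDiffOn_chr x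
  have h1 := ContDiffOn.fderiv_ct hΓ
  have h2 : ContDiffOn ℝ ∞ (fun z => lriem (chr g x) z) (ct x) := by
    rw [contDiffOn_clm_apply]; intro u
    rw [contDiffOn_clm_apply]; intro v
    simp only [lriem, curvOp_apply]
    fun_prop
  refine ContDiffOn.congr (f := fun z => ricOp (lriem (chr g x) z)) ?_ fun z hz => hg.ricci_rep hz
  rw [contDiffOn_clm_apply]; intro v
  rw [contDiffOn_clm_apply]; intro w
  have h3 : ContDiffOn ℝ ∞ (fun z => ((lriem (chr g x) z).flip v).flip w) (ct x) := by
    rw [contDiffOn_clm_apply]; intro u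
    simp only [ContinuousLinearMap.flip_apply]
    fun_prop
  exact (trL n).contDiff.comp_contDiffOn h3

theorem MF.sB_hessian {g : BilField n X} (hg : MF g) {f : X → ℝ} (hf : SF n f) :
    SB (hessian g f) := fun x => by
  have hΓ := hg.contDiffOn_chr x
  have h1 := ContDiffOn.fderiv_ct (hf x)
  have h2 := ContDiffOn.fderiv_ct h1
  rw [contDiffOn_clm_apply]; intro u
  rw [contDiffOn_clm_apply]; intro v
  refine ContDiffOn.congr ?_ fun z hz => hessian_rep hg hf hz u v
  fun_prop

theorem SV.covV {g : BilField n X} (hg : MF g) {Y : X → E n} (hY : SV Y) : SE (covV g Y) :=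
  fun x => by
  have hΓ := hg.contDiffOn_chr x
  have h0 := hY x
  have h1 := ContDiffOn.fderiv_ct (hY x)
  refine ContDiffOn.congr ?_ fun z hz => covV_rep hg hY hz
  rw [contDiffOn_clm_apply]; intro u
  simp only [lnabV_apply]
  fun_prop

/-- An `End (T_X)`-valued 1-form that is smooth in all charts. -/
def S1 (D : X → E n →L[ℝ] E n →L[ℝ] E n) : Prop :=
  ∀ x : X, ContDiffOn ℝ ∞ (rep1 x D) (ct x : Set (E n))

theorem SE.covE {g : BilField n X} (hg : MF g) {A : EndField n X} (hA : SE A) : S1 (covE g A) :=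
  fun x => by
  have hΓ := hg.contDiffOn_chr x
  have h0 := hA x
  have h1 := ContDiffOn.fderiv_ct (hA x)
  refine ContDiffOn.congr ?_ fun z hz => covE_rep hg hA hz
  rw [contDiffOn_clm_apply]; intro u
  simp only [lnab_apply]
  fun_prop

theorem SE.apply {A : EndField n X} {Y : X → E n} (hA : SE A) (hY : SV Y) :
    SV fun x => A x (Y x) := fun x =>
  ((hA x).clm_apply (hY x)).congr fun z hz => by
    simp [repE_apply, repV, fromChart_toChart (cs_mem hz)]

theorem S1.apply {D : X → E n →L[ℝ] E n →L[ℝ] E n} {Y : X → E n} (hD : S1 D) (hY : SV Y) :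
    SE fun x => D x (Y x) := fun x =>
  ((hD x).clm_apply (hY x)).congr fun z hz => by
    ext1 v
    simp [repE_apply, rep1_apply, repV, fromChart_toChart (cs_mem hz)]

theorem SV.raise {g : BilField n X} (hg : MF g) {θ : X → E n →L[ℝ] ℝ}
    (hθ : ∀ x : X, ContDiffOn ℝ ∞ (repθ x θ) (ct x : Set (E n))) :
    SV fun x => raise g x (θ x) := fun x =>
  ((contDiffOn_inverse (hg.sB x) fun _ hz => hg.met_rep hz).clm_apply (hθ x)).congr
    fun _ hz => (repB_inverse hg hz _).symm

theorem SF.raise_diff {g : BilField n X} (hg : MF g) {f : X → ℝ} (hf : SF n f) :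
    SV fun x => raise g x (diff f x) :=
  SV.raise hg fun x => (ContDiffOn.fderiv_ct (hf x)).congr fun _ hz => repθ_diff hf hz

theorem repE_comp {x : X} {z : E n} (hz : z ∈ ct x) (A B : EndField n X) :
    repE x (fun y => A y ∘L B y) z = repE x A z ∘L repE x B z := by
  ext1 u
  simp [repE_apply, fromChart_toChart (cs_mem hz)]

end

section

variable {n : ℕ} {X : Type*} [TopologicalSpace X] [ChartedSpace (E n) X] [IsManifold (𝓡 n) ∞ X]

/-! ### Densities -/

theorem form_apply (f : (E n) [⋀^Fin n]→L[ℝ] ℝ) (v : Fin n → E n) :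
    f v = f e * (Matrix.of fun i j : Fin n => v i j).det := by
  have h := AlternatingMap.eq_smul_basis_det (EuclideanSpace.basisFun (Fin n) ℝ).toBasis
    f.toAlternatingMap
  have h1 := congrArg (fun L : (E n) [⋀^Fin n]→ₗ[ℝ] ℝ => L v) h
  have hb : ⇑(EuclideanSpace.basisFun (Fin n) ℝ).toBasis = (e : Fin n → E n) := by
    funext i; simp [e]
  simp only [AlternatingMap.smul_apply, smul_eq_mul, hb] at h1
  refine h1.trans ?_
  congr 1
  rw [Module.Basis.det_apply, ← Matrix.det_transpose]
  congr 1

theorem form_comp (f : (E n) [⋀^Fin n]→L[ℝ] ℝ) (F : E n →L[ℝ] E n) :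
    f (fun i => F (e i)) = f e * detE F := form_apply f _

theorem form_e_ne_zero {f : (E n) [⋀^Fin n]→L[ℝ] ℝ} (hf : f ≠ 0) : f e ≠ 0 := fun h => hf <| by
  ext v
  rw [form_apply, h, zero_mul]
  rfl

theorem detE_ne_zero {F T : E n →L[ℝ] E n} (h : ∀ u, T (F u) = u) : detE F ≠ 0 := by
  intro h0
  have h1 : T * F = 1 := by ext1 u; exact h u
  have h2 := detE_mul T F
  rw [h1, detE_one, h0, mul_zero] at h2
  exact one_ne_zero h2

/-- The density of a volume form in the preferred chart at `x`. -/
def dens (Ω : VolumeForm n X) (x : X) (z : E n) : ℝ :=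
  |Ω.form (cs x z) (fun i => fromChart x (cs x z) (e i))|

theorem dens_eq (Ω : VolumeForm n X) (x : X) (z : E n) :
    dens Ω x z = |Ω.form (cs x z) e| * |detE (n := n) (fromChart x (cs x z))| := by
  rw [dens, form_comp, abs_mul]

theorem dens_pos (Ω : VolumeForm n X) {x : X} {z : E n} (hz : z ∈ ct x) : 0 < dens Ω x z := by
  rw [dens_eq]
  exact mul_pos (abs_pos.2 (form_e_ne_zero (Ω.ne_zero _)))
    (abs_pos.2 (detE_ne_zero (toChart_fromChart (cs_mem hz))))

theorem contDiffOn_dens (Ω : VolumeForm n X) (x : X) : ContDiffOn ℝ ∞ (dens Ω x) (ct x) := by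
  have h1 : ContDiffOn ℝ ∞ (fun z => Ω.form (cs x z) (fun i => fromChart x (cs x z) (e i)))
      (ct x) := (contMDiffOn_chart_iff
    (fun y : X => Ω.form y (fun i => fromChart x y (e i))) x).1 (Ω.smooth x)
  intro z hz
  exact (contDiffAt_abs (abs_pos.1 (dens_pos Ω hz))).comp_contDiffWithinAt z (h1 z hz)

/-- Both densities are multiplied by |det| of the frame `fromChart`, so their quotient may be
computed in coordinates. -/
theorem logVol_rep (Ω : VolumeForm n X) {g : BilField n X} (hg : MF g) {x : X} {z : E n}
    (hz : z ∈ ct x) : logVol Ω g (cs x z) =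
      1 / 2 * Real.log (detB (repB x g z)) - Real.log (dens Ω x z) := by
  have h1 : logVol Ω g (cs x z) =
      Real.log (Real.sqrt (detB (g (cs x z))) / |Ω.form (cs x z) e|) := rfl
  have h2 : detB (repB x g z) = detE (fromChart x (cs x z)) ^ 2 * detB (g (cs x z)) :=
    detB_bilinearComp _ _
  have h3 := (hg.met (cs x z)).detB_pos
  have h4 : |detE (fromChart x (cs x z))| ≠ 0 :=
    abs_ne_zero.2 (detE_ne_zero (toChart_fromChart (cs_mem hz)))
  have h5 : |Ω.form (cs x z) e| ≠ 0 := abs_ne_zero.2 (form_e_ne_zero (Ω.ne_zero _))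
  rw [h1, h2, dens_eq, Real.log_div (Real.sqrt_pos.2 h3).ne' h5, Real.log_sqrt h3.le,
    Real.log_mul h5 h4, ← sq_abs, Real.log_mul (pow_ne_zero 2 h4) h3.ne', Real.log_pow]
  push_cast
  ring

theorem MF.contDiffOn_detB {g : BilField n X} (hg : MF g) (x : X) :
    ContDiffOn ℝ ∞ (fun z => detB (repB x g z)) (ct x) :=
  contDiff_detB.comp_contDiffOn (hg.sB x)

theorem MF.sF_logVol (Ω : VolumeForm n X) {g : BilField n X} (hg : MF g) : SF n (logVol Ω g) :=
  fun x => by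
  refine ContDiffOn.congr ?_ fun z hz => logVol_rep Ω hg hz
  exact (contDiffOn_const.mul ((hg.contDiffOn_detB x).log
    fun z hz => (hg.met_rep hz).detB_pos.ne')).sub
      ((contDiffOn_dens Ω x).log fun z hz => (dens_pos Ω hz).ne')

theorem fderiv_logVol (Ω : VolumeForm n X) {g : BilField n X} (hg : MF g) {x : X} {z : E n}
    (hz : z ∈ ct x) (u : E n) : fderiv ℝ (logVol Ω g ∘ cs x) z u =
      tr (chr g x z u) - fderiv ℝ (dens Ω x) z u / dens Ω x z := by
  have h1 : logVol Ω g ∘ cs x =ᶠ[𝓝 z] fun z =>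
      1 / 2 * Real.log (detB (repB x g z)) - Real.log (dens Ω x z) :=
    (eventually_ct hz).mono fun z' hz' => logVol_rep Ω hg hz'
  have h2 := (ContDiffOn.diff_ct (hg.contDiffOn_detB x) hz).hasFDerivAt
  have h3 := (ContDiffOn.diff_ct (contDiffOn_dens Ω x) hz).hasFDerivAt
  have h4 := (hg.met_rep hz).detB_pos.ne'
  rw [h1.fderiv_eq, (((h2.log h4).const_mul (1 / 2 : ℝ)).fun_sub
    (h3.log (dens_pos Ω hz).ne')).fderiv]
  simp only [sub_apply, smul_apply, smul_eq_mul]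
  rw [fderiv_detB_field (hg.diff_rep hz) (hg.eventually_met hz)]
  field_simp
  rfl

/-- The divergence of a vector field with respect to the volume form. -/
def divV (Ω : VolumeForm n X) (g : BilField n X) (Y : X → E n) (x : X) : ℝ :=
  tr (covV g Y x) - diff (logVol Ω g) x (Y x)

/-- The trace of the Christoffel symbols occurs once in Tr ∇Y and once in the differential of
log(dV_g/Ω), and cancels. What remains is the coordinate divergence of the density times Y, free of
the metric and ready for integration by parts. -/
theorem divV_rep (Ω : VolumeForm n X) {g : BilField n X} (hg : MF g) {Y : X → E n} (hY : SV Y)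
    {x : X} {z : E n} (hz : z ∈ ct x) : divV Ω g Y (cs x z) * dens Ω x z =
      tr (fderiv ℝ (repV x Y) z) * dens Ω x z + fderiv ℝ (dens Ω x) z (repV x Y z) := by
  have h1 : diff (logVol Ω g) (cs x z) (Y (cs x z)) =
      fderiv ℝ (logVol Ω g ∘ cs x) z (repV x Y z) := by
    rw [← repθ_diff (hg.sF_logVol Ω) hz]
    exact congrArg _ (fromChart_toChart (cs_mem hz) _).symm
  have h2 : tr (covV g Y (cs x z)) =
      tr (fderiv ℝ (repV x Y) z) + tr (chr g x z (repV x Y z)) := by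
    have h3 : (chr g x z).flip (repV x Y z) = chr g x z (repV x Y z) := by
      ext1 u
      exact lchr_symm (hg.diff_rep hz) (hg.eventually_met hz) u (repV x Y z)
    rw [← tr_repE hz, covV_rep hg hY hz, lnabV, tr_add, h3]
  rw [divV, h1, h2, fderiv_logVol Ω hg hz]
  have := (dens_pos Ω hz).ne'
  field_simp
  ring

theorem MF.sF_divV (Ω : VolumeForm n X) {g : BilField n X} (hg : MF g) {Y : X → E n} (hY : SV Y) :
    SF n (divV Ω g Y) := fun x => by
  have h1 := (SE.tr (SV.covV hg hY)) x
  have h2 := (ContDiffOn.fderiv_ct (hg.sF_logVol Ω x)).clm_apply (hY x)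
  refine (h1.sub h2).congr fun z hz => ?_
  rw [← repθ_diff (hg.sF_logVol Ω) hz]
  simp only [Function.comp, divV]
  congr 1
  exact congrArg _ (fromChart_toChart (cs_mem hz) _).symm

end

section

variable {n : ℕ} {X : Type*} [TopologicalSpace X] [ChartedSpace (E n) X] [IsManifold (𝓡 n) ∞ X]
  [MeasurableSpace X] [BorelSpace X]

/-! ### The measure of a volume form -/

theorem measurableSet_ct (x : X) : MeasurableSet (ct x : Set (E n)) := (isOpen_ct x).measurableSet

theorem aemeasurable_cs (x : X) :
    AEMeasurable (cs x) ((volume : Measure (E n)).restrict (ct x)) :=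
  (continuousOn_cs x).aemeasurable (measurableSet_ct x)

theorem measurableSet_ct_inter (x : X) {T : Set X} (hT : MeasurableSet T) :
    MeasurableSet (ct x ∩ cs x ⁻¹' T : Set (E n)) := by
  have h1 : Measurable ((ct x : Set (E n)).domRestrict (cs x)) :=
    (continuousOn_iff_continuous_domRestrict.1 (continuousOn_cs x)).measurable
  have h2 := (measurableSet_ct (n := n) x).subtype_image (h1 hT)
  convert h2 using 1
  ext z
  simp only [Set.mem_inter_iff, Set.mem_preimage, Set.mem_image, Subtype.exists, exists_and_right,
    exists_eq_right]
  exact ⟨fun h => ⟨h.1, h.2⟩, fun ⟨h1, h2⟩ => ⟨h1, h2⟩⟩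

theorem aemeasurable_dens (Ω : VolumeForm n X) (x : X) :
    AEMeasurable (fun z => ENNReal.ofReal (dens Ω x z)) ((volume : Measure (E n)).restrict (ct x)) :=
  ((contDiffOn_dens Ω x).continuousOn.aemeasurable (measurableSet_ct x)).ennreal_ofReal

theorem chartMeasure_eq (Ω : VolumeForm n X) (x : X) : Ω.chartMeasure x =
    (((volume : Measure (E n)).restrict (ct x)).withDensity
      fun z => ENNReal.ofReal (dens Ω x z)).map (cs x) := rfl

theorem aemeasurable_cs' (Ω : VolumeForm n X) (x : X) :
    AEMeasurable (cs x) (((volume : Measure (E n)).restrict (ct x)).withDensity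
      fun z => ENNReal.ofReal (dens Ω x z)) :=
  (aemeasurable_cs x).mono_ac (withDensity_absolutelyContinuous _ _)

theorem chartMeasure_apply (Ω : VolumeForm n X) (x : X) {T : Set X} (hT : MeasurableSet T) :
    Ω.chartMeasure x T = ∫⁻ z in ct x ∩ cs x ⁻¹' T, ENNReal.ofReal (dens Ω x z) := by
  rw [chartMeasure_eq, Measure.map_apply_of_aemeasurable (aemeasurable_cs' Ω x) hT,
    withDensity_apply', Measure.restrict_restrict₀ ((aemeasurable_cs x).nullMeasurable hT),
    Set.inter_comm]

theorem chartMeasure_source (Ω : VolumeForm n X) (x : X) {T : Set X} (hT : MeasurableSet T) :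
    Ω.chartMeasure x (T ∩ (chartAt (E n) x).source) = Ω.chartMeasure x T := by
  rw [chartMeasure_apply Ω x hT, chartMeasure_apply Ω x
    (hT.inter (chartAt (E n) x).open_source.measurableSet)]
  congr 2
  ext z
  simp only [Set.mem_inter_iff, Set.mem_preimage]
  exact ⟨fun h => ⟨h.1, h.2.1⟩, fun h => ⟨h.1, h.2, cs_mem h.1⟩⟩

/-- Change of variables along `chg x0 x1`: the densities in the two charts differ exactly by the
Jacobian determinant. -/
theorem chartMeasure_compat (Ω : VolumeForm n X) (x0 x1 : X) {T : Set X} (hT : MeasurableSet T)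
    (h0 : T ⊆ (chartAt (E n) x0).source) (h1 : T ⊆ (chartAt (E n) x1).source) :
    Ω.chartMeasure x0 T = Ω.chartMeasure x1 T := by
  rw [chartMeasure_apply Ω x0 hT, chartMeasure_apply Ω x1 hT]
  have him : ct x1 ∩ cs x1 ⁻¹' T = chg x0 x1 '' (ct x0 ∩ cs x0 ⁻¹' T : Set (E n)) := by
    ext w
    constructor
    · rintro ⟨hw, hwT⟩
      refine ⟨chartAt (E n) x0 (cs x1 w), ⟨chart_mem_ct (h0 hwT), ?_⟩, ?_⟩
      · rw [Set.mem_preimage, cs_chart (h0 hwT)]; exact hwT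
      · rw [chg, cs_chart (h0 hwT), chart_cs hw]
    · rintro ⟨z, ⟨_, hzT⟩, rfl⟩
      refine ⟨chart_mem_ct (h1 hzT), ?_⟩
      rw [Set.mem_preimage, cs_chg (h1 hzT)]; exact hzT
  rw [him, lintegral_image_eq_lintegral_abs_det_fderiv_mul volume (measurableSet_ct_inter x0 hT)
    (f' := fderiv ℝ (chg x0 x1))
    (fun z hz => (isTrans_chg hz.1 (h1 hz.2)).diff.hasFDerivAt.hasFDerivWithinAt)]
  · refine setLIntegral_congr_fun (measurableSet_ct_inter x0 hT) fun z hz => ?_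
    have hF : fromChart x0 (cs x0 z) =
        fromChart x1 (cs x0 z) * fderiv ℝ (chg x0 x1) z := by
      ext1 v
      exact (fromChart_chg hz.1 (h1 hz.2) v).symm
    rw [← ENNReal.ofReal_mul (abs_nonneg _), dens_eq, dens_eq, cs_chg (h1 hz.2), hF, detE_mul,
      abs_mul, ← detE_eq_det]
    congr 1
    ring
  · intro z hz z' hz' h
    have h2 : cs x0 z = cs x0 z' := by
      rw [← cs_chg (h1 hz.2), h, cs_chg (h1 hz'.2)]
    rw [← chart_cs hz.1, h2, chart_cs hz'.1]

/-- Only the bound from above needs work. A finite cover by charts, made disjoint, glues the chart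
measures to a measure ν that dominates each of them, hence their supremum, while on subsets of one
chart ν agrees with the measure of that chart. -/
theorem measure_apply [CompactSpace X] (Ω : VolumeForm n X) (x : X) {T : Set X}
    (hT : MeasurableSet T) (hx : T ⊆ (chartAt (E n) x).source) :
    Ω.measure T = Ω.chartMeasure x T := by
  refine le_antisymm ?_ (le_iSup Ω.chartMeasure x T)
  obtain ⟨t, ht⟩ := isCompact_univ.elim_finite_subcover
    (fun x : X => (chartAt (E n) x).source) (fun x => (chartAt (E n) x).open_source)
    (fun y _ => Set.mem_iUnion.2 ⟨y, mem_chart_source _ y⟩)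
  have htne : (t : Set X).Nonempty := by
    obtain ⟨i, hi⟩ := Set.mem_iUnion.1 (ht (Set.mem_univ x))
    obtain ⟨hi, _⟩ := Set.mem_iUnion.1 hi
    exact ⟨i, hi⟩
  obtain ⟨s, hs⟩ := t.countable_toSet.exists_eq_range htne
  set D : ℕ → Set X := disjointed fun k => (chartAt (E n) (s k)).source with hD
  have hDm : ∀ k, MeasurableSet (D k) := fun k =>
    MeasurableSet.disjointed (fun k => (chartAt (E n) (s k)).open_source.measurableSet) k
  have hDs : ∀ k, D k ⊆ (chartAt (E n) (s k)).source := fun k => disjointed_subset _ k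
  have hDd : Pairwise (Function.onFun Disjoint D) := disjoint_disjointed _
  have hDu : ⋃ k, D k = Set.univ := by
    rw [hD, iUnion_disjointed]
    refine Set.eq_univ_of_forall fun y => ?_
    obtain ⟨i, hi⟩ := Set.mem_iUnion.1 (ht (Set.mem_univ y))
    obtain ⟨hit, hi⟩ := Set.mem_iUnion.1 hi
    have : i ∈ Set.range s := hs ▸ hit
    obtain ⟨k, rfl⟩ := this
    exact Set.mem_iUnion.2 ⟨k, hi⟩
  have hdec : ∀ ν : Measure X, ν = Measure.sum fun k => ν.restrict (D k) := fun ν => by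
    rw [← Measure.restrict_iUnion hDd hDm, hDu, Measure.restrict_univ]
  set ν : Measure X := Measure.sum fun k => (Ω.chartMeasure (s k)).restrict (D k) with hν
  -- Only an inequality: part of T ∩ D k may lie outside the chart at y, where the measure of that
  -- chart is zero.
  have hcomp : ∀ y k T, MeasurableSet T →
      Ω.chartMeasure y (T ∩ D k) ≤ Ω.chartMeasure (s k) (T ∩ D k) := by
    intro y k T hT
    have h1 : MeasurableSet (T ∩ D k) := hT.inter (hDm k)
    rw [← chartMeasure_source Ω y h1, chartMeasure_compat Ω y (s k)
      (h1.inter (chartAt (E n) y).open_source.measurableSet) Set.inter_subset_right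
      (Set.inter_subset_left.trans (Set.inter_subset_right.trans (hDs k)))]
    exact measure_mono Set.inter_subset_left
  have hle : Ω.measure ≤ ν := by
    refine iSup_le fun y => Measure.le_iff.2 fun T hT => ?_
    rw [hdec (Ω.chartMeasure y), Measure.sum_apply _ hT, hν, Measure.sum_apply _ hT]
    refine ENNReal.tsum_le_tsum fun k => ?_
    rw [Measure.restrict_apply hT, Measure.restrict_apply hT]
    exact hcomp y k T hT
  refine (hle T).trans ?_
  conv_rhs => rw [hdec (Ω.chartMeasure x)]
  rw [hν, Measure.sum_apply _ hT, Measure.sum_apply _ hT]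
  refine ENNReal.tsum_le_tsum fun k => ?_
  rw [Measure.restrict_apply hT, Measure.restrict_apply hT]
  exact (chartMeasure_compat Ω (s k) x (hT.inter (hDm k))
    (Set.inter_subset_right.trans (hDs k)) (Set.inter_subset_left.trans hx)).le

theorem restrict_measure [CompactSpace X] (Ω : VolumeForm n X) (x : X) :
    Ω.measure.restrict (chartAt (E n) x).source = Ω.chartMeasure x := by
  ext T hT
  rw [Measure.restrict_apply hT, measure_apply Ω x
    (hT.inter (chartAt (E n) x).open_source.measurableSet) Set.inter_subset_right,
    chartMeasure_source Ω x hT]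

theorem isOpen_ct_inter (x : X) {O : Set X} (hO : IsOpen O) :
    IsOpen (ct x ∩ cs x ⁻¹' O : Set (E n)) :=
  (continuousOn_cs x).isOpen_inter_preimage (isOpen_ct x) hO

/-- Compactness plays no role, since the supremum dominates each chart measure. This positivity is
what upgrades pointwise relations from almost every point to all points. -/
theorem measure_pos (Ω : VolumeForm n X) {O : Set X} (hO : IsOpen O) {x : X} (hx : x ∈ O) :
    Ω.measure O ≠ 0 := by
  have h1 : Ω.chartMeasure x O ≤ Ω.measure O := le_iSup Ω.chartMeasure x O
  intro h0
  rw [h0, nonpos_iff_eq_zero, chartMeasure_apply Ω x hO.measurableSet] at h1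
  have hm : AEMeasurable (fun z => ENNReal.ofReal (dens Ω x z))
      ((volume : Measure (E n)).restrict (ct x ∩ cs x ⁻¹' O)) :=
    (aemeasurable_dens Ω x).mono_measure (Measure.restrict_mono Set.inter_subset_left le_rfl)
  rw [lintegral_eq_zero_iff' hm] at h1
  have h2 := (ae_restrict_iff' (measurableSet_ct_inter x hO.measurableSet)).1 h1
  have h3 : (volume : Measure (E n)) (ct x ∩ cs x ⁻¹' O) = 0 := by
    refine measure_mono_null (fun z hz => ?_) (ae_iff.1 h2)
    simp only [Set.mem_ofPred_eq, Classical.not_imp]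
    refine ⟨hz, ?_⟩
    simpa using dens_pos Ω hz.1
  have h4 := (isOpen_ct_inter (n := n) x hO).measure_pos volume
    ⟨chartAt (E n) x x, self_mem_ct x, by rwa [Set.mem_preimage, cs_self]⟩
  exact h4.ne' h3

theorem isFiniteMeasure_measure [CompactSpace X] (Ω : VolumeForm n X) :
    IsFiniteMeasure Ω.measure := by
  have hloc : IsLocallyFiniteMeasure Ω.measure := by
    refine ⟨fun x => ?_⟩
    obtain ⟨r, hr, hK⟩ := Metric.nhds_basis_closedBall.mem_iff.1
      ((isOpen_ct x).mem_nhds (self_mem_ct (n := n) x))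
    set O : Set X := (chartAt (E n) x).source ∩ chartAt (E n) x ⁻¹' Metric.ball (chartAt (E n) x x) r
    have hO : IsOpen O := (chartAt (E n) x).isOpen_inter_preimage Metric.isOpen_ball
    refine ⟨O, hO.mem_nhds ⟨mem_chart_source _ x, Metric.mem_ball_self hr⟩, ?_⟩
    rw [measure_apply Ω x hO.measurableSet Set.inter_subset_left,
      chartMeasure_apply Ω x hO.measurableSet]
    have hcomp := isCompact_closedBall (chartAt (E n) x x) r
    have hcont : ContinuousOn (dens Ω x) (Metric.closedBall (chartAt (E n) x x) r) :=
      (contDiffOn_dens Ω x).continuousOn.mono hK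
    obtain ⟨C, hC⟩ := hcomp.exists_bound_of_continuousOn hcont
    have hsub : ct x ∩ cs x ⁻¹' O ⊆ Metric.closedBall (chartAt (E n) x x) r := by
      rintro z ⟨hz, hzO⟩
      have := hzO.2
      rw [Set.mem_preimage, chart_cs hz] at this
      exact Metric.ball_subset_closedBall this
    calc ∫⁻ z in ct x ∩ cs x ⁻¹' O, ENNReal.ofReal (dens Ω x z)
        ≤ ∫⁻ z in Metric.closedBall (chartAt (E n) x x) r, ENNReal.ofReal (dens Ω x z) :=
          lintegral_mono_set hsub
      _ ≤ ∫⁻ z in Metric.closedBall (chartAt (E n) x x) r, ENNReal.ofReal C := by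
          refine setLIntegral_mono' hcomp.measurableSet fun z hz => ?_
          exact ENNReal.ofReal_le_ofReal ((le_abs_self _).trans (hC z hz))
      _ < ⊤ := by
          rw [setLIntegral_const]
          exact ENNReal.mul_lt_top ENNReal.ofReal_lt_top hcomp.measure_lt_top
  exact CompactSpace.isFiniteMeasure

theorem integral_measure [CompactSpace X] (Ω : VolumeForm n X) (x : X) {h : X → ℝ}
    (hc : Continuous h) (h0 : ∀ y, y ∉ (chartAt (E n) x).source → h y = 0) :
    ∫ y, h y ∂Ω.measure = ∫ z in ct x, dens Ω x z * h (cs x z) := by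
  rw [← setIntegral_eq_integral_of_forall_compl_eq_zero h0, restrict_measure, chartMeasure_eq,
    integral_map (aemeasurable_cs' Ω x) hc.aestronglyMeasurable,
    integral_withDensity_eq_integral_toReal_smul₀ (aemeasurable_dens Ω x)
      (ae_of_all _ fun _ => ENNReal.ofReal_lt_top)]
  refine integral_congr_ae (ae_of_all _ fun z => ?_)
  have : (0 : ℝ) ≤ dens Ω x z := abs_nonneg _
  simp only [smul_eq_mul, ENNReal.toReal_ofReal this]

end

section

variable {n : ℕ} {X : Type*} [TopologicalSpace X] [ChartedSpace (E n) X] [IsManifold (𝓡 n) ∞ X]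

/-! ### The divergence theorem -/

theorem integrable_mul_of_tsupport {k G : E n → ℝ} {U : Set (E n)} (hk : Continuous k)
    (hc : HasCompactSupport k) (hU : tsupport k ⊆ U) (hG : ContinuousOn G U) :
    Integrable (fun z => k z * G z) := by
  have h1 : IntegrableOn (fun z => k z * G z) (tsupport k) :=
    (hk.continuousOn.mul (hG.mono hU)).integrableOn_compact hc
  rwa [integrableOn_iff_integrable_of_support_subset] at h1
  intro z hz
  refine subset_tsupport k fun h => hz ?_
  simp [h]

/-- Integration by parts in each coordinate. The field G need only be defined and differentiable on
U, because r vanishes near the complement of U. -/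
theorem integral_mul_div {r : E n → ℝ} {U : Set (E n)} (hUo : IsOpen U) (hr : ContDiff ℝ 1 r)
    (hc : HasCompactSupport r) (hU : tsupport r ⊆ U) {G : E n → E n} (hG : ContDiffOn ℝ 1 G U) :
    ∫ z, r z * tr (fderiv ℝ G z) = -∫ z, fderiv ℝ r z (G z) := by
  have hGj : ∀ j : Fin n, ContDiffOn ℝ 1 (fun z => G z j) U := fun j =>
    (dualBasis j).contDiff.comp_contDiffOn hG
  have hGd : ∀ z ∈ U, DifferentiableAt ℝ G z := fun z hz =>
    (hG.contDiffAt (hUo.mem_nhds hz)).differentiableAt (by simp)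
  have hGjd : ∀ z ∈ U, ∀ j : Fin n, ∀ v, fderiv ℝ (fun z => G z j) z v = fderiv ℝ G z v j :=
    fun z hz j v => by
      have := ((dualBasis j).hasFDerivAt.comp z (hGd z hz).hasFDerivAt).fderiv
      exact congrArg (fun L : E n →L[ℝ] ℝ => L v) this
  have hr' : Continuous (fderiv ℝ r) := hr.continuous_fderiv (by simp)
  have hrj : ∀ j : Fin n, Continuous fun z => fderiv ℝ r z (e j) := fun j =>
    hr'.clm_apply continuous_const
  have hsupp : ∀ j : Fin n, tsupport (fun z => fderiv ℝ r z (e j)) ⊆ tsupport r := fun j =>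
    (closure_mono fun z hz => by
      contrapose! hz
      simp only [Function.mem_support, not_not] at hz ⊢
      rw [hz]; rfl).trans (tsupport_fderiv_subset ℝ)
  have hcj : ∀ j : Fin n, HasCompactSupport fun z => fderiv ℝ r z (e j) := fun j =>
    hc.of_isClosed_subset (isClosed_tsupport _) (hsupp j)
  have hfG : ∀ j : Fin n, ContinuousOn (fun z => fderiv ℝ (fun z => G z j) z (e j)) U := fun j =>
    ((hGj j).continuousOn_fderiv_of_isOpen hUo (by simp)).clm_apply continuousOn_const
  have hi1 : ∀ j : Fin n, Integrable fun z => fderiv ℝ r z (e j) * G z j := fun j =>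
    integrable_mul_of_tsupport (hrj j) (hcj j) ((hsupp j).trans hU) (hGj j).continuousOn
  have hi2 : ∀ j : Fin n, Integrable fun z => r z * fderiv ℝ (fun z => G z j) z (e j) := fun j =>
    integrable_mul_of_tsupport hr.continuous hc hU (hfG j)
  have hi3 : ∀ j : Fin n, Integrable fun z => r z * G z j := fun j =>
    integrable_mul_of_tsupport hr.continuous hc hU (hGj j).continuousOn
  have key : ∀ j : Fin n, ∫ z, r z * fderiv ℝ (fun z => G z j) z (e j) =
      -∫ z, fderiv ℝ r z (e j) * G z j := fun j =>
    integral_mul_fderiv_eq_neg_fderiv_mul_of_integrable (hi1 j) (hi2 j) (hi3 j)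
      (fun z _ => (hr.differentiable (by simp)).differentiableAt)
      (fun z hz => ((hGj j).contDiffAt (hUo.mem_nhds (hU hz))).differentiableAt (by simp))
  have e1 : (fun z => r z * tr (fderiv ℝ G z)) =
      fun z => ∑ j, r z * fderiv ℝ (fun z => G z j) z (e j) := by
    funext z
    by_cases hz : z ∈ U
    · simp_rw [hGjd z hz]
      rw [tr_eq_sum, Finset.mul_sum]
    · have : r z = 0 := image_eq_zero_of_notMem_tsupport fun h => hz (hU h)
      simp [this]
  have e2 : (fun z => fderiv ℝ r z (G z)) = fun z => ∑ j, fderiv ℝ r z (e j) * G z j := by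
    funext z
    conv_lhs => rw [← sum_coord (G z)]
    simp [mul_comm]
  rw [e1, e2, integral_finsetSum _ fun j _ => hi2 j, integral_finsetSum _ fun j _ => hi1 j,
    ← Finset.sum_neg_distrib]
  exact Finset.sum_congr rfl fun j _ => key j

theorem SF.diff_apply {f : X → ℝ} (hf : SF n f) {Y : X → E n} (hY : SV Y) :
    SF n fun y => diff f y (Y y) := fun x =>
  ((ContDiffOn.fderiv_ct (hf x)).clm_apply (hY x)).congr fun z hz => by
    rw [← repθ_diff hf hz]
    show diff f (cs x z) (Y (cs x z)) =
      diff f (cs x z) (fromChart x (cs x z) (toChart x (cs x z) (Y (cs x z))))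
    rw [fromChart_toChart (cs_mem hz)]

theorem SF.mul {f h : X → ℝ} (hf : SF n f) (hh : SF n h) : SF n fun y => f y * h y :=
  fun x => (hf x).mul (hh x)

variable [MeasurableSpace X] [BorelSpace X] [CompactSpace X]

theorem integral_mul_divV (Ω : VolumeForm n X) {g : BilField n X} (hg : MF g) {Y : X → E n}
    (hY : SV Y) {ρ : X → ℝ} (hρ : SF n ρ) {x : X} (hx : tsupport ρ ⊆ (chartAt (E n) x).source) :
    ∫ y, ρ y * divV Ω g Y y ∂Ω.measure = -∫ y, diff ρ y (Y y) ∂Ω.measure := by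
  have hz0 : ∀ y, y ∉ (chartAt (E n) x).source → ρ y = 0 := fun y hy =>
    image_eq_zero_of_notMem_tsupport fun h => hy (hx h)
  have hd0 : ∀ y, y ∉ (chartAt (E n) x).source → diff ρ y = 0 := fun y hy => by
    have h1 : ρ =ᶠ[𝓝 y] fun _ => 0 := by
      filter_upwards [(isClosed_tsupport ρ).isOpen_compl.mem_nhds fun h => hy (hx h)] with p hp
      exact image_eq_zero_of_notMem_tsupport hp
    show mfderiv (𝓡 n) 𝓘(ℝ, ℝ) ρ y = 0
    rw [h1.mfderiv_eq, mfderiv_const]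
    rfl
  set K : Set (E n) := chartAt (E n) x '' tsupport ρ with hK
  have hKc : IsCompact K := (isClosed_tsupport ρ).isCompact.image_of_continuousOn
    ((chartAt (E n) x).continuousOn.mono hx)
  have hKct : K ⊆ ct x := by
    rintro _ ⟨y, hy, rfl⟩
    exact chart_mem_ct (hx hy)
  -- The cutoff in coordinates, extended by zero. It is smooth on all of ℝⁿ because the support of ρ
  -- has compact image inside the chart range.
  set r : E n → ℝ := (ct x : Set (E n)).indicator (ρ ∘ cs x) with hrdef
  have hr1 : ∀ z ∈ ct x, r =ᶠ[𝓝 z] ρ ∘ cs x := fun z hz =>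
    (eventually_ct hz).mono fun z' hz' => Set.indicator_of_mem hz' _
  have hr0 : ∀ z, z ∉ K → r z = 0 := fun z hz => by
    by_cases hzc : z ∈ ct x
    · rw [hrdef, Set.indicator_of_mem hzc]
      show ρ (cs x z) = 0
      exact image_eq_zero_of_notMem_tsupport fun h => hz ⟨_, h, chart_cs hzc⟩
    · exact Set.indicator_of_notMem hzc _
  have hrs : ContDiff ℝ 1 r := contDiff_iff_contDiffAt.2 fun z => by
    by_cases hz : z ∈ ct x
    · exact ((ContDiffOn.at_ct (hρ x) hz).of_le (by simp)).congr_of_eventuallyEq (hr1 z hz)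
    · have : r =ᶠ[𝓝 z] fun _ => 0 := by
        filter_upwards [hKc.isClosed.isOpen_compl.mem_nhds fun h => hz (hKct h)] with w hw
        exact hr0 w hw
      exact contDiffAt_const.congr_of_eventuallyEq this
  have hts : tsupport r ⊆ K := closure_minimal (fun z hz => by
    by_contra h
    exact hz (hr0 z h)) hKc.isClosed
  have hrc : HasCompactSupport r := hKc.of_isClosed_subset (isClosed_tsupport _) hts
  set G : E n → E n := fun z => dens Ω x z • repV x Y z with hG
  have hGs : ContDiffOn ℝ ∞ G (ct x) := (contDiffOn_dens Ω x).smul (hY x)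
  have key := integral_mul_div (isOpen_ct x) hrs hrc (hts.trans hKct) (hGs.of_le (by simp))
  have hoff : ∀ z, z ∉ ct x → r z = 0 := fun z hz => Set.indicator_of_notMem hz _
  have hoff' : ∀ z, z ∉ (ct x : Set (E n)) → fderiv ℝ r z (G z) = 0 := fun z hz => by
    have : z ∉ tsupport (fderiv ℝ r) := fun h => hz (hKct (hts (tsupport_fderiv_subset ℝ h)))
    rw [image_eq_zero_of_notMem_tsupport this]; rfl
  rw [integral_measure Ω x (h := fun y => ρ y * divV Ω g Y y) (hρ.continuous.mul (hg.sF_divV Ω hY).continuous) (fun y hy => by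
      rw [hz0 y hy, zero_mul]),
    integral_measure Ω x (hρ.diff_apply hY).continuous (fun y hy => by rw [hd0 y hy]; rfl)]
  rw [← setIntegral_eq_integral_of_forall_compl_eq_zero (s := ct x)
      (fun z hz => by rw [hoff z hz, zero_mul]),
    ← setIntegral_eq_integral_of_forall_compl_eq_zero (s := ct x) hoff'] at key
  have e1 : ∫ z in ct x, dens Ω x z * (ρ (cs x z) * divV Ω g Y (cs x z)) =
      ∫ z in ct x, r z * tr (fderiv ℝ G z) := by
    refine setIntegral_congr_fun (measurableSet_ct (X := X) x) fun z hz => ?_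
    have h1 := divV_rep Ω hg hY hz
    have h2 : fderiv ℝ G z = dens Ω x z • fderiv ℝ (repV x Y) z +
        (fderiv ℝ (dens Ω x) z).smulRight (repV x Y z) :=
      fderiv_fun_smul (ContDiffOn.diff_ct (contDiffOn_dens Ω x) hz) (ContDiffOn.diff_ct (hY x) hz)
    have h3 : tr ((fderiv ℝ (dens Ω x) z).smulRight (repV x Y z)) =
        fderiv ℝ (dens Ω x) z (repV x Y z) := by
      rw [tr_eq_sum]
      conv_rhs => rw [← sum_coord (repV x Y z)]
      simp [mul_comm]
    have h4 : r z = ρ (cs x z) := (hr1 z hz).self_of_nhds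
    simp only [h2, tr_add, tr_smul, h3, h4]
    rw [mul_left_comm, mul_comm (dens Ω x z), h1, mul_comm (tr _)]
  have e2 : ∫ z in ct x, dens Ω x z * diff ρ (cs x z) (Y (cs x z)) =
      ∫ z in ct x, fderiv ℝ r z (G z) := by
    refine setIntegral_congr_fun (measurableSet_ct (X := X) x) fun z hz => ?_
    simp only [hG, map_smul, smul_eq_mul]
    rw [(hr1 z hz).fderiv_eq, ← repθ_diff hρ hz]
    congr 1
    exact congrArg _ (fromChart_toChart (cs_mem hz) _).symm
  rw [e1, e2, key]

theorem SF.integrable (Ω : VolumeForm n X) {h : X → ℝ} (hh : SF n h) :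
    Integrable h Ω.measure := by
  have := isFiniteMeasure_measure Ω
  exact hh.continuous.integrable_of_hasCompactSupport (HasCompactSupport.of_compactSpace h)

/-- With a partition of unity the integral becomes minus the integral of ∑ dρᵢ(Y), and ∑ dρᵢ = 0
since ∑ ρᵢ = 1. -/
theorem integral_divV [T2Space X] (Ω : VolumeForm n X) {g : BilField n X} (hg : MF g)
    {Y : X → E n} (hY : SV Y) : ∫ y, divV Ω g Y y ∂Ω.measure = 0 := by
  obtain ⟨t, ht⟩ := isCompact_univ.elim_finite_subcover
    (fun x : X => (chartAt (E n) x).source) (fun x => (chartAt (E n) x).open_source)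
    (fun y _ => Set.mem_iUnion.2 ⟨y, mem_chart_source _ y⟩)
  obtain ⟨ρ, hρ⟩ := SmoothPartitionOfUnity.exists_isSubordinate (𝓡 n) isClosed_univ
    (fun i : t => (chartAt (E n) (i : X)).source) (fun i => (chartAt (E n) (i : X)).open_source)
    (fun y hy => by
      obtain ⟨i, hi⟩ := Set.mem_iUnion.1 (ht hy)
      obtain ⟨hit, hi⟩ := Set.mem_iUnion.1 hi
      exact Set.mem_iUnion.2 ⟨⟨i, hit⟩, hi⟩)
  have hs : ∀ i, SF n (ρ i) := fun i => ContMDiff.sF (ρ i).contMDiff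
  have h1 : ∀ y, ∑ i, ρ i y = 1 := fun y => by
    rw [← finsum_eq_sum_of_fintype]; exact ρ.sum_eq_one (Set.mem_univ y)
  have h2 : ∀ y, ∑ i, diff (ρ i) y = 0 := fun y => by
    rw [Finset.sum_congr rfl fun i _ => (hs i).diff_eq y,
      ← fderiv_fun_sum fun i _ => ContDiffOn.diff_ct (hs i y) (self_mem_ct (n := n) y)]
    have : (fun z : E n => ∑ i, (ρ i ∘ cs y) z) = fun _ => 1 := by funext z; exact h1 _
    rw [this, fderiv_fun_const]
    rfl
  have e1 : (fun y => divV Ω g Y y) = fun y => ∑ i, ρ i y * divV Ω g Y y := by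
    funext y; rw [← Finset.sum_mul, h1, one_mul]
  rw [e1, integral_finsetSum _ fun i _ => ((hs i).mul (hg.sF_divV Ω hY)).integrable Ω]
  rw [Finset.sum_congr rfl fun i _ => integral_mul_divV Ω hg hY (hs i) (hρ i), Finset.sum_neg_distrib, ← integral_finsetSum _ fun i _ => ((hs i).diff_apply hY).integrable Ω]
  have e2 : (fun y => ∑ i, diff (ρ i) y (Y y)) = fun _ => 0 := by
    funext y
    rw [← sum_apply, h2]
    rfl
  rw [e2]
  simp

end

section

variable {n : ℕ} {X : Type*} [TopologicalSpace X] [ChartedSpace (E n) X] [IsManifold (𝓡 n) ∞ X]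

/-! ### Rules of covariant differentiation -/

theorem lnab_congr {Γ : E n → E n →L[ℝ] E n →L[ℝ] E n} {A B : E n → E n →L[ℝ] E n} {z : E n}
    (h : A =ᶠ[𝓝 z] B) : lnab Γ A z = lnab Γ B z := by
  ext1 u
  rw [lnab_apply, lnab_apply, h.fderiv_eq, h.self_of_nhds]

section

variable {g : BilField n X} (x : X)

theorem covE_add (A B : EndField n X) (hA : SE A) (hB : SE B) (u : E n) :
    covE g (A + B) x u = covE g A x u + covE g B x u := by
  have h : repE x (A + B) = fun z => repE x A z + repE x B z := by
    funext z; ext1 v; simp [repE_apply]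
  rw [covE, covE, covE, h, lnab_apply, lnab_apply, lnab_apply,
    fderiv_fun_add (ContDiffOn.diff_ct (hA x) (self_mem_ct x))
      (ContDiffOn.diff_ct (hB x) (self_mem_ct x))]
  ext1 v
  simp only [add_apply, sub_apply, ContinuousLinearMap.comp_apply, map_add]
  abel

theorem covE_smul (c : ℝ) (A : EndField n X) (hA : SE A) (u : E n) :
    covE g (c • A) x u = c • covE g A x u := by
  have h : repE x (c • A) = fun z => c • repE x A z := by
    funext z; ext1 v; simp [repE_apply]
  rw [covE, covE, h, lnab_apply, lnab_apply,
    fderiv_fun_const_smul (ContDiffOn.diff_ct (hA x) (self_mem_ct x))]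
  ext1 v
  simp only [add_apply, sub_apply, smul_apply, ContinuousLinearMap.comp_apply, map_smul]
  module

theorem covE_comp (A B : EndField n X) (hA : SE A) (hB : SE B) (u : E n) :
    covE g (fun y => A y ∘L B y) x u = covE g A x u ∘L B x + A x ∘L covE g B x u := by
  have h : repE x (fun y => A y ∘L B y) =ᶠ[𝓝 (chartAt (E n) x x)]
      fun z => repE x A z ∘L repE x B z :=
    (eventually_ct (self_mem_ct x)).mono fun z hz => repE_comp hz A B
  have hdA := ContDiffOn.diff_ct (hA x) (self_mem_ct x)
  have hdB := ContDiffOn.diff_ct (hB x) (self_mem_ct x)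
  rw [covE, lnab_congr h, covE, covE, lnab_apply, lnab_apply, lnab_apply, fderiv_clm_comp hdA hdB,
    repE_self, repE_self]
  ext1 v
  simp only [add_apply, sub_apply, ContinuousLinearMap.comp_apply, map_add, map_sub,
    ContinuousLinearMap.compL_apply, ContinuousLinearMap.flip_apply]
  abel

theorem covE_exp (A : EndField n X) (hA : SE A) (hc : ∀ u, Commute (A x) (covE g A x u)) (c : ℝ)
    (u : E n) :
    covE g (expEnd (c • A)) x u = c • (expEnd (c • A) x ∘L covE g A x u) := by
  have h : repE x (expEnd (c • A)) =ᶠ[𝓝 (chartAt (E n) x x)]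
      fun z => NormedSpace.exp (c • repE x A z) :=
    (eventually_ct (self_mem_ct x)).mono fun z hz => by
      rw [repE_exp hz]
      congr 1
      ext1 v; simp [repE_apply]
  rw [covE, lnab_congr h, fderiv_exp_field (ContDiffOn.diff_ct (hA x) (self_mem_ct x)), repE_self]
  · rfl
  · rw [repE_self]; exact hc

theorem covV_apply (A : EndField n X) (Y : X → E n) (hA : SE A) (hY : SV Y) (u : E n) :
    covV g (fun y => A y (Y y)) x u = covE g A x u (Y x) + A x (covV g Y x u) := by
  have h : repV x (fun y => A y (Y y)) =ᶠ[𝓝 (chartAt (E n) x x)]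
      fun z => repE x A z (repV x Y z) :=
    (eventually_ct (self_mem_ct x)).mono fun z hz => by
      simp [repE_apply, repV, fromChart_toChart (cs_mem hz)]
  rw [covV, covV, covE, lnabV_apply, lnabV_apply, lnab_apply, h.fderiv_eq,
    fderiv_clm_apply (ContDiffOn.diff_ct (hA x) (self_mem_ct x))
      (ContDiffOn.diff_ct (hY x) (self_mem_ct x)), repE_self, repV_self, repV_self]
  simp only [add_apply, sub_apply, ContinuousLinearMap.comp_apply, map_add,
    ContinuousLinearMap.flip_apply]
  abel

theorem diff_tr (A : EndField n X) (hA : SE A) (u : E n) :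
    diff (fun y => tr (A y)) x u = tr (covE g A x u) := by
  have h : (fun y => tr (A y)) ∘ cs x =ᶠ[𝓝 (chartAt (E n) x x)] fun z => trL n (repE x A z) :=
    (eventually_ct (self_mem_ct x)).mono fun z hz => (tr_repE hz A).symm
  have hd := ContDiffOn.diff_ct (hA x) (self_mem_ct x)
  rw [hA.tr.diff_eq x, h.fderiv_eq, covE, lnab_apply, tr_add, tr_sub, tr_comm, sub_self, add_zero]
  exact congrArg (fun L : E n →L[ℝ] ℝ => L u) ((trL n).hasFDerivAt.comp _ hd.hasFDerivAt).fderiv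

theorem covE_symm (hg : MF g) (A : EndField n X) (hA : SE A)
    (hs : ∀ x u v, g x (A x u) v = g x u (A x v)) (u v w : E n) :
    g x (covE g A x u v) w = g x v (covE g A x u w) := by
  have h := lnab_symm (hg.diff_rep (self_mem_ct x)) (hg.eventually_met (self_mem_ct x))
    (ContDiffOn.diff_ct (hA x) (self_mem_ct x))
    ((eventually_ct (self_mem_ct x)).mono fun z hz u v => by
      simp [repB_apply, repE_apply, fromChart_toChart (cs_mem hz), hs]) u v w
  rwa [repB_self] at h

theorem fderiv_pairing (hg : MF g) {Y : X → E n} (hY : SV Y) (u v : E n) :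
    fderiv ℝ (fun z => repB x g z (repV x Y z) v) (chartAt (E n) x x) u =
      g x (covV g Y x u) v + g x (Y x) (chr g x (chartAt (E n) x x) u v) := by
  have h1 := hg.diff_rep (self_mem_ct x)
  have h2 := ContDiffOn.diff_ct (hY x) (self_mem_ct x)
  have h3 : fderiv ℝ (fun z => repB x g z (repV x Y z) v) (chartAt (E n) x x) u = _ :=
    fderiv_comp₂ (φ := id) (z := chartAt (E n) x x) (β := fun _ => v) h1 differentiableAt_id h2
      (differentiableAt_const v) u
  rw [h3, fderiv_id, ContinuousLinearMap.id_apply, id,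
    lchr_compat h1 (hg.eventually_met (self_mem_ct x)), repB_self, repV_self, covV, lnabV_apply,
    repV_self]
  simp only [map_add, add_apply, fderiv_fun_const, Pi.zero_apply, zero_apply, map_zero, add_zero,
    chr]
  ring

/-- Differentiate g(∇f, v) = df(v): the Christoffel term given by `fderiv_pairing` is the one that
the Hessian subtracts. -/
theorem hessian_eq_covV (hg : MF g) {f : X → ℝ} (hf : SF n f) (u v : E n) :
    hessian g f x u v = g x (covV g (grad g f) x u) v := by
  have hY : SV (grad g f) := hf.raise_diff hg
  have h1 : (fun z => repB x g z (repV x (grad g f) z) v) =ᶠ[𝓝 (chartAt (E n) x x)]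
      fun z => fderiv ℝ (f ∘ cs x) z v :=
    (eventually_ct (self_mem_ct x)).mono fun z hz => by
      have : repV x (grad g f) z = (repB x g z).inverse (fderiv ℝ (f ∘ cs x) z) := by
        rw [← repθ_diff hf hz]
        exact (repB_inverse hg hz _).symm
      simp only [this, (hg.met_rep hz).inverse_apply]
  have h2 := fderiv_pairing x hg hY u v
  rw [h1.fderiv_eq, fderiv_apply_const
    (ContDiffOn.diff_ct (ContDiffOn.fderiv_ct (hf x)) (self_mem_ct x))] at h2
  rw [hessian_eq hg hf, h2, ← hf.diff_eq x]
  have h3 : ∀ w, g x (grad g f x) w = diff f x w := fun w => (hg.met x).inverse_apply _ w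
  rw [h3]
  ring

/-- The covariant derivative of an `End (T_X)`-valued 1-form. -/
def cov1 (g : BilField n X) (β : X → E n →L[ℝ] E n →L[ℝ] E n) (x : X) (u v : E n) :
    E n →L[ℝ] E n :=
  fderiv ℝ (rep1 x β) (chartAt (E n) x x) u v +
    (chr g x (chartAt (E n) x x) u ∘L β x v - β x v ∘L chr g x (chartAt (E n) x x) u) -
    β x (chr g x (chartAt (E n) x x) u v)

theorem rep1_self (β : X → E n →L[ℝ] E n →L[ℝ] E n) : rep1 x β (chartAt (E n) x x) = β x := by
  ext1 u; ext1 v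
  rw [rep1_apply, cs_self, fromChart_self, toChart_self]
  rfl

theorem nabla_eq_cov1 (hg : MF g) {β : X → E n →L[ℝ] E n →L[ℝ] E n} (hβ : S1 β) (u v : E n) :
    nabla g (fun y w => β y (w 0) : EndTensor n X 1) x ![u, v] = cov1 g β x u v := by
  have h1 : diff (fun y : X => toChart x y ∘L β y (fromChart x y v) ∘L fromChart x y) x =
      fderiv ℝ (fun z => rep1 x β z v) (chartAt (E n) x x) :=
    diff_self (f := fun y : X => toChart x y ∘L β y (fromChart x y v) ∘L fromChart x y)
      (((ContDiffOn.diff_ct (hβ x) (self_mem_ct x))).clm_apply (differentiableAt_const v))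
  have h2 : nabla g (fun y w => β y (w 0) : EndTensor n X 1) x ![u, v] =
      diff (fun y : X => toChart x y ∘L β y (fromChart x y v) ∘L fromChart x y) x u
    + (christoffel g x x u ∘L β x v - β x v ∘L christoffel g x x u)
    - ∑ j : Fin 1, β x (Function.update ![v] j (christoffel g x x u (![v] j)) 0) := rfl
  rw [h2, h1, hg.christoffel_self, cov1,
    fderiv_apply_const (ContDiffOn.diff_ct (hβ x) (self_mem_ct x))]
  simp

/-- Product rule for a vector field metrically dual to a 1-form of the shape u ↦ Tr(N β_u). The
intended case is N = V² e^A and β = e^A ∇A. -/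
theorem covV_of_trace (hg : MF g) {Y : X → E n} (hY : SV Y) {N : EndField n X} (hN : SE N)
    {β : X → E n →L[ℝ] E n →L[ℝ] E n} (hβ : S1 β)
    (h : ∀ y u, g y (Y y) u = tr (N y ∘L β y u)) (u v : E n) :
    g x (covV g Y x u) v = tr (covE g N x u ∘L β x v) + tr (N x ∘L cov1 g β x u v) := by
  have hdN := ContDiffOn.diff_ct (hN x) (self_mem_ct x)
  have hdβ := ContDiffOn.diff_ct (hβ x) (self_mem_ct x)
  have h1 : (fun z => repB x g z (repV x Y z) v) =ᶠ[𝓝 (chartAt (E n) x x)]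
      fun z => trL n (repE x N z ∘L rep1 x β z v) :=
    (eventually_ct (self_mem_ct x)).mono fun z hz => by
      have h2 : repE x N z ∘L rep1 x β z v = toChart x (cs x z) ∘L
          (N (cs x z) ∘L β (cs x z) (fromChart x (cs x z) v)) ∘L fromChart x (cs x z) := by
        ext1 w
        simp [repE_apply, rep1_apply, fromChart_toChart (cs_mem hz)]
      simp only [h2, trL_apply]
      rw [tr_conj (by ext1 u; exact fromChart_toChart (cs_mem hz) u), ← h, repB_apply, repV,
        fromChart_toChart (cs_mem hz)]
  have h2 := fderiv_pairing x hg hY u v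
  rw [h1.fderiv_eq, h] at h2
  have h3 := ((trL n).hasFDerivAt.comp _
    (hdN.hasFDerivAt.clm_comp (hdβ.clm_apply (differentiableAt_const v)).hasFDerivAt)).fderiv
  have h4 := congrArg (fun L : E n →L[ℝ] ℝ => L u) h3
  simp only [ContinuousLinearMap.comp_apply, add_apply, ContinuousLinearMap.compL_apply,
    ContinuousLinearMap.flip_apply, fderiv_apply_const hdβ, map_add, repE_self, rep1_self,
    trL_apply] at h4
  have h5 : fderiv ℝ (fun z => trL n (repE x N z ∘L rep1 x β z v)) (chartAt (E n) x x) u =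
    tr (N x ∘L fderiv ℝ (rep1 x β) (chartAt (E n) x x) u v) +
      tr (fderiv ℝ (repE x N) (chartAt (E n) x x) u ∘L β x v) := h4
  rw [h5] at h2
  rw [covE, lnab_apply, cov1, repE_self]
  set Γ := chr g x (chartAt (E n) x x) u
  have e1 : tr ((fderiv ℝ (repE x N) (chartAt (E n) x x) u + (Γ ∘L N x - N x ∘L Γ)) ∘L β x v) =
      tr (fderiv ℝ (repE x N) (chartAt (E n) x x) u ∘L β x v) +
        (tr (Γ ∘L (N x ∘L β x v)) - tr (N x ∘L Γ ∘L β x v)) := by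
    rw [← tr_sub, ← tr_add]
    congr 1
  have e2 : tr (N x ∘L (fderiv ℝ (rep1 x β) (chartAt (E n) x x) u v +
      (Γ ∘L β x v - β x v ∘L Γ) - β x (Γ v))) =
      tr (N x ∘L fderiv ℝ (rep1 x β) (chartAt (E n) x x) u v) +
        (tr (N x ∘L Γ ∘L β x v) - tr ((N x ∘L β x v) ∘L Γ)) - tr (N x ∘L β x (Γ v)) := by
    rw [← tr_sub, ← tr_add, ← tr_sub]
    congr 1
    ext1 w
    simp
  rw [e1, e2, tr_comm Γ]
  linarith

end

end

section

variable {n : ℕ} {X : Type*} [TopologicalSpace X] [ChartedSpace (E n) X] [IsManifold (𝓡 n) ∞ X]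

theorem SF.sub {f h : X → ℝ} (hf : SF n f) (hh : SF n h) : SF n fun y => f y - h y :=
  fun x => (hf x).sub (hh x)

theorem SF.add {f h : X → ℝ} (hf : SF n f) (hh : SF n h) : SF n fun y => f y + h y :=
  fun x => (hf x).add (hh x)

theorem SF.const (c : ℝ) : SF n fun _ : X => c := fun _ => contDiffOn_const

theorem SF.const_mul {f : X → ℝ} (c : ℝ) (hf : SF n f) : SF n fun y => c * f y :=
  fun x => contDiffOn_const.mul (hf x)

/-! ### Commuting symmetric Codazzi fields -/

/-- Smooth symmetric Codazzi sections of `End (T_X)`. -/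
structure IsCod (g : BilField n X) (A : EndField n X) : Prop where
  smooth : SE A
  symm : ∀ x u v, g x (A x u) v = g x u (A x v)
  closed : ∀ x u v, covE g A x u v = covE g A x v u

/-- Sections which commute together with their covariant derivatives. -/
structure CC (g : BilField n X) (A V : EndField n X) : Prop where
  zero : ∀ x, Commute (A x) (V x)
  right : ∀ x u, Commute (A x) (covE g V x u)
  left : ∀ x u, Commute (covE g A x u) (V x)
  both : ∀ x u v, Commute (covE g A x u) (covE g V x v)

theorem CC.swap {g : BilField n X} {A V : EndField n X} (h : CC g A V) : CC g V A :=
  ⟨fun x => (h.zero x).symm, fun x u => (h.left x u).symm, fun x u => (h.right x u).symm,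
    fun x u v => (h.both x v u).symm⟩

section

/-! ### Commutation relations inside `TK` -/

variable {g : Metric n X} {K A V : EndField n X}

theorem MemTK.isCod (h : MemTK g K A) : IsCod g.field A where
  smooth := (smoothEnd_iff A).1 h.smooth
  symm x u v := by rw [h.symm, g.mF.met x |>.symm]
  closed x u v := by
    have := h.closed x u v
    rw [nablaEnd_eq g.mF ((smoothEnd_iff A).1 h.smooth),
      nablaEnd_eq g.mF ((smoothEnd_iff A).1 h.smooth)] at this
    exact sub_eq_zero.1 this

theorem MemTK.comm_K (h : MemTK g K A) (x : X) : Commute (K x) (A x) :=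
  sub_eq_zero.1 (h.comm_center 0 x ![])

theorem MemTK.comm_nablaK (h : MemTK g K A) (hK : SE K) (x : X) (u : E n) :
    Commute (covE g.field K x u) (A x) := by
  have h1 := h.comm_center 1 x ![u]
  have h2 : nablaIter g.field (EndField.tensor K) 1 x ![u] = covE g.field K x u :=
    nablaEnd_eq g.mF hK x ![u]
  rw [h2] at h1
  exact sub_eq_zero.1 h1

theorem MemTK.comm_riemann (h : MemTK g K A) (x : X) (u v : E n) :
    Commute (riemann g.field x u v) (A x) := sub_eq_zero.1 (h.comm_curvature 0 x ![u, v])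

/-- Differentiate KA = AK; the terms with ∇K cancel because ∇K commutes with A. -/
theorem MemTK.comm_K_nabla (h : MemTK g K A) (hK : SE K) (x : X) (u : E n) :
    Commute (K x) (covE g.field A x u) := by
  have hA := h.isCod.smooth
  have h1 : (fun y => K y ∘L A y) = fun y => A y ∘L K y := funext fun y => h.comm_K y
  have h2 := covE_comp (g := g.field) x K A hK hA u
  rw [h1, covE_comp x A K hA hK u] at h2
  have h3 : covE g.field K x u ∘L A x = A x ∘L covE g.field K x u := h.comm_nablaK hK x u
  rw [h3, add_comm] at h2
  exact (add_left_cancel h2).symm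

end

/-- The points of the chart where FG ≠ GF form an open set contained in the null set of exceptional
points of K, and a nonempty open set is not null. -/
theorem commute_of_chart {Ω : VolumeForm n X} [MeasurableSpace X] [BorelSpace X] [CompactSpace X]
    {K : EndField n X} (hKev : ∀ᵐ x ∂Ω.measure, HasDistinctEigenvalues (K x)) (x : X)
    {F G : E n → E n →L[ℝ] E n} (hF : ContinuousOn F (ct x : Set (E n)))
    (hG : ContinuousOn G (ct x : Set (E n)))
    (h : ∀ z ∈ ct x, HasDistinctEigenvalues (K (cs x z)) → Commute (F z) (G z)) {z : E n}
    (hz : z ∈ ct x) : Commute (F z) (G z) := by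
  by_contra hne
  set O : Set X := (chartAt (E n) x).source ∩
    chartAt (E n) x ⁻¹' {z : E n | z ∈ ct x ∧ F z * G z - G z * F z ≠ 0} with hO
  have hOo : IsOpen O := by
    refine (chartAt (E n) x).continuousOn.isOpen_inter_preimage (chartAt (E n) x).open_source ?_
    have := ((hF.mul hG).sub (hG.mul hF)).isOpen_inter_preimage (isOpen_ct x)
      (isOpen_compl_singleton (x := (0 : E n →L[ℝ] E n)))
    exact this
  have hmem : cs x z ∈ O := ⟨cs_mem hz, by
    rw [Set.mem_preimage, chart_cs hz]
    exact ⟨hz, fun h => hne (sub_eq_zero.1 h)⟩⟩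
  refine measure_pos Ω hOo hmem (measure_mono_null ?_ (ae_iff.1 hKev))
  rintro y ⟨hy, hy1, hy2⟩ hy3
  refine hy2 (sub_eq_zero.2 ?_)
  exact h _ hy1 (by rwa [cs_chart hy])

theorem commute_conj {x y : X} (hy : y ∈ (chartAt (E n) x).source) {B C : E n →L[ℝ] E n}
    (h : Commute B C) : Commute (toChart x y ∘L B ∘L fromChart x y)
      (toChart x y ∘L C ∘L fromChart x y) := by
  show _ = _
  ext1 v
  have := congrArg (fun L : E n →L[ℝ] E n => L (fromChart x y v)) h.eq
  simpa [fromChart_toChart hy] using congrArg (toChart x y) this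

/-- At a generic point A, V and their covariant derivatives all lie in the abelian commutant of K,
and `commute_of_chart` removes the word generic. Coordinate expressions enter only to state
continuity. -/
theorem MemTK.cC {Ω : VolumeForm n X} [MeasurableSpace X] [BorelSpace X] [CompactSpace X]
    {g : Metric n X} {K A V : EndField n X} (hK : SE K)
    (hKev : ∀ᵐ x ∂Ω.measure, HasDistinctEigenvalues (K x))
    (hA : MemTK g K A) (hV : MemTK g K V) : CC g.field A V := by
  have cA := hA.isCod.smooth
  have cV := hV.isCod.smooth
  have sA := cA.covE g.mF
  have sV := cV.covE g.mF
  have key : ∀ x : X, Commute (repE x A (chartAt (E n) x x)) (repE x V (chartAt (E n) x x)) ∧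
      (∀ u, Commute (repE x A (chartAt (E n) x x))
        (rep1 x (covE g.field V) (chartAt (E n) x x) u)) ∧
      (∀ u, Commute (rep1 x (covE g.field A) (chartAt (E n) x x) u)
        (repE x V (chartAt (E n) x x))) ∧
      ∀ u v, Commute (rep1 x (covE g.field A) (chartAt (E n) x x) u)
        (rep1 x (covE g.field V) (chartAt (E n) x x) v) := fun x => by
    have cs1 : ∀ u, ContinuousOn (fun z => rep1 x (covE g.field A) z u) (ct x : Set (E n)) :=
      fun u => (sA x).continuousOn.clm_apply continuousOn_const
    have cs2 : ∀ u, ContinuousOn (fun z => rep1 x (covE g.field V) z u) (ct x : Set (E n)) :=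
      fun u => (sV x).continuousOn.clm_apply continuousOn_const
    refine ⟨?_, fun u => ?_, fun u => ?_, fun u v => ?_⟩
    · exact commute_of_chart hKev x (cA x).continuousOn (cV x).continuousOn
        (fun z hz hd => commute_conj (cs_mem hz)
          (commute_of_distinctEigenvalues hd (hA.comm_K _) (hV.comm_K _))) (self_mem_ct x)
    · exact commute_of_chart hKev x (cA x).continuousOn (cs2 u)
        (fun z hz hd => commute_conj (cs_mem hz)
          (commute_of_distinctEigenvalues hd (hA.comm_K _) (hV.comm_K_nabla hK _ _)))
        (self_mem_ct x)
    · exact commute_of_chart hKev x (cs1 u) (cV x).continuousOn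
        (fun z hz hd => commute_conj (cs_mem hz)
          (commute_of_distinctEigenvalues hd (hA.comm_K_nabla hK _ _) (hV.comm_K _)))
        (self_mem_ct x)
    · exact commute_of_chart hKev x (cs1 u) (cs2 v)
        (fun z hz hd => commute_conj (cs_mem hz)
          (commute_of_distinctEigenvalues hd (hA.comm_K_nabla hK _ _) (hV.comm_K_nabla hK _ _)))
        (self_mem_ct x)
  simp only [repE_self, rep1_self] at key
  exact ⟨fun x => (key x).1, fun x => (key x).2.1, fun x => (key x).2.2.1,
    fun x => (key x).2.2.2⟩

/-! ### Contractions of Codazzi fields -/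

/-- The gradient of the trace. -/
def gtr (g : BilField n X) (A : EndField n X) : X → E n := grad g fun y => tr (A y)

section

variable {g : BilField n X} {A V : EndField n X}

/-- The vector `g⁻¹ e_i^*`. -/
def ei (g : BilField n X) (x : X) (i : Fin n) : E n := raise g x (dualBasis i)

/-- Write the trace as ∑ g(M ∇_wA eᵢ, eⁱ) with eⁱ = g⁻¹ eᵢ^*. Codazzi exchanges w with eᵢ, and the
symmetry of M and ∇A then moves everything off w. -/
theorem trace_comp_nabla (hg : MF g) (hA : IsCod g A) (x : X) {M : E n →L[ℝ] E n}
    (hM : ∀ u v, g x (M u) v = g x u (M v)) (hc : ∀ u, Commute M (covE g A x u)) (w : E n) :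
    tr (M ∘L covE g A x w) = g x w (M (∑ i, covE g A x (e i) (ei g x i))) := by
  rw [(hg.met x).tr_eq, map_sum, map_sum]
  refine Finset.sum_congr rfl fun i _ => ?_
  have h1 : M (covE g A x (e i) (ei g x i)) = covE g A x (e i) (M (ei g x i)) :=
    congrArg (fun L : E n →L[ℝ] E n => L (ei g x i)) (hc (e i)).eq
  rw [h1, ← covE_symm x hg A hA.smooth hA.symm, hA.closed x _ w, ContinuousLinearMap.comp_apply, hM]
  have h2 : M (ei g x i) = M ((g x).inverse (dualBasis i)) := rfl
  rw [covE_symm x hg A hA.smooth hA.symm, h2, covE_symm x hg A hA.smooth hA.symm]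

theorem gtr_eq_sum (hg : MF g) (hA : IsCod g A) (x : X) :
    gtr g A x = ∑ i, covE g A x (e i) (ei g x i) := by
  refine (hg.met x).ext fun w => ?_
  have h1 := trace_comp_nabla hg hA x (M := 1) (fun _ _ => rfl) (fun _ => Commute.one_left _) w
  have h2 : g x (gtr g A x) w = diff (fun y => tr (A y)) x w := (hg.met x).inverse_apply _ w
  rw [h2, diff_tr x A hA.smooth, (hg.met x).symm]
  exact h1

theorem trace_comp_nabla_eq (hg : MF g) (hA : IsCod g A) (x : X) {M : E n →L[ℝ] E n}
    (hM : ∀ u v, g x (M u) v = g x u (M v)) (hc : ∀ u, Commute M (covE g A x u)) (w : E n) :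
    tr (M ∘L covE g A x w) = g x (M (gtr g A x)) w := by
  rw [trace_comp_nabla hg hA x hM hc, gtr_eq_sum hg hA, (hg.met x).symm]

/-- The section `∇_{g, ξ} V` of `End (T_X)` for `ξ` the gradient of the trace of `A`. -/
def dd (g : BilField n X) (A V : EndField n X) : EndField n X := fun x => covE g V x (gtr g A x)

theorem IsCod.sV_gtr (hg : MF g) (hA : IsCod g A) : SV (gtr g A) := hA.smooth.tr.raise_diff hg

theorem IsCod.sE_dd (hg : MF g) (hA : IsCod g A) (hV : IsCod g V) : SE (dd g A V) :=
  (hV.smooth.covE hg).apply (hA.sV_gtr hg)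

/-- Applied to w, Codazzi turns ∇_{eⁱ}V w into ∇_wV eⁱ, which commutation carries past ∇A. The sum
that remains is ∇_wV applied to the contraction of ∇A, that is to the gradient of Tr A. -/
theorem sum_comp_nabla (hg : MF g) (hA : IsCod g A) (hV : IsCod g V) (h : CC g A V) (x : X) :
    ∑ i, covE g A x (e i) ∘L covE g V x (ei g x i) = dd g A V x := by
  ext1 w
  rw [dd, gtr_eq_sum hg hA, hV.closed, map_sum, sum_apply]
  refine Finset.sum_congr rfl fun i _ => ?_
  rw [ContinuousLinearMap.comp_apply, hV.closed]
  exact congrArg (fun L : E n →L[ℝ] E n => L (ei g x i)) (h.both x (e i) w).eq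

/-- Both sides are contractions of products of ∇A and ∇V: the factors commute and the contraction is
symmetric. This makes `dd` a symmetric bilinear expression, so it behaves like a quadratic form
along lines. -/
theorem dd_swap (hg : MF g) (hA : IsCod g A) (hV : IsCod g V) (h : CC g A V) (x : X) :
    dd g A V x = dd g V A x := by
  ext1 w
  refine (hg.met x).ext fun y => ?_
  have h1 := (hg.met x).sum_contr_symm
    (((ContinuousLinearMap.compL ℝ (E n) (E n) ℝ).flip ((covE g A x).flip w)) ∘L
      ContinuousLinearMap.compL ℝ (E n) (E n) ℝ ((g x).flip y) ∘L covE g V x)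
  rw [← sum_comp_nabla hg hV hA h.swap, ← sum_comp_nabla hg hA hV h]
  simp only [sum_apply, map_sum, ContinuousLinearMap.comp_apply]
  refine Eq.trans (Finset.sum_congr rfl fun i _ => ?_) h1.symm
  exact congrArg (fun L : E n →L[ℝ] E n => g x (L w) y) (h.both x (e i) (ei g x i)).eq

theorem gtr_add_smul (hA : SE A) (hV : SE V) (t : ℝ) (x : X) :
    gtr g (A + t • V) x = gtr g A x + t • gtr g V x := by
  have h1 : diff (n := n) (fun y => tr ((A + t • V) y)) x =
      diff (n := n) (fun y => tr (A y)) x + t • diff (n := n) (fun y => tr (V y)) x := by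
    ext1 u
    rw [diff_tr (g := g) x _ (hA.add (hV.smul t)), covE_add x A _ hA (hV.smul t), covE_smul x t V hV]
    simp only [add_apply, smul_apply, diff_tr (g := g) x _ hA, diff_tr (g := g) x _ hV, tr_add, tr_smul, smul_eq_mul]
  rw [gtr, grad, h1, raise, map_add, map_smul]
  rfl

theorem dd_add_smul (hg : MF g) (hA : IsCod g A) (hV : IsCod g V) (h : CC g A V) (t : ℝ) (x : X) :
    dd g (A + t • V) (A + t • V) x =
      dd g A A x + (2 * t) • dd g A V x + t ^ 2 • dd g V V x := by
  have h1 := dd_swap hg hA hV h x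
  rw [dd, covE_add x A _ hA.smooth (hV.smooth.smul t), covE_smul x t V hV.smooth,
    gtr_add_smul hA.smooth hV.smooth, map_add, map_add, map_smul, map_smul]
  have h2 : covE g A x (gtr g V x) = dd g A V x := h1.symm
  rw [h2]
  simp only [dd]
  module

/-! ### Change of the metric -/

theorem repB_metricOf {x : X} {z : E n} (hz : z ∈ ct x) (A : EndField n X) :
    repB x (metricOf g A) z = repB x g z ∘L NormedSpace.exp ((-2 : ℝ) • repE x A z) := by
  have h1 : (-2 : ℝ) • repE x A z = repE x ((-2 : ℝ) • A) z := by ext1 v; simp [repE_apply]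
  rw [h1, ← repE_exp hz]
  ext u v
  simp [repB_apply, repE_apply, fromChart_toChart (cs_mem hz), metricOf]

theorem repE_symm (hs : ∀ x u v, g x (A x u) v = g x u (A x v)) {x : X} {z : E n} (hz : z ∈ ct x)
    (u v : E n) : repB x g z (repE x A z u) v = repB x g z u (repE x A z v) := by
  simp [repB_apply, repE_apply, fromChart_toChart (cs_mem hz), hs]

theorem IsCod.mF_metricOf (hg : MF g) (hA : IsCod g A) : MF (metricOf g A) where
  sB x := ((hg.sB x).clm_comp (contDiff_exp_end.comp_contDiffOn
    ((hA.smooth x).const_smul (-2 : ℝ)))).congr fun _ hz => repB_metricOf hz A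
  met x := (hg.met x).comp_exp (hA.symm x)

theorem lchr_congr {G H : E n → Bil n} {z : E n} (h : G =ᶠ[𝓝 z] H) : lchr G z = lchr H z := by
  rw [lchr, lchr, h.fderiv_eq, h.self_of_nhds]

theorem commute_rep (hg : MF g) (hA : IsCod g A) (h : CC g A A) {x : X} {z : E n}
    (hz : z ∈ ct x) (u : E n) : Commute (repE x A z) (lnab (chr g x) (repE x A) z u) := by
  rw [← covE_rep hg hA.smooth hz]
  exact commute_conj (cs_mem hz) (h.right _ _)

/-- The gauge change `lchr_gauge` read in a chart. This formula is the entire dependence of the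
connection on A. -/
theorem chr_metricOf (hg : MF g) (hA : IsCod g A) (h : CC g A A) {x : X} {z : E n}
    (hz : z ∈ ct x) :
    chr (metricOf g A) x z = chr g x z - lnab (chr g x) (repE x A) z := by
  have h1 : repB x (metricOf g A) =ᶠ[𝓝 z]
      fun z => repB x g z ∘L NormedSpace.exp ((-2 : ℝ) • repE x A z) :=
    (eventually_ct hz).mono fun z hz => repB_metricOf hz A
  rw [chr, lchr_congr h1]
  refine lchr_gauge (hg.diff_rep hz) (hg.eventually_met hz) (ContDiffOn.diff_ct (hA.smooth x) hz)
    ((eventually_ct hz).mono fun z hz => repE_symm hA.symm hz) (fun u v => ?_)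
    (commute_rep hg hA h hz)
  show lnab (chr g x) (repE x A) z u v = lnab (chr g x) (repE x A) z v u
  rw [← covE_rep hg hA.smooth hz, rep1_apply, rep1_apply, hA.closed]

theorem ricci_eq (hg : MF g) (x : X) :
    ricci g x = ricOp (lriem (chr g x) (chartAt (E n) x x)) := by
  rw [← hg.ricci_rep (self_mem_ct x), repB_self]

theorem ricci_metricOf (hg : MF g) (hA : IsCod g A) (h : CC g A A)
    (hR : ∀ x u v, Commute (riemann g x u v) (A x)) (x : X) :
    ricci (metricOf g A) x = ricci g x := by
  rw [ricci_eq hg, ricci_eq (hA.mF_metricOf hg)]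
  congr 1
  have h1 : chr (metricOf g A) x =ᶠ[𝓝 (chartAt (E n) x x)]
      fun z => chr g x z - lnab (chr g x) (repE x A) z :=
    (eventually_ct (self_mem_ct x)).mono fun z hz => chr_metricOf hg hA h hz
  rw [← lriem_gauge (hg.diff_chr (self_mem_ct x))
    (mod_cast contDiffAt_infty.1 (ContDiffOn.at_ct (hA.smooth x) (self_mem_ct x)) 2) (h.both x)
    (fun u v => by rw [← hg.riemann_eq, repE_self]; exact hR x u v), lriem, lriem, h1.fderiv_eq,
    h1.self_of_nhds]

theorem hessian_metricOf (hg : MF g) (hA : IsCod g A) (h : CC g A A) {f : X → ℝ} (hf : SF n f)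
    (x : X) (u v : E n) :
    hessian (metricOf g A) f x u v = hessian g f x u v + diff f x (covE g A x u v) := by
  rw [hessian_eq hg hf, hessian_eq (hA.mF_metricOf hg) hf, chr_metricOf hg hA h (self_mem_ct x),
    hf.diff_eq, covE, sub_apply, sub_apply, map_sub]
  ring

/-- det e^{-2A} = e^{-2 Tr A}, and the volume density contains its square root. -/
theorem logVol_metricOf (Ω : VolumeForm n X) (hg : MF g) (hA : IsCod g A) (x : X) :
    logVol Ω (metricOf g A) x = logVol Ω g x - tr (A x) := by
  have h1 := logVol_rep Ω (hA.mF_metricOf hg) (self_mem_ct x)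
  have h2 := logVol_rep Ω hg (self_mem_ct x)
  rw [cs_self] at h1 h2
  have h3 : metricOf g A x = g x ∘L NormedSpace.exp ((-2 : ℝ) • A x) := rfl
  rw [h1, h2, repB_self, repB_self, h3, detB_comp, detE_exp, tr_smul,
    Real.log_mul (Real.exp_pos _).ne' (hg.met x).detB_pos.ne', Real.log_exp]
  ring

theorem diff_sub {f h : X → ℝ} (hf : SF n f) (hh : SF n h) (x : X) :
    diff (n := n) (fun y => f y - h y) x = diff f x - diff h x := by
  have h1 := hf.sub hh
  rw [h1.diff_eq, hf.diff_eq, hh.diff_eq]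
  exact fderiv_fun_sub (ContDiffOn.diff_ct (hf x) (self_mem_ct x))
    (ContDiffOn.diff_ct (hh x) (self_mem_ct x))

theorem hessian_sub (hg : MF g) {f h : X → ℝ} (hf : SF n f) (hh : SF n h) (x : X) (u v : E n) :
    hessian g (fun y => f y - h y) x u v = hessian g f x u v - hessian g h x u v := by
  have h1 := hf.sub hh
  have h2 : (fun y => f y - h y) ∘ cs x = fun z : E n => (f ∘ cs x) z - (h ∘ cs x) z := rfl
  have h3 : fderiv ℝ (fun z : E n => (f ∘ cs x) z - (h ∘ cs x) z) =ᶠ[𝓝 (chartAt (E n) x x)]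
      fun z => fderiv ℝ (f ∘ cs x) z - fderiv ℝ (h ∘ cs x) z :=
    (eventually_ct (self_mem_ct x)).mono fun z hz =>
      fderiv_fun_sub (ContDiffOn.diff_ct (hf x) hz) (ContDiffOn.diff_ct (hh x) hz)
  rw [hessian_eq hg hf, hessian_eq hg hh, hessian_eq hg h1, h2, h3.fderiv_eq, h3.self_of_nhds,
    fderiv_fun_sub (ContDiffOn.diff_ct (ContDiffOn.fderiv_ct (hf x)) (self_mem_ct x))
      (ContDiffOn.diff_ct (ContDiffOn.fderiv_ct (hh x)) (self_mem_ct x))]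
  simp only [sub_apply]
  ring

theorem exp_symm_field (hA : IsCod g A) (c : ℝ) (x : X) (u v : E n) :
    g x (expEnd (c • A) x u) v = g x u (expEnd (c • A) x v) :=
  IsMet.exp_symm (IsMet.smul_symm (hA.symm x) c) u v

theorem CC.exp (h : CC g A V) (c : ℝ) (x : X) (u : E n) :
    Commute (expEnd (c • A) x) (covE g V x u) :=
  ((h.right x u).smul_left c).exp_left

/-- The inverse of the new metric is e^{2A} g⁻¹, so every contribution is a trace against e^{2A}.
The Hessian of Tr A is not integrable by inspection, but it is the leading part of the divergence of
e^{2A} ∇ Tr A. That divergence also contains 2 Tr(e^{2A} D(A, A)), which changes the sign of the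
`dd` term. -/
theorem tr_sharp_metricOf (Ω : VolumeForm n X) (hg : MF g) (hA : IsCod g A) (h : CC g A A)
    (hR : ∀ x u v, Commute (riemann g x u v) (A x)) (x : X) :
    tr (sharp (metricOf g A) (fun y => ricciOmega Ω (metricOf g A) y - metricOf g A y) x) =
      tr (expEnd ((2 : ℝ) • A) x ∘L (ricciOmegaStar Ω g x + dd g A A x)) -
        divV Ω g (fun y => expEnd ((2 : ℝ) • A) y (gtr g A y)) x - n := by
  set S := expEnd ((2 : ℝ) • A) with hS
  have hf := hg.sF_logVol Ω
  have ht := hA.smooth.tr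
  have hm := hg.met x
  have hSs : SE S := (hA.smooth.smul 2).exp
  have e0 : sharp (metricOf g A) (fun y => ricciOmega Ω (metricOf g A) y - metricOf g A y) x =
      (S x ∘L (g x).inverse) ∘L ricciOmega Ω (metricOf g A) x - .id ℝ _ := by
    ext1 u
    have h1 := ((hA.mF_metricOf hg).met x).inverse_self u
    have h2 : (metricOf g A x).inverse = S x ∘L (g x).inverse := hm.inverse_comp_exp (A x)
    simp only [sharp, ContinuousLinearMap.comp_apply, sub_apply, map_sub, h1,
      ContinuousLinearMap.id_apply]
    rw [h2]
    rfl
  have hlog : logVol Ω (metricOf g A) = fun y => logVol Ω g y - tr (A y) :=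
    funext fun y => logVol_metricOf Ω hg hA y
  -- The last term is the change of connection in the Hessian, d(f - Tr A)(∇_uA v), rewritten by
  -- Codazzi and symmetry as a derivative of A in the direction of the gradient.
  have e1 : ricciOmega Ω (metricOf g A) x = ricciOmega Ω g x -
      hessian g (fun y => tr (A y)) x + g x ∘L covE g A x (grad g (logVol Ω g) x - gtr g A x) := by
    ext u v
    simp only [ricciOmega, add_apply, sub_apply, ricci_metricOf hg hA h hR x]
    rw [hlog, hessian_metricOf hg hA h (hf.sub ht), hessian_sub hg hf ht,
      diff_sub hf ht]
    have h2 : g x (covE g A x (grad g (logVol Ω g) x - gtr g A x) u) v =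
        g x (grad g (logVol Ω g) x - gtr g A x) (covE g A x u v) := by
      rw [hA.closed, covE_symm x hg A hA.smooth hA.symm]
    have h3 : ∀ w, g x (grad g (logVol Ω g) x) w = diff (logVol Ω g) x w :=
      fun w => hm.inverse_apply _ w
    have h4 : ∀ w, g x (gtr g A x) w = diff (fun y => tr (A y)) x w :=
      fun w => hm.inverse_apply _ w
    simp only [ContinuousLinearMap.comp_apply, h2]
    rw [map_sub, sub_apply, sub_apply, h3, h4]
    ring
  have e2 : (S x ∘L (g x).inverse) ∘L ricciOmega Ω (metricOf g A) x =
      S x ∘L ricciOmegaStar Ω g x - S x ∘L covV g (gtr g A) x +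
        (S x ∘L covE g A x (grad g (logVol Ω g) x) - S x ∘L dd g A A x) := by
    rw [e1]
    ext1 u
    have h5 : hessian g (fun y => tr (A y)) x u = g x (covV g (gtr g A) x u) := by
      ext1 v; exact hessian_eq_covV x hg ht u v
    simp only [ContinuousLinearMap.comp_apply, add_apply, sub_apply, map_add, map_sub, h5,
      hm.inverse_self, ricciOmegaStar, sharp, dd]
  have e3 : covV g (fun y => S y (gtr g A y)) x = (2 : ℝ) • (S x ∘L dd g A A x) +
      S x ∘L covV g (gtr g A) x := by
    ext1 u
    rw [covV_apply x S _ hSs (hA.sV_gtr hg), covE_exp x A hA.smooth (h.right x)]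
    simp only [dd, add_apply, smul_apply, ContinuousLinearMap.comp_apply, hA.closed x u]
    rfl
  have e4 : diff (logVol Ω g) x (S x (gtr g A x)) =
      tr (S x ∘L covE g A x (grad g (logVol Ω g) x)) := by
    rw [trace_comp_nabla_eq hg hA x (exp_symm_field hA 2 x) (h.exp 2 x), hm.symm]
    exact (hm.inverse_apply _ _).symm
  rw [e0, e2, divV, e3, e4, ContinuousLinearMap.comp_add]
  simp only [tr_add, tr_sub, tr_smul, tr_id]
  ring

end

theorem MF.sE_ricciOmegaStar (Ω : VolumeForm n X) {g : BilField n X} (hg : MF g) :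
    SE (ricciOmegaStar Ω g) :=
  SB.sharp hg (hg.sB_ricci.add (hg.sB_hessian (hg.sF_logVol Ω)))

/-- The divergence integrates to zero. The dimension n comes from the trace of the metric, and -2 Tr
A from twice the change of log(dV/Ω). -/
theorem boldW_eq [T2Space X] [CompactSpace X] [MeasurableSpace X] [BorelSpace X]
    (Ω : VolumeForm n X) {g : Metric n X} {A : EndField n X} (hA : IsCod g.field A)
    (h : CC g.field A A) (hR : ∀ x u v, Commute (riemann g.field x u v) (A x)) :
    boldW Ω g A =
      ∫ x, tr (expEnd ((2 : ℝ) • A) x ∘L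
        (ricciOmegaStar Ω g.field x + dd g.field A A x)) ∂Ω.measure +
      ∫ x, (2 * logVol Ω g.field x - n) ∂Ω.measure - 2 * ∫ x, tr (A x) ∂Ω.measure := by
  have hg := g.mF
  have hS : SE (expEnd ((2 : ℝ) • A)) := (hA.smooth.smul 2).exp
  have i1 : SF n fun x => tr (expEnd ((2 : ℝ) • A) x ∘L
        (ricciOmegaStar Ω g.field x + dd g.field A A x)) :=
    (hS.comp ((hg.sE_ricciOmegaStar Ω).add (hA.sE_dd hg hA))).tr
  have i2 : SF n fun x => 2 * logVol Ω g.field x - n :=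
    ((hg.sF_logVol Ω).const_mul 2).sub (SF.const _)
  have hY := hS.apply (hA.sV_gtr hg)
  have i3 := hg.sF_divV Ω hY
  have e1 : boldW Ω g A = ∫ x, (tr (expEnd ((2 : ℝ) • A) x ∘L
        (ricciOmegaStar Ω g.field x + dd g.field A A x)) + (2 * logVol Ω g.field x - n) -
        2 * tr (A x) -
        divV Ω g.field (fun y => expEnd ((2 : ℝ) • A) y (gtr g.field A y)) x) ∂Ω.measure := by
    refine integral_congr_ae (Eventually.of_forall fun x => ?_)
    simp only
    rw [tr_sharp_metricOf Ω hg hA h hR, logVol_metricOf Ω hg hA]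
    ring
  rw [e1, integral_sub (((i1.add i2).sub (hA.smooth.tr.const_mul 2)).integrable Ω)
      (i3.integrable Ω), integral_divV Ω hg hY,
    integral_sub ((i1.add i2).integrable Ω) ((hA.smooth.tr.const_mul 2).integrable Ω),
    integral_add (i1.integrable Ω) (i2.integrable Ω), integral_const_mul, sub_zero]

end

section

variable {n : ℕ} {X : Type*} [TopologicalSpace X] [ChartedSpace (E n) X] [IsManifold (𝓡 n) ∞ X]

/-! ### Integrals of `Tr (e^{2tV} C)` -/

/-- The function `Tr (e^{2tV} C)`. -/
def expTr (V C : EndField n X) (t : ℝ) (x : X) : ℝ := tr (expEnd ((2 * t) • V) x ∘L C x)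

theorem sF_expTr {V C : EndField n X} (hV : SE V) (hC : SE C) (t : ℝ) : SF n (expTr V C t) :=
  ((hV.smul _).exp.comp hC).tr

/-- Joint continuity bounds the t-derivative on [t - 1, t + 1] × X, which is compact; this is the
domination used for differentiating under the integral. -/
theorem continuous_expTr {V C : EndField n X} (hV : SE V) (hC : SE C) :
    Continuous fun p : ℝ × X => expTr V C p.1 p.2 := by
  refine continuous_iff_continuousAt.2 fun ⟨t, x⟩ => ?_
  have hx := mem_chart_source (E n) x
  have h1 : (fun p : ℝ × X => expTr V C p.1 p.2) =ᶠ[𝓝 (t, x)] fun p => trL n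
      (NormedSpace.exp ((2 * p.1) • repE x V (chartAt (E n) x p.2)) ∘L
        repE x C (chartAt (E n) x p.2)) := by
    filter_upwards [continuousAt_snd.preimage_mem_nhds
      ((chartAt (E n) x).open_source.mem_nhds hx)] with p hp
    have hz := chart_mem_ct hp
    have h2 : (2 * p.1) • repE x V (chartAt (E n) x p.2) =
        repE x ((2 * p.1) • V) (chartAt (E n) x p.2) := by ext1 v; simp [repE_apply]
    have h3 := tr_repE hz fun y => expEnd ((2 * p.1) • V) y ∘L C y
    rw [repE_comp hz, repE_exp hz, cs_chart hp] at h3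
    rw [h2, trL_apply, h3]
    rfl
  have hφ : ContinuousAt (fun p : ℝ × X => chartAt (E n) x p.2) (t, x) :=
    ((chartAt (E n) x).continuousAt hx).comp continuousAt_snd
  have hv : ContinuousAt (fun p : ℝ × X => repE x V (chartAt (E n) x p.2)) (t, x) :=
    ContinuousAt.comp (g := repE x V) (f := fun p : ℝ × X => chartAt (E n) x p.2)
      (ContDiffOn.at_ct (hV x) (self_mem_ct x)).continuousAt hφ
  have hc : ContinuousAt (fun p : ℝ × X => repE x C (chartAt (E n) x p.2)) (t, x) :=
    ContinuousAt.comp (g := repE x C) (f := fun p : ℝ × X => chartAt (E n) x p.2)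
      (ContDiffOn.at_ct (hC x) (self_mem_ct x)).continuousAt hφ
  refine ContinuousAt.congr ?_ h1.symm
  have he : ContinuousAt (fun p : ℝ × X =>
      NormedSpace.exp ((2 * p.1) • repE x V (chartAt (E n) x p.2))) (t, x) :=
    (NormedSpace.exp_continuous (𝔸 := E n →L[ℝ] E n)).continuousAt.comp
      ((continuousAt_const.mul continuousAt_fst).smul hv)
  exact (trL n).continuous.continuousAt.comp (he.clm_comp hc)

/-- The section `2 V C`. -/
def twist (V C : EndField n X) : EndField n X := fun x => (2 : ℝ) • (V x ∘L C x)

theorem SE.twist {V C : EndField n X} (hV : SE V) (hC : SE C) : SE (twist V C) :=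
  (hV.comp hC).smul 2

theorem hasDerivAt_expTr (V C : EndField n X) (t : ℝ) (x : X) :
    HasDerivAt (fun t => expTr V C t x) (expTr V (twist V C) t x) t := by
  have h1 : HasDerivAt (fun t : ℝ => NormedSpace.exp ((2 * t) • V x)) _ t :=
    (hasDerivAt_exp_smul_const (V x) (2 * t)).scomp t ((hasDerivAt_id t).const_mul 2)
  have h2 := (trL n).hasFDerivAt.comp_hasDerivAt t (h1.clm_comp (hasDerivAt_const t (C x)))
  refine h2.congr_deriv ?_
  rw [trL_apply, expTr, twist]
  congr 1
  ext1 v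
  simp
  rfl

theorem MemTK.add_smul {g : Metric n X} {K A V : EndField n X} (hA : MemTK g K A)
    (hV : MemTK g K V) (t : ℝ) : MemTK g K (A + t • V) where
  smooth := (smoothEnd_iff _).2 (hA.isCod.smooth.add (hV.isCod.smooth.smul t))
  symm x u v := by
    have h1 := hA.symm x u v
    have h2 := hV.symm x u v
    simp only [Pi.add_apply, Pi.smul_apply, add_apply, smul_apply, map_add, map_smul, h1, h2]
  closed x u v := by
    have cA := hA.isCod
    have cV := hV.isCod
    rw [nablaEnd_eq g.mF (cA.smooth.add (cV.smooth.smul t)),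
      nablaEnd_eq g.mF (cA.smooth.add (cV.smooth.smul t))]
    simp only [covE_add x A _ cA.smooth (cV.smooth.smul t), covE_smul x t V cV.smooth, add_apply,
      smul_apply, Matrix.cons_val_fin_one]
    rw [cA.closed x u v, cV.closed x u v, sub_self]
  comm_curvature p x u :=
    sub_eq_zero.2 (Commute.add_right (sub_eq_zero.1 (hA.comm_curvature p x u))
      (Commute.smul_right (sub_eq_zero.1 (hV.comm_curvature p x u)) t)).eq
  comm_center p x u :=
    sub_eq_zero.2 (Commute.add_right (sub_eq_zero.1 (hA.comm_center p x u))
      (Commute.smul_right (sub_eq_zero.1 (hV.comm_center p x u)) t)).eq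

theorem expEnd_add_smul {A V : EndField n X} (x : X) (h : Commute (A x) (V x)) (t : ℝ) :
    expEnd ((2 : ℝ) • (A + t • V)) x =
      expEnd ((2 * t) • V) x ∘L expEnd ((2 : ℝ) • A) x := by
  have h1 : (2 : ℝ) • (A x + t • V x) = (2 * t) • V x + (2 : ℝ) • A x := by module
  have h2 := NormedSpace.exp_add_of_commute ((h.symm.smul_left (2 * t)).smul_right (2 : ℝ))
  rw [← h1] at h2
  exact h2

variable [MeasurableSpace X] [BorelSpace X] [CompactSpace X]

theorem hasDerivAt_integral_expTr (Ω : VolumeForm n X) {V C : EndField n X} (hV : SE V)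
    (hC : SE C) (t : ℝ) : HasDerivAt (fun t => ∫ x, expTr V C t x ∂Ω.measure)
      (∫ x, expTr V (twist V C) t x ∂Ω.measure) t := by
  have hfin := isFiniteMeasure_measure Ω
  obtain ⟨M, hM⟩ := ((isCompact_Icc (a := t - 1) (b := t + 1)).prod
    (isCompact_univ (X := X))).exists_bound_of_continuousOn
      (continuous_expTr hV (hV.twist hC)).continuousOn
  refine (hasDerivAt_integral_of_dominated_loc_of_deriv_le (bound := fun _ => M)
    (F' := expTr V (twist V C)) (Icc_mem_nhds (sub_one_lt t) (lt_add_one t))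
    (Eventually.of_forall fun s => ((sF_expTr hV hC s).integrable Ω).aestronglyMeasurable)
    ((sF_expTr hV hC t).integrable Ω)
    ((sF_expTr hV (hV.twist hC) t).integrable Ω).aestronglyMeasurable
    (Eventually.of_forall fun x s hs => hM (s, x) ⟨hs, Set.mem_univ x⟩)
    (integrable_const M) (Eventually.of_forall fun x s _ => hasDerivAt_expTr V C s x)).2

/-- Differentiating in t replaces C by `twist V C`, so the family of these integrals is closed under
differentiation and induction applies. -/
theorem contDiff_integral_expTr (Ω : VolumeForm n X) {V : EndField n X} (hV : SE V) (k : ℕ) :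
    ∀ {C : EndField n X}, SE C → ContDiff ℝ k fun t => ∫ x, expTr V C t x ∂Ω.measure := by
  induction k with
  | zero => exact fun hC => contDiff_zero.2 (continuous_iff_continuousAt.2 fun t =>
      (hasDerivAt_integral_expTr Ω hV hC t).continuousAt)
  | succ k ih =>
    intro C hC
    have h1 : deriv (fun t => ∫ x, expTr V C t x ∂Ω.measure) = _ :=
      funext fun t => (hasDerivAt_integral_expTr Ω hV hC t).deriv
    rw [Nat.cast_add, Nat.cast_one, contDiff_succ_iff_deriv, h1]
    exact ⟨fun t => (hasDerivAt_integral_expTr Ω hV hC t).differentiableAt, by simp,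
      ih (hV.twist hC)⟩

theorem iteratedDeriv_two_quadratic (Ω : VolumeForm n X) {V C₀ C₁ C₂ : EndField n X} (hV : SE V)
    (h0 : SE C₀) (h1 : SE C₁) (h2 : SE C₂) (c d : ℝ) :
    let h := fun t : ℝ => ∫ x, expTr V C₀ t x ∂Ω.measure + t * ∫ x, expTr V C₁ t x ∂Ω.measure +
      t ^ 2 * ∫ x, expTr V C₂ t x ∂Ω.measure + (c + t * d)
    ContDiff ℝ 2 h ∧ iteratedDeriv 2 h 0 = ∫ x, expTr V (twist V (twist V C₀)) 0 x ∂Ω.measure +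
      2 * ∫ x, expTr V (twist V C₁) 0 x ∂Ω.measure + 2 * ∫ x, expTr V C₂ 0 x ∂Ω.measure := by
  intro h
  have D := fun {C : EndField n X} (hC : SE C) => hasDerivAt_integral_expTr Ω hV hC
  constructor
  · have k := fun {C : EndField n X} (hC : SE C) => contDiff_integral_expTr Ω hV 2 hC
    exact (((k h0).add (contDiff_id.mul (k h1))).add ((contDiff_id.pow 2).mul (k h2))).add
      (contDiff_const.add (contDiff_id.mul contDiff_const))
  · have e1 : deriv h = fun t => ∫ x, expTr V (twist V C₀) t x ∂Ω.measure +
        (∫ x, expTr V C₁ t x ∂Ω.measure + t * ∫ x, expTr V (twist V C₁) t x ∂Ω.measure) +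
        (2 * t * ∫ x, expTr V C₂ t x ∂Ω.measure +
          t ^ 2 * ∫ x, expTr V (twist V C₂) t x ∂Ω.measure) + d := by
      funext t
      refine HasDerivAt.deriv ?_
      refine ((((D h0 t).add ((hasDerivAt_id t).mul (D h1 t))).add
        ((hasDerivAt_pow 2 t).mul (D h2 t))).add
          ((hasDerivAt_id t).mul_const d |>.const_add c)).congr_deriv ?_
      simp
    have e2 := ((((D (hV.twist h0) 0).add ((D h1 0).add
        ((hasDerivAt_id (0 : ℝ)).mul (D (hV.twist h1) 0)))).add
        ((((hasDerivAt_id (0 : ℝ)).const_mul 2).mul (D h2 0)).add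
          ((hasDerivAt_pow 2 (0 : ℝ)).mul (D (hV.twist h2) 0)))).add_const d)
    rw [iteratedDeriv_succ, iteratedDeriv_one, e1]
    refine e2.deriv.trans ?_
    simp
    ring

/-! ### The second variation -/

/-- The integrand of the second variation. -/
def secondVar (Ω : VolumeForm n X) (g : BilField n X) (A V : EndField n X) (x : X) : ℝ :=
  tr (expEnd ((2 : ℝ) • A) x ∘L
    ((4 : ℝ) • ((V x ∘L V x) ∘L (ricciOmegaStar Ω g x + dd g A A x)) +
      (8 : ℝ) • (V x ∘L dd g A V x) + (2 : ℝ) • dd g V V x))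

theorem boldW_add_smul [T2Space X] {Ω : VolumeForm n X} {g : Metric n X} {K A V : EndField n X}
    (hK : SE K) (hKev : ∀ᵐ x ∂Ω.measure, HasDistinctEigenvalues (K x))
    (hA : MemTK g K A) (hV : MemTK g K V) :
    ContDiff ℝ 2 (fun t : ℝ => boldW Ω g (A + t • V)) ∧
      iteratedDeriv 2 (fun t : ℝ => boldW Ω g (A + t • V)) 0 =
        ∫ x, secondVar Ω g.field A V x ∂Ω.measure := by
  have hg := g.mF
  have cA := hA.isCod
  have cV := hV.isCod
  have hAV := MemTK.cC hK hKev hA hV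
  have sS : SE (expEnd ((2 : ℝ) • A)) := (cA.smooth.smul 2).exp
  set S := expEnd ((2 : ℝ) • A) with hS
  set C₀ : EndField n X := fun x => S x ∘L (ricciOmegaStar Ω g.field + dd g.field A A) x with hC₀
  -- The factor 2 is the cross term of the quadratic expansion `dd_add_smul`.
  set C₁ : EndField n X := (2 : ℝ) • fun x => S x ∘L dd g.field A V x with hC₁
  set C₂ : EndField n X := fun x => S x ∘L dd g.field V V x with hC₂
  have s0 : SE C₀ := sS.comp ((hg.sE_ricciOmegaStar Ω).add (cA.sE_dd hg cA))
  have s1 : SE C₁ := (sS.comp (cA.sE_dd hg cV)).smul 2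
  have s2 : SE C₂ := sS.comp (cV.sE_dd hg cV)
  have key : (fun t : ℝ => boldW Ω g (A + t • V)) = fun t : ℝ =>
      ∫ x, expTr V C₀ t x ∂Ω.measure + t * ∫ x, expTr V C₁ t x ∂Ω.measure +
      t ^ 2 * ∫ x, expTr V C₂ t x ∂Ω.measure +
      ((∫ x, (2 * logVol Ω g.field x - n) ∂Ω.measure - 2 * ∫ x, tr (A x) ∂Ω.measure) +
        t * (-(2 * ∫ x, tr (V x) ∂Ω.measure))) := by
    funext t
    have hT := hA.add_smul hV t
    rw [boldW_eq Ω hT.isCod (MemTK.cC hK hKev hT hT) hT.comm_riemann]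
    have e1 : (fun x => tr (expEnd ((2 : ℝ) • (A + t • V)) x ∘L (ricciOmegaStar Ω g.field x +
        dd g.field (A + t • V) (A + t • V) x))) =
        fun x => expTr V C₀ t x + t * expTr V C₁ t x + t ^ 2 * expTr V C₂ t x := by
      funext x
      rw [expEnd_add_smul x (hAV.zero x), dd_add_smul hg cA cV hAV]
      simp only [expTr, ← tr_smul, ← tr_add]
      congr 1
      ext1 w
      simp only [hC₀, hC₁, hC₂, ContinuousLinearMap.comp_apply, add_apply, smul_apply,
        Pi.add_apply, Pi.smul_apply, map_add, map_smul, ← hS]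
      module
    have e2 : (fun x => tr ((A + t • V) x)) = fun x => tr (A x) + t * tr (V x) := by
      funext x
      rw [Pi.add_apply, Pi.smul_apply, tr_add, tr_smul]
    have i0 := sF_expTr cV.smooth s0 t
    have i1 := (sF_expTr cV.smooth s1 t).const_mul t
    have i2 := (sF_expTr cV.smooth s2 t).const_mul (t ^ 2)
    rw [e1, e2, integral_add ((i0.add i1).integrable Ω) (i2.integrable Ω),
      integral_add (i0.integrable Ω) (i1.integrable Ω),
      integral_add (cA.smooth.tr.integrable Ω) ((cV.smooth.tr.const_mul t).integrable Ω),
      integral_const_mul, integral_const_mul, integral_const_mul]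
    ring
  have h := iteratedDeriv_two_quadratic Ω cV.smooth s0 s1 s2
    (∫ x, (2 * logVol Ω g.field x - n) ∂Ω.measure - 2 * ∫ x, tr (A x) ∂Ω.measure)
    (-(2 * ∫ x, tr (V x) ∂Ω.measure))
  rw [key]
  refine ⟨h.1, h.2.trans ?_⟩
  have j0 := sF_expTr cV.smooth (cV.smooth.twist (cV.smooth.twist s0)) 0
  have j1 := (sF_expTr cV.smooth (cV.smooth.twist s1) 0).const_mul 2
  have j2 := (sF_expTr cV.smooth s2 0).const_mul 2
  rw [← integral_const_mul, ← integral_const_mul,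
    ← integral_add (j0.integrable Ω) (j1.integrable Ω),
    ← integral_add ((j0.add j1).integrable Ω) (j2.integrable Ω)]
  refine integral_congr_ae (Eventually.of_forall fun x => ?_)
  -- At t = 0 the factor e^{2tV} is the identity; it remains to move V past e^{2A} to match the
  -- order of factors in `secondVar`.
  have hSV : ∀ w, V x (S x w) = S x (V x w) := fun w =>
    congrArg (fun L : E n →L[ℝ] E n => L w) (((hAV.zero x).smul_left (2 : ℝ)).exp_left).eq.symm
  have h0 : ∀ w, expEnd ((2 * (0 : ℝ)) • V) x w = w := fun w => by
    simp [expEnd]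
  simp only [expTr, secondVar, ← tr_smul, ← tr_add]
  congr 1
  ext1 w
  simp only [twist, hC₀, hC₁, hC₂, ContinuousLinearMap.comp_apply, add_apply, smul_apply, h0,
    Pi.add_apply, Pi.smul_apply, map_add, map_smul, ← hS, hSV]
  module

end

section

variable {n : ℕ} {X : Type*} [TopologicalSpace X] [ChartedSpace (E n) X] [IsManifold (𝓡 n) ∞ X]

/-! ### Positivity of traces -/

/-- In a G-orthogonal basis the diagonal entries of G⁻¹b are b(vⱼ, vⱼ)/G(vⱼ, vⱼ). Symmetry of b is
not needed. -/
theorem IsMet.tr_nonneg {G : Bil n} (hG : IsMet G) {b : Bil n} (hb : ∀ u, 0 ≤ b u u) :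
    0 ≤ tr (G.inverse ∘L b) := by
  let B : LinearMap.BilinForm ℝ (E n) := LinearMap.mk₂ ℝ (fun u v => G u v) (by simp) (by simp)
    (by simp) (by simp)
  have hB : LinearMap.IsSymm B := ⟨fun u v => hG.symm u v⟩
  obtain ⟨v, hv⟩ := LinearMap.BilinForm.exists_orthogonal_basis hB
  rw [tr, LinearMap.trace_eq_matrix_trace ℝ v, Matrix.trace]
  refine Finset.sum_nonneg fun j _ => ?_
  rw [Matrix.diag_apply, LinearMap.toMatrix_apply]
  set w := G.inverse (b (v j)) with hw
  show 0 ≤ v.repr w j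
  have h1 : G w (v j) = v.repr w j * G (v j) (v j) := by
    conv_lhs => rw [← v.sum_repr w]
    rw [map_sum, sum_apply, Finset.sum_eq_single j]
    · simp
    · intro k _ hk
      have : G (v k) (v j) = 0 := hv hk
      simp [this]
    · simp
  rw [hw, hG.inverse_apply, ← hw] at h1
  have h2 := hG.pos (v j) (v.ne_zero j)
  by_contra! h3
  have := hb (v j)
  nlinarith

theorem IsMet.tr_sq_nonneg {G : Bil n} (hG : IsMet G) {C : E n →L[ℝ] E n}
    (hC : ∀ u v, G (C u) v = G u (C v)) : 0 ≤ tr (C ∘L C) := by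
  have h1 := hG.tr_nonneg (b := G.bilinearComp C C) fun u => by
    rcases eq_or_ne (C u) 0 with h | h
    · simp [h]
    · exact (hG.pos _ h).le
  have h2 : C ∘L C = G.inverse ∘L G.bilinearComp C C := by
    ext1 u
    refine hG.ext fun w => ?_
    rw [ContinuousLinearMap.comp_apply, ContinuousLinearMap.comp_apply, hG.inverse_apply, hC]
    rfl
  rwa [h2]

/-- The sum is the G-trace of the bilinear form (u, v) ↦ Tr(W_u W_v), whose diagonal values Tr(W_u²)
are nonnegative for symmetric W_u. -/
theorem sum_tr_sq_nonneg {g : BilField n X} (hg : MF g) (x : X) {W : E n →L[ℝ] E n →L[ℝ] E n}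
    (hW : ∀ w u v, g x (W w u) v = g x u (W w v)) :
    0 ≤ ∑ i, tr (W (e i) ∘L W (ei g x i)) := by
  have h1 := (hg.met x).tr_nonneg
    (b := (ContinuousLinearMap.compL ℝ (E n) (E n →L[ℝ] E n) ℝ (trL n)) ∘L
      (ContinuousLinearMap.compL ℝ (E n) (E n) (E n)).bilinearComp W W)
    fun u => (hg.met x).tr_sq_nonneg (hW u)
  rw [← (hg.met x).sum_contr] at h1
  exact h1

/-! ### Norms of covariant derivatives -/

section

variable {g : BilField n X}

theorem transpose_of_symm (hg : MF g) (x : X) {C : E n →L[ℝ] E n}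
    (hC : ∀ u v, g x (C u) v = g x u (C v)) : transpose g x C = C := by
  ext1 u
  refine (hg.met x).ext fun w => ?_
  have : transpose g x C u = (g x).inverse (g x u ∘L C) := rfl
  rw [this, (hg.met x).inverse_apply, hC]
  rfl

theorem innerEnd_of_symm (hg : MF g) (x : X) (B : E n →L[ℝ] E n) {C : E n →L[ℝ] E n}
    (hC : ∀ u v, g x (C u) v = g x u (C v)) : innerEnd g x B C = tr (B ∘L C) := by
  rw [innerEnd, transpose_of_symm hg x hC]

theorem normSq_of_symm (hg : MF g) (x : X) {α : EndTensor n X 1} {W : E n → E n →L[ℝ] E n}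
    (hα : ∀ u, α x ![u] = W u) (hW : ∀ w u v, g x (W w u) v = g x u (W w v)) :
    normSq g α x = ∑ i, tr (W (e i) ∘L W (ei g x i)) :=
  Finset.sum_congr rfl fun i _ => by
    rw [hα, hα, innerEnd_of_symm hg x _ (hW _)]
    rfl

/-- Expand the square, collect the coefficients N and M in front by commutation, and recognise the
four contractions as values of `dd`. -/
theorem sum_mul_self {A V : EndField n X} (hg : MF g) (hA : IsCod g A) (hV : IsCod g V)
    (hAA : CC g A A) (hAV : CC g A V) (hVV : CC g V V) (x : X) {N M : E n →L[ℝ] E n}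
    (h1 : ∀ u, Commute (covE g A x u) N) (h2 : ∀ u, Commute (covE g A x u) M)
    (h3 : ∀ u, Commute (covE g V x u) N) (h4 : ∀ u, Commute (covE g V x u) M)
    (h5 : Commute M N) :
    ∑ i, tr ((N * covE g A x (e i) + M * covE g V x (e i)) *
      (N * covE g A x (ei g x i) + M * covE g V x (ei g x i))) =
    tr (N * N * dd g A A x) + 2 * tr (N * M * dd g A V x) + tr (M * M * dd g V V x) := by
  have e1 : ∀ i, tr ((N * covE g A x (e i) + M * covE g V x (e i)) *
      (N * covE g A x (ei g x i) + M * covE g V x (ei g x i))) =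
      tr (N * N * (covE g A x (e i) * covE g A x (ei g x i))) +
      tr (N * M * (covE g A x (e i) * covE g V x (ei g x i))) +
      tr (N * M * (covE g V x (e i) * covE g A x (ei g x i))) +
      tr (M * M * (covE g V x (e i) * covE g V x (ei g x i))) := fun i => by
    rw [← tr_add, ← tr_add, ← tr_add]
    congr 1
    simp only [mul_add, add_mul, mul_assoc, (h1 _).left_comm, (h2 _).left_comm, (h3 _).left_comm,
      (h4 _).left_comm, h5.left_comm]
    abel
  have e2 := sum_comp_nabla hg hA hA hAA x
  have e3 := sum_comp_nabla hg hA hV hAV x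
  have e4 := sum_comp_nabla hg hV hA hAV.swap x
  have e5 := sum_comp_nabla hg hV hV hVV x
  rw [← dd_swap hg hA hV hAV] at e4
  simp only [e1, Finset.sum_add_distrib, ← tr_sum, ← Finset.mul_sum]
  simp only [← ContinuousLinearMap.mul_def] at e2 e3 e4 e5
  rw [e2, e3, e4, e5]
  ring

end

theorem symm_mul {G : Bil n} {B C : E n →L[ℝ] E n} (hB : ∀ u v, G (B u) v = G u (B v))
    (hC : ∀ u v, G (C u) v = G u (C v)) (h : Commute B C) (u v : E n) :
    G ((B * C) u) v = G u ((B * C) v) := by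
  conv_rhs => rw [h.eq]
  exact (hB _ _).trans (hC _ _)

theorem symm_add {G : Bil n} {B C : E n →L[ℝ] E n} (hB : ∀ u v, G (B u) v = G u (B v))
    (hC : ∀ u v, G (C u) v = G u (C v)) (u v : E n) :
    G ((B + C) u) v = G u ((B + C) v) := by
  simp only [add_apply, map_add, hB, hC]

/-- Two commuting Codazzi sections. -/
structure CodPair (g : BilField n X) (A V : EndField n X) : Prop where
  met : MF g
  fst : IsCod g A
  snd : IsCod g V
  ff : CC g A A
  fs : CC g A V
  ss : CC g V V

/-! ### Squares and norms built from e^A V -/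

namespace CodPair

variable {g : BilField n X} {A V : EndField n X}

theorem exp_left (h : CodPair g A V) (x : X) : Commute (expEnd A x) (V x) := (h.fs.zero x).exp_left

theorem exp_cov_left (h : CodPair g A V) (x : X) (u : E n) :
    Commute (expEnd A x) (covE g A x u) := (h.ff.right x u).exp_left

theorem exp_cov_right (h : CodPair g A V) (x : X) (u : E n) :
    Commute (expEnd A x) (covE g V x u) := (h.fs.right x u).exp_left

theorem exp_symm (h : CodPair g A V) (x : X) (u v : E n) :
    g x (expEnd A x u) v = g x u (expEnd A x v) := IsMet.exp_symm (h.fst.symm x) u v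

theorem covE_exp_left (h : CodPair g A V) (x : X) (u : E n) :
    covE g (expEnd A) x u = expEnd A x ∘L covE g A x u := by
  have := covE_exp x A h.fst.smooth (h.ff.right x) 1 u
  simpa only [one_smul] using this

theorem covE_exp_comp (h : CodPair g A V) (x : X) (u : E n) :
    covE g (fun y => expEnd A y ∘L V y) x u =
      expEnd A x * V x * covE g A x u + expEnd A x * covE g V x u := by
  rw [covE_comp x _ V h.fst.smooth.exp h.snd.smooth, h.covE_exp_left, mul_assoc,
    ← (h.fs.left x u).eq]
  rfl

theorem exp_two (A : EndField n X) (x : X) :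
    expEnd ((2 : ℝ) • A) x = expEnd A x * expEnd A x := exp_two_smul (A x)

theorem comb_symm (h : CodPair g A V) (x : X) (c : ℝ) (w u v : E n) :
    g x ((c • (expEnd A x * V x) * covE g A x w + expEnd A x * covE g V x w) u) v =
      g x u ((c • (expEnd A x * V x) * covE g A x w + expEnd A x * covE g V x w) v) := by
  refine symm_add (symm_mul (IsMet.smul_symm (symm_mul (h.exp_symm x) (h.snd.symm x)
    (h.exp_left x)) c) (covE_symm x h.met A h.fst.smooth h.fst.symm w) ?_)
    (symm_mul (h.exp_symm x) (covE_symm x h.met V h.snd.smooth h.snd.symm w)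
      (h.exp_cov_right x w)) u v
  exact ((h.exp_cov_left x w).mul_left (h.fs.left x w).symm).smul_left c

/-- The combination c e^A V ∇A + e^A ∇V serves twice: c = 1 is the covariant derivative of e^A V,
and c = 2 is the square completed in the convexity estimate. -/
theorem sum_comb (h : CodPair g A V) (x : X) (c : ℝ) :
    ∑ i, tr ((c • (expEnd A x * V x) * covE g A x (e i) + expEnd A x * covE g V x (e i)) *
      (c • (expEnd A x * V x) * covE g A x (ei g x i) + expEnd A x * covE g V x (ei g x i))) =
    c ^ 2 * tr (expEnd ((2 : ℝ) • A) x * (V x * V x) * dd g A A x) +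
      2 * c * tr (expEnd ((2 : ℝ) • A) x * V x * dd g A V x) +
      tr (expEnd ((2 : ℝ) • A) x * dd g V V x) := by
  have hc := (h.exp_left x).left_comm
  rw [sum_mul_self h.met h.fst h.snd h.ff h.fs h.ss x
    (fun u => (((h.exp_cov_left x u).mul_left (h.fs.left x u).symm).smul_left c).symm)
    (fun u => (h.exp_cov_left x u).symm)
    (fun u => (((h.exp_cov_right x u).mul_left (h.ss.left x u).symm).smul_left c).symm)
    (fun u => (h.exp_cov_right x u).symm)
    (((Commute.refl _).mul_right (h.exp_left x)).smul_right c), exp_two]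
  simp only [smul_mul_assoc, mul_smul_comm, tr_smul, mul_assoc, hc]
  ring

theorem normSq_exp_comp (h : CodPair g A V) (x : X) :
    normSq g (nablaEnd g (fun y => expEnd A y ∘L V y)) x =
      tr (expEnd ((2 : ℝ) • A) x * (V x * V x) * dd g A A x) +
      2 * tr (expEnd ((2 : ℝ) • A) x * V x * dd g A V x) +
      tr (expEnd ((2 : ℝ) • A) x * dd g V V x) := by
  rw [normSq_of_symm h.met x (fun u => ?_) (h.comb_symm x 1)]
  · have := h.sum_comb x 1
    rw [one_pow, one_mul, mul_one] at this
    exact this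
  · rw [nablaEnd_eq h.met (h.fst.smooth.exp.comp h.snd.smooth), h.covE_exp_comp, one_smul]
    rfl

theorem normSq_mulLeft (h : CodPair g A V) (x : X) :
    normSq g (mulLeft V (nablaEnd g A)) x = tr ((V x * V x) * dd g A A x) := by
  have h1 := sum_mul_self h.met h.fst h.fst h.ff h.ff h.ff x (N := V x) (M := 0)
    (h.fs.left x) (fun _ => Commute.zero_right _) (h.fs.left x)
    (fun _ => Commute.zero_right _) (Commute.zero_left _)
  simp only [zero_mul, mul_zero, add_zero, tr_zero] at h1
  rw [← h1]
  refine normSq_of_symm h.met x (W := fun u => V x * covE g A x u) (fun u => ?_)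
    fun w => symm_mul (h.snd.symm x) (covE_symm x h.met A h.fst.smooth h.fst.symm w)
      (h.fs.left x w).symm
  rw [mulLeft, nablaEnd_eq h.met h.fst.smooth]
  rfl

/-! ### The second variation formula -/

theorem _root_.SolitonRicci.S1.comp {B : EndField n X} {D : X → E n →L[ℝ] E n →L[ℝ] E n}
    (hB : SE B) (hD : S1 D) :
    S1 fun y => ContinuousLinearMap.compL ℝ (E n) (E n) (E n) (B y) ∘L D y := fun x => by
  have h1 := (ContinuousLinearMap.compL ℝ (E n) (E n) (E n)).contDiff.comp_contDiffOn (hB x)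
  refine (h1.clm_comp (hD x)).congr fun z hz => ?_
  ext1 u; ext1 v
  simp [rep1_apply, repE_apply, fromChart_toChart (cs_mem hz)]

/-- The vector field `V² e^{2A} ξ`, `ξ` the gradient of the trace of `A`. -/
def field (g : BilField n X) (A V : EndField n X) (x : X) : E n :=
  V x (V x (expEnd ((2 : ℝ) • A) x (gtr g A x)))

theorem sV_field (h : CodPair g A V) : SV (field g A V) :=
  h.snd.smooth.apply (h.snd.smooth.apply ((h.fst.smooth.smul 2).exp.apply (h.fst.sV_gtr h.met)))

/-- The field is dual to u ↦ Tr(N β_u) with N = V² e^A and β = e^A ∇A. Contracting ∇N with β gives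
the two `dd` terms; contracting N with ∇β and subtracting the gradient term of f gives N times the
Ω-divergence of β. -/
theorem divV_field (h : CodPair g A V) (Ω : VolumeForm n X) (x : X) :
    divV Ω g (field g A V) x =
      2 * tr (expEnd ((2 : ℝ) • A) x * V x * dd g A V x) +
      tr (expEnd ((2 : ℝ) • A) x * (V x * V x) * dd g A A x) +
      tr ((V x * V x * expEnd A x) *
        divOmega Ω g (mulLeft (expEnd A) (nablaEnd g A)) x) := by
  have hg := h.met
  set N : EndField n X := fun y => V y ∘L (V y ∘L expEnd A y) with hN
  set β := fun y => ContinuousLinearMap.compL ℝ (E n) (E n) (E n) (expEnd A y) ∘L covE g A y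
    with hβ
  have sN : SE N := h.snd.smooth.comp (h.snd.smooth.comp h.fst.smooth.exp)
  have sβ : S1 β := S1.comp h.fst.smooth.exp (h.fst.smooth.covE hg)
  have hp : ∀ y u, g y (field g A V y) u = tr (N y ∘L β y u) := fun y u => by
    have hVS : Commute (V y) (expEnd ((2 : ℝ) • A) y) := by
      rw [exp_two]; exact ((h.exp_left y).mul_left (h.exp_left y)).symm
    have e1 := trace_comp_nabla_eq hg h.fst y (M := V y * (V y * expEnd ((2 : ℝ) • A) y))
      (symm_mul (h.snd.symm y) (symm_mul (h.snd.symm y) (exp_symm_field h.fst 2 y) hVS)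
        ((Commute.refl _).mul_right hVS))
      (fun u => (h.fs.left y u).symm.mul_left ((h.fs.left y u).symm.mul_left (h.ff.exp 2 y u))) u
    rw [exp_two] at e1
    rw [field, exp_two]
    exact e1.symm
  have e1 : mulLeft (expEnd A) (nablaEnd g A) = fun y w => β y (w 0) := by
    funext y w
    rw [mulLeft, nablaEnd_eq hg h.fst.smooth]
    rfl
  have e2 : diff (logVol Ω g) x (field g A V x) = tr (N x ∘L β x (grad g (logVol Ω g) x)) := by
    rw [← hp, (hg.met x).symm]
    exact ((hg.met x).inverse_apply _ _).symm
  have e3 : tr (covV g (field g A V) x) =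
      ∑ i, tr (covE g N x (e i) ∘L β x (ei g x i)) + ∑ i, tr (N x ∘L cov1 g β x (e i) (ei g x i)) := by
    rw [(hg.met x).tr_eq, ← Finset.sum_add_distrib]
    exact Finset.sum_congr rfl fun i _ => covV_of_trace x hg h.sV_field sN sβ hp _ _
  have e4 : divg g (mulLeft (expEnd A) (nablaEnd g A)) x = ∑ i, cov1 g β x (e i) (ei g x i) := by
    rw [e1]
    exact Finset.sum_congr rfl fun i _ => nabla_eq_cov1 x hg sβ _ _
  have e5 : ∀ i, tr (covE g N x (e i) ∘L β x (ei g x i)) =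
      2 * tr (expEnd ((2 : ℝ) • A) x * V x * (covE g V x (e i) * covE g A x (ei g x i))) +
      tr (expEnd ((2 : ℝ) • A) x * (V x * V x) *
        (covE g A x (e i) * covE g A x (ei g x i))) := fun i => by
    have c1 : covE g N x (e i) = covE g V x (e i) * (V x * expEnd A x) +
        V x * (covE g V x (e i) * expEnd A x + V x * (expEnd A x * covE g A x (e i))) := by
      rw [hN, covE_comp x V _ h.snd.smooth (h.snd.smooth.comp h.fst.smooth.exp),
        covE_comp x V _ h.snd.smooth h.fst.smooth.exp, h.covE_exp_left]
      rfl
    have c2 : covE g N x (e i) ∘L β x (ei g x i) =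
        covE g N x (e i) * (expEnd A x * covE g A x (ei g x i)) := rfl
    rw [c2, c1, ← tr_smul, ← tr_add, exp_two]
    congr 1
    simp only [add_mul, mul_add, mul_assoc, (h.exp_left x).symm.left_comm,
      (h.exp_cov_left x (e i)).symm.left_comm, (h.exp_cov_right x (e i)).symm.left_comm,
      (h.ss.left x (e i)).left_comm]
    module
  have e6 := sum_comp_nabla hg h.snd h.fst h.fs.swap x
  have e7 := sum_comp_nabla hg h.fst h.fst h.ff x
  rw [← dd_swap hg h.fst h.snd h.fs] at e6
  simp only [← ContinuousLinearMap.mul_def] at e6 e7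
  have e8 : tr ((V x * V x * expEnd A x) * divOmega Ω g (mulLeft (expEnd A) (nablaEnd g A)) x) =
      ∑ i, tr (N x ∘L cov1 g β x (e i) (ei g x i)) - tr (N x ∘L β x (grad g (logVol Ω g) x)) := by
    rw [divOmega, e4, e1, mul_sub, tr_sub, Finset.mul_sum, tr_sum]
    rfl
  rw [divV, e2, e3, e8]
  simp only [e5, Finset.sum_add_distrib, ← Finset.mul_sum, ← tr_sum]
  rw [e6, e7]
  ring

theorem secondVar_eq (g : BilField n X) (A V : EndField n X) (Ω : VolumeForm n X) (x : X) :
    secondVar Ω g A V x =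
      4 * tr (expEnd ((2 : ℝ) • A) x * (V x * V x) * ricciOmegaStar Ω g x) +
      4 * tr (expEnd ((2 : ℝ) • A) x * (V x * V x) * dd g A A x) +
      8 * tr (expEnd ((2 : ℝ) • A) x * V x * dd g A V x) +
      2 * tr (expEnd ((2 : ℝ) • A) x * dd g V V x) := by
  simp only [← tr_smul, ← tr_add]
  rw [secondVar]
  congr 1
  simp only [← ContinuousLinearMap.mul_def, mul_add, mul_smul_comm, smul_add, mul_assoc]

/-- In the notation r, a, b, c of the introduction, 4r + 4a + 8b + 2c - 2(a + 2b + c) - 2(a + 2b)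
leaves only 4r, and the remaining part of the divergence supplies the term in div^Ω(e^A ∇A). So the
two sides agree pointwise, before any integration. -/
theorem two_mul_innerEnd (h : CodPair g A V) (Ω : VolumeForm n X) (x : X) :
    2 * innerEnd g x ((-(expEnd A x ∘L divOmega Ω g (mulLeft (expEnd A) (nablaEnd g A)) x)
        + (2 : ℝ) • (expEnd ((2 : ℝ) • A) x ∘L ricciOmegaStar Ω g x)) ∘L V x) (V x) =
      secondVar Ω g A V x - 2 * normSq g (nablaEnd g (fun y => expEnd A y ∘L V y)) x -
        2 * divV Ω g (field g A V) x := by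
  rw [innerEnd_of_symm h.met x _ (h.snd.symm x), h.divV_field, secondVar_eq, h.normSq_exp_comp]
  set O := divOmega Ω g (mulLeft (expEnd A) (nablaEnd g A)) x
  set R := ricciOmegaStar Ω g x
  set S := expEnd ((2 : ℝ) • A) x
  have hSV : Commute S (V x) := ((h.fs.zero x).smul_left (2 : ℝ)).exp_left
  have e1 : tr (((-(expEnd A x ∘L O) + (2 : ℝ) • (S ∘L R)) ∘L V x) ∘L V x) =
      -tr ((expEnd A x * O) * (V x * V x)) + 2 * tr ((S * R) * (V x * V x)) := by
    rw [← tr_smul, ← tr_neg, ← tr_add]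
    congr 1
  have e2 : tr ((expEnd A x * O) * (V x * V x)) = tr ((V x * V x * expEnd A x) * O) := by
    rw [mul_assoc (V x * V x)]
    exact tr_comm _ _
  have e3 : tr ((S * R) * (V x * V x)) = tr (S * (V x * V x) * R) := by
    rw [(hSV.mul_right hSV).eq, mul_assoc (V x * V x)]
    exact tr_comm _ _
  rw [e1, e2, e3]
  ring

end CodPair

end

section

variable {n : ℕ} {X : Type*} [TopologicalSpace X] [ChartedSpace (E n) X] [IsManifold (𝓡 n) ∞ X]

/-! ### Convexity -/

namespace CodPair

variable {g : BilField n X} {A V : EndField n X}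

theorem sF_secondVar (h : CodPair g A V) (Ω : VolumeForm n X) : SF n (secondVar Ω g A V) := by
  have sV := h.snd.smooth
  exact ((h.fst.smooth.smul 2).exp.comp
    (((((sV.comp sV).comp ((h.met.sE_ricciOmegaStar Ω).add (h.fst.sE_dd h.met h.fst))).smul 4).add
      ((sV.comp (h.fst.sE_dd h.met h.snd)).smul 8)).add ((h.snd.sE_dd h.met h.snd).smul 2))).tr

theorem sF_normSq_exp_comp (h : CodPair g A V) :
    SF n (normSq g (nablaEnd g (fun y => expEnd A y ∘L V y))) := by
  have sV := h.snd.smooth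
  have sS := (h.fst.smooth.smul 2).exp
  have h1 : normSq g (nablaEnd g (fun y => expEnd A y ∘L V y)) = _ := funext h.normSq_exp_comp
  rw [h1]
  exact ((((sS.comp (sV.comp sV)).comp (h.fst.sE_dd h.met h.fst)).tr).add
    (((sS.comp sV).comp (h.fst.sE_dd h.met h.snd)).tr.const_mul 2)).add
      (sS.comp (h.snd.sE_dd h.met h.snd)).tr

theorem sF_normSq_mulLeft (h : CodPair g A V) : SF n (normSq g (mulLeft V (nablaEnd g A))) := by
  have h1 : normSq g (mulLeft V (nablaEnd g A)) = _ := funext h.normSq_mulLeft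
  rw [h1]
  exact ((h.snd.smooth.comp h.snd.smooth).comp (h.fst.sE_dd h.met h.fst)).tr

/-- The difference of the two sides is exactly twice the nonnegative square with c = 2: 4r + 4a + 8b
+ 2c' = 4r - 4a + 2(4a + 4b + c'), where c' = Tr(e^{2A} D(V, V)). -/
theorem secondVar_ge (h : CodPair g A V) {U : EndField n X} (hU : CodPair g A U)
    (hUe : ∀ x, U x = expEnd A x * V x) (Ω : VolumeForm n X) (x : X) :
    4 * tr ((U x ∘L U x) ∘L ricciOmegaStar Ω g x) - 4 * normSq g (mulLeft U (nablaEnd g A)) x ≤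
      secondVar Ω g A V x := by
  have h1 : 0 ≤ ∑ i, tr ((((2 : ℝ) • (expEnd A x * V x)) * covE g A x (e i) +
      expEnd A x * covE g V x (e i)) * (((2 : ℝ) • (expEnd A x * V x)) * covE g A x (ei g x i) +
        expEnd A x * covE g V x (ei g x i))) :=
    sum_tr_sq_nonneg h.met x
      (W := ContinuousLinearMap.compL ℝ (E n) (E n) (E n) ((2 : ℝ) • (expEnd A x * V x)) ∘L
          covE g A x + ContinuousLinearMap.compL ℝ (E n) (E n) (E n) (expEnd A x) ∘L covE g V x)
      (h.comb_symm x 2)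
  rw [h.sum_comb] at h1
  have h2 : U x * U x = expEnd ((2 : ℝ) • A) x * (V x * V x) := by
    rw [hUe, exp_two]
    simp only [mul_assoc, (h.exp_left x).symm.left_comm]
  rw [hU.normSq_mulLeft, secondVar_eq]
  simp only [← ContinuousLinearMap.mul_def, h2]
  linarith

end CodPair

/-- This provides the test section for the condition in `TKplus`. It is Codazzi since ∇(e^A V) =
e^A(V ∇A + ∇V), and V ∇_uA v is symmetric in u and v; the commutation conditions pass to
exponentials and products. -/
theorem MemTK.exp_comp {g : Metric n X} {K A V : EndField n X} (hA : MemTK g K A)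
    (hV : MemTK g K V) (h : CodPair g.field A V) : MemTK g K (fun y => expEnd A y ∘L V y) where
  smooth := (smoothEnd_iff _).2 (h.fst.smooth.exp.comp h.snd.smooth)
  symm x u v := by
    rw [h.met.met x |>.symm _ u]
    exact symm_mul (h.exp_symm x) (h.snd.symm x) (h.exp_left x) u v
  closed x u v := by
    have h1 : ∀ u v, covE g.field A x u (V x v) = V x (covE g.field A x v u) := fun u v => by
      rw [h.fst.closed x v u]
      exact congrArg (fun L : E n →L[ℝ] E n => L v) (h.fs.left x u).eq
    have h2 : ∀ u v, (expEnd A x * V x * covE g.field A x u + expEnd A x * covE g.field V x u) v =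
        expEnd A x (V x (covE g.field A x u v) + covE g.field V x u v) := fun u v => by
      simp
    rw [nablaEnd_eq h.met (h.fst.smooth.exp.comp h.snd.smooth),
      nablaEnd_eq h.met (h.fst.smooth.exp.comp h.snd.smooth), h.covE_exp_comp, h.covE_exp_comp,
      h2, h2, sub_eq_zero]
    show expEnd A x (V x (covE g.field A x u v) + covE g.field V x u v) =
      expEnd A x (V x (covE g.field A x v u) + covE g.field V x v u)
    rw [h.fst.closed x u v, h.snd.closed x u v]
  comm_curvature p x u :=
    sub_eq_zero.2 (Commute.mul_right (Commute.exp_right (sub_eq_zero.1 (hA.comm_curvature p x u)))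
      (sub_eq_zero.1 (hV.comm_curvature p x u))).eq
  comm_center p x u :=
    sub_eq_zero.2 (Commute.mul_right (Commute.exp_right (sub_eq_zero.1 (hA.comm_center p x u)))
      (sub_eq_zero.1 (hV.comm_center p x u))).eq

/-- As a function of t the left side is a quadratic polynomial with leading coefficient |U ∇V|² ≥ 0;
its convexity defect is t(1 - t) times this coefficient. -/
theorem normSq_mulLeft_add_smul_le {g : BilField n X} {A V U : EndField n X}
    (hA : CodPair g A U) (hV : CodPair g V U) (hAV : CodPair g A V)
    (hC : ∀ t : ℝ, CodPair g (A + t • V) U) {t : ℝ} (h0 : 0 ≤ t) (h1 : t ≤ 1) (x : X) :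
    normSq g (mulLeft U (nablaEnd g (A + t • V))) x ≤
      (1 - t) * normSq g (mulLeft U (nablaEnd g A)) x +
        t * normSq g (mulLeft U (nablaEnd g (A + (1 : ℝ) • V))) x := by
  have e1 : ∀ s : ℝ, normSq g (mulLeft U (nablaEnd g (A + s • V))) x =
      tr (U x * U x * dd g A A x) + 2 * s * tr (U x * U x * dd g A V x) +
        s ^ 2 * tr (U x * U x * dd g V V x) := fun s => by
    rw [(hC s).normSq_mulLeft, dd_add_smul hAV.met hAV.fst hAV.snd hAV.fs]
    simp only [mul_add, mul_smul_comm, tr_add, tr_smul]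
  have h2 : 0 ≤ tr (U x * U x * dd g V V x) := by
    have h3 := sum_mul_self hV.met hV.fst hV.fst hV.ff hV.ff hV.ff x (N := U x) (M := 0)
      (hV.fs.left x) (fun _ => Commute.zero_right _) (hV.fs.left x)
      (fun _ => Commute.zero_right _) (Commute.zero_left _)
    simp only [zero_mul, mul_zero, add_zero, tr_zero] at h3
    rw [← h3]
    exact sum_tr_sq_nonneg hV.met x
      (W := ContinuousLinearMap.compL ℝ (E n) (E n) (E n) (U x) ∘L covE g V x)
      fun w => symm_mul (hV.snd.symm x) (covE_symm x hV.met V hV.fst.smooth hV.fst.symm w)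
        (hV.fs.left x w).symm
  rw [e1, e1, hA.normSq_mulLeft]
  nlinarith [mul_nonneg (mul_nonneg h0 (sub_nonneg.2 h1)) h2]

variable [MeasurableSpace X] [BorelSpace X] [CompactSpace X]

theorem MemTK.codPair {Ω : VolumeForm n X} {g : Metric n X} {K A V : EndField n X} (hK : SE K)
    (hKev : ∀ᵐ x ∂Ω.measure, HasDistinctEigenvalues (K x)) (hA : MemTK g K A)
    (hV : MemTK g K V) : CodPair g.field A V :=
  ⟨g.mF, hA.isCod, hV.isCod, MemTK.cC hK hKev hA hA, MemTK.cC hK hKev hA hV,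
    MemTK.cC hK hKev hV hV⟩

theorem integral_secondVar [T2Space X] (Ω : VolumeForm n X) {g : BilField n X}
    {A V : EndField n X} (h : CodPair g A V) :
    ∫ x, secondVar Ω g A V x ∂Ω.measure =
      2 * ∫ x, innerEnd g x
        ((-(expEnd A x ∘L divOmega Ω g (mulLeft (expEnd A) (nablaEnd g A)) x)
          + (2 : ℝ) • (expEnd ((2 : ℝ) • A) x ∘L ricciOmegaStar Ω g x)) ∘L V x) (V x) ∂Ω.measure +
      2 * ∫ x, normSq g (nablaEnd g (fun y => expEnd A y ∘L V y)) x ∂Ω.measure := by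
  have i1 := h.sF_secondVar Ω
  have i2 := h.sF_normSq_exp_comp.const_mul 2
  have i3 := (h.met.sF_divV Ω h.sV_field).const_mul 2
  have h1 := integral_divV Ω h.met h.sV_field
  rw [← integral_const_mul 2 fun x => innerEnd g x _ _]
  simp_rw [h.two_mul_innerEnd Ω]
  rw [integral_sub ((i1.sub i2).integrable Ω) (i3.integrable Ω),
    integral_sub (i1.integrable Ω) (i2.integrable Ω), integral_const_mul, integral_const_mul, h1]
  ring

/-- The defining inequality of `TKplus` is tested on U = e^A V, the section that appears in the
pointwise lower bound `CodPair.secondVar_ge`. -/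
theorem integral_secondVar_nonneg {Ω : VolumeForm n X} {g : Metric n X}
    {K A V : EndField n X} (hK : SE K)
    (hKev : ∀ᵐ x ∂Ω.measure, HasDistinctEigenvalues (K x)) (hA : A ∈ TKplus Ω g K)
    (hV : MemTK g K V) : 0 ≤ ∫ x, secondVar Ω g.field A V x ∂Ω.measure := by
  have hA' : MemTK g K A := hA.1
  have hp := hA'.codPair hK hKev hV
  set U : EndField n X := fun y => expEnd A y ∘L V y with hU
  have hUm : MemTK g K U := hA'.exp_comp hV hp
  have hUp := hA'.codPair hK hKev hUm
  have h1 := hA.2 U hUm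
  have i1 : SF n fun x => tr ((U x ∘L U x) ∘L ricciOmegaStar Ω g.field x) :=
    ((hUp.snd.smooth.comp hUp.snd.smooth).comp (g.mF.sE_ricciOmegaStar Ω)).tr
  have i2 := hUp.sF_normSq_mulLeft
  have h2 : ∫ x, (4 * tr ((U x ∘L U x) ∘L ricciOmegaStar Ω g.field x) -
      4 * normSq g.field (mulLeft U (nablaEnd g.field A)) x) ∂Ω.measure ≤
      ∫ x, secondVar Ω g.field A V x ∂Ω.measure :=
    integral_mono (((i1.const_mul 4).sub (i2.const_mul 4)).integrable Ω)
      ((hp.sF_secondVar Ω).integrable Ω) fun x => hp.secondVar_ge hUp (fun _ => rfl) Ω x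
  rw [integral_sub ((i1.const_mul 4).integrable Ω) ((i2.const_mul 4).integrable Ω),
    integral_const_mul, integral_const_mul] at h2
  linarith

theorem TKplus.add_smul_mem {Ω : VolumeForm n X} {g : Metric n X} {K A V : EndField n X}
    (hK : SE K) (hKev : ∀ᵐ x ∂Ω.measure, HasDistinctEigenvalues (K x))
    (hA : A ∈ TKplus Ω g K) (hV : MemTK g K V) (hB : A + (1 : ℝ) • V ∈ TKplus Ω g K) {t : ℝ}
    (h0 : 0 ≤ t) (h1 : t ≤ 1) : A + t • V ∈ TKplus Ω g K := by
  have hA' : MemTK g K A := hA.1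
  refine ⟨hA'.add_smul hV t, fun U hU => ?_⟩
  have hC : ∀ t : ℝ, CodPair g.field (A + t • V) U := fun t =>
    (hA'.add_smul hV t).codPair hK hKev hU
  have pA := hA'.codPair hK hKev hU
  have i0 := (pA.sF_normSq_mulLeft.const_mul (1 - t))
  have i1 := ((hC 1).sF_normSq_mulLeft.const_mul t)
  have h2 := integral_mono ((hC t).sF_normSq_mulLeft.integrable Ω) ((i0.add i1).integrable Ω)
    (normSq_mulLeft_add_smul_le pA (hV.codPair hK hKev hU) (hA'.codPair hK hKev hV) hC h0 h1)
  rw [integral_add (i0.integrable Ω) (i1.integrable Ω), integral_const_mul,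
    integral_const_mul] at h2
  nlinarith [mul_le_mul_of_nonneg_left (hA.2 U hU) (sub_nonneg.2 h1),
    mul_le_mul_of_nonneg_left (hB.2 U hU) h0]

theorem convexOn_boldW_line [T2Space X] {Ω : VolumeForm n X} {g : Metric n X}
    {K A V : EndField n X} (hK : SE K) (hKev : ∀ᵐ x ∂Ω.measure, HasDistinctEigenvalues (K x))
    (hA : A ∈ TKplus Ω g K) (hV : MemTK g K V) (hB : A + (1 : ℝ) • V ∈ TKplus Ω g K) :
    ConvexOn ℝ (Set.Icc 0 1) fun t : ℝ => boldW Ω g (A + t • V) := by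
  have hA' : MemTK g K A := hA.1
  have hd := (boldW_add_smul (Ω := Ω) hK hKev hA' hV).1
  have hd' := hd
  -- Class C² is written as C^{1+1} so that the first derivative can be peeled off and seen to be
  -- differentiable.
  rw [← one_add_one_eq_two] at hd'
  refine convexOn_of_deriv2_nonneg' (convex_Icc 0 1)
    (hd.differentiable (by simp)).differentiableOn
    ((contDiff_succ_iff_deriv.1 hd').2.2.differentiable (by simp)).differentiableOn
    fun t ht => ?_
  -- The second derivative at t is the one at 0 with base point A + tV, and this point lies in
  -- `TKplus` by its convexity.
  rw [← iteratedDeriv_eq_iterate]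
  have h1 := congrFun (iteratedDeriv_comp_const_add 2 (fun t : ℝ => boldW Ω g (A + t • V)) t) 0
  rw [add_zero] at h1
  have h2 : (fun s : ℝ => boldW Ω g (A + (t + s) • V)) =
      fun s : ℝ => boldW Ω g ((A + t • V) + s • V) := by
    funext s
    rw [add_smul, add_assoc]
  rw [← h1, h2, (boldW_add_smul hK hKev (hA'.add_smul hV t) hV).2]
  exact integral_secondVar_nonneg hK hKev
    (TKplus.add_smul_mem hK hKev hA hV hB ht.1 ht.2) hV

end

end SolitonRicci

end

/-! ### Second variation formula and convexity of the functional -/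

theorem mainTheorem6 {n : ℕ} {X : Type*} [TopologicalSpace X] [T2Space X] [CompactSpace X]
    [ChartedSpace (SolitonRicci.E n) X] [IsManifold (𝓡 n) ∞ X]
    [MeasurableSpace X] [BorelSpace X]
    (Ω : SolitonRicci.VolumeForm n X)
    (K : SolitonRicci.EndField n X) (hK : SolitonRicci.SmoothEnd K)
    (hKev : ∀ᵐ x ∂Ω.measure, SolitonRicci.HasDistinctEigenvalues (K x))
    (g₀ : SolitonRicci.Metric n X) :
    (∀ A ∈ SolitonRicci.TK g₀ K, ∀ V ∈ SolitonRicci.TK g₀ K,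
      ContDiff ℝ 2 (fun t : ℝ => SolitonRicci.boldW Ω g₀ (A + t • V)) ∧
      iteratedDeriv 2 (fun t : ℝ => SolitonRicci.boldW Ω g₀ (A + t • V)) 0 =
        2 * ∫ x, SolitonRicci.innerEnd g₀.field x
              ((-(SolitonRicci.expEnd A x ∘L
                    SolitonRicci.divOmega Ω g₀.field
                      (SolitonRicci.mulLeft (SolitonRicci.expEnd A)
                        (SolitonRicci.nablaEnd g₀.field A)) x)
                  + (2 : ℝ) • (SolitonRicci.expEnd ((2 : ℝ) • A) x ∘L
                      SolitonRicci.ricciOmegaStar Ω g₀.field x)) ∘L V x)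
              (V x) ∂Ω.measure
        + 2 * ∫ x, SolitonRicci.normSq g₀.field
              (SolitonRicci.nablaEnd g₀.field
                (fun y => SolitonRicci.expEnd A y ∘L V y)) x ∂Ω.measure) ∧
    ((∀ (x : X) (v : SolitonRicci.E n), v ≠ 0 →
        0 < SolitonRicci.ricciOmega Ω g₀.field x v v) →
      ConvexOn ℝ (SolitonRicci.TKplus Ω g₀ K) (SolitonRicci.boldW Ω g₀)) := by
  have hK' : SolitonRicci.SE K := (SolitonRicci.smoothEnd_iff K).1 hK
  constructor
  · intro A hA V hV
    have h := SolitonRicci.boldW_add_smul hK' hKev hA hV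
    exact ⟨h.1, h.2.trans
      (SolitonRicci.integral_secondVar Ω (SolitonRicci.MemTK.codPair hK' hKev hA hV))⟩
  · intro _
    -- The witness is V = B - A. The endpoint is kept in the form A + 1 • V so that both points lie
    -- on the line t ↦ A + tV.
    have key : ∀ A ∈ SolitonRicci.TKplus Ω g₀ K, ∀ B ∈ SolitonRicci.TKplus Ω g₀ K,
        ∃ V, SolitonRicci.MemTK g₀ K V ∧ B = A + (1 : ℝ) • V ∧
          ∀ a b : ℝ, a + b = 1 → a • A + b • B = A + b • V := fun A hA B hB => by
      refine ⟨B + (-1 : ℝ) • A, SolitonRicci.MemTK.add_smul hB.1 hA.1 (-1), by module,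
        fun a b hab => ?_⟩
      obtain rfl : a = 1 - b := by linarith
      module
    refine ⟨fun A hA B hB a b ha hb hab => ?_, fun A hA B hB a b ha hb hab => ?_⟩
    · obtain ⟨V, hV, rfl, h⟩ := key A hA B hB
      rw [h a b hab]
      exact SolitonRicci.TKplus.add_smul_mem hK' hKev hA hV hB hb (by linarith)
    · obtain ⟨V, hV, rfl, h⟩ := key A hA B hB
      rw [h a b hab]
      have h1 := (SolitonRicci.convexOn_boldW_line hK' hKev hA hV hB).2
        (Set.left_mem_Icc.2 zero_le_one) (Set.right_mem_Icc.2 zero_le_one) ha hb hab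
      simpa using h1
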